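/- For a permutation group \(G\le S_n\), let \(P(G)\subset \mathrm{Mat}_n(\mathbb R)\) be the convex hull of the permutation matrices of the elements of \(G\). For a real representation \(\rho\) of a finite group \(G\), let \(\ker^\circ\rho=\{\sum_g\lambda_g g\in\mathbb R[G] : \sum_g\lambda_g\rho(g)=0,\ \sum_g\lambda_g=0\}\); a finite-dimensional real representation \(\rho'\) of \(G\) is an affine quotient of \(\rho\) if \(\ker^\circ\rho\subseteq\ker^\circ\rho'\); representations \(\rho_1,\rho_2\) of \(G\) are stably equivalent if there are affine quotients \(\rho_i'\) of \(\rho_i\) with \(\rho_1\oplus\rho_1'\cong\rho_2\oplus\rho_2'\). Permutation groups \(G_1\le S_m\), \(G_2\le S_n\), with permutation representations \(\rho_1,\rho_2\) on \(\mathbb R^m,\mathbb R^n\), are effectively equivalent if there is a group isomorphism \(\phi\colon G_1\to G_2\) such that \(\rho_1\) and \(\rho_2\circ\phi\) are stably equivalent. Two polytopes have the same combinatorial type if their face lattices are isomorphic. **Theorem.** Every permutation group \(G\) with \(2\le\dim P(G)\le 4\) is effectively equivalent to exactly one of the 14 permutation groups in the last column of the following table. Conversely, every permutation group \(G\) that is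 effectively equivalent to the group in some row has \(\dim P(G)\), the combinatorial type of \(P(G)\), and the isomorphism type of \(G\) as listed in that row. \[ \begin{array}{c|l|l|l} \dim & \text{combinatorial type of } P(G) & \text{isomorphism type of } G & \text{effective equivalence type of } G\\\hline 2 & \text{triangle} & \mathbb Z/3 & \langle(1\,2\,3)\rangle\le S_3\\ 2 & \text{square} & (\mathbb Z/2)^2 & \langle(1\,2),(3\,4)\rangle\le S_4\\ 3 & \text{tetrahedron} & \mathbb Z/4 & \langle(1\,2\,3\,4)\rangle\le S_4\\ 3 & \text{tetrahedron} & (\mathbb Z/2)^2 & \langle(1\,2)(3\,4),(1\,3)(2\,4)\rangle\le S_4\\ 3 & \text{triangular prism} & \mathbb Z/6 & \langle(1\,2),(3\,4\,5)\rangle\le S_5\\ 3 & \text{cube} & (\mathbb Z/2)^3 & \langle(1\,2),(3\,4),(5\,6)\rangle\le S_6\\ 4 & 4\text{-simplex} & \mathbb Z/5 & \langle(1\,2\,3\,4\,5)\rangle\le S_5\\ 4 & B_3=P(S_3) & S_3 & \langle(1\,2),(1\,2\,3)\rangle\le S_3\\ 4 & \text{prism over tetrahedron} & \mathbb Z/2\times\mathbb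 Z/4 & \langle(1\,2\,3\,4),(5\,6)\rangle\le S_6\\ 4 & \text{prism over tetrahedron} & (\mathbb Z/2)^3 & \langle(1\,2)(3\,4),(1\,3)(2\,4),(5\,6)\rangle\le S_6\\ 4 & 4\text{-crosspolytope} & (\mathbb Z/2)^3 & \langle(1\,2)(3\,4),(3\,4)(7\,8),(5\,6)(7\,8)\rangle\le S_8\\ 4 & \text{product of two triangles} & (\mathbb Z/3)^2 & \langle(1\,2\,3),(4\,5\,6)\rangle\le S_6\\ 4 & \text{prism over triangular prism} & \mathbb Z/6\times\mathbb Z/2 & \langle(1\,2),(3\,4\,5),(6\,7)\rangle\le S_7\\ 4 & 4\text{-cube} & (\mathbb Z/2)^4 & \langle(1\,2),(3\,4),(5\,6),(7\,8)\rangle\le S_8 \end{array} \] In the remaining dimensions below \(2\): \(\dim P(G)=0\) if and only if \(G\) is trivial, and \(\dim P(G)=1\) if and only if \(G\) is effectively equivalent to \(\langle(1\,2)\rangle\le S_2\). -/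

import Mathlib

/-! ### Polytopes: dimension, faces, combinatorial equivalence -/

/-- The dimension of a polytope: the dimension of its affine hull. -/
noncomputable def polytopeDim {E : Type*} [AddCommGroup E] [Module ℝ E] (P : Set E) : ℕ :=
  Module.finrank ℝ (affineSpan ℝ P).direction

/-- The face lattice of a polytope `P`: the empty face and all the subsets of `P` where some
linear functional is maximized, ordered by inclusion. -/
abbrev FaceLattice {E : Type*} [AddCommGroup E] [Module ℝ E] [TopologicalSpace E]
    (P : Set E) : Type _ :=
  {F : Set E // IsExposed ℝ P F}

/-- Two polytopes are combinatorially equivalent if their face lattices are isomorphic posets. -/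
def CombinatoriallyEquivalent {E F : Type*}
    [AddCommGroup E] [Module ℝ E] [TopologicalSpace E]
    [AddCommGroup F] [Module ℝ F] [TopologicalSpace F] (P : Set E) (Q : Set F) : Prop :=
  Nonempty (FaceLattice P ≃o FaceLattice Q)

/-- The `d`-cube `[0,1]^d`. -/
def cube (d : ℕ) : Set (Fin d → ℝ) := Set.Icc 0 1

/-- The `d`-simplex, as the standard simplex in `ℝ^(d+1)`. -/
def simplex (d : ℕ) : Set (Fin (d + 1) → ℝ) := stdSimplex ℝ (Fin (d + 1))

/-- The `d`-crosspolytope: the convex hull of the vectors `e_i` and `-e_i`. -/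
def crosspolytope (d : ℕ) : Set (Fin d → ℝ) :=
  convexHull ℝ
    (Set.range (fun i : Fin d => (Pi.single i 1 : Fin d → ℝ)) ∪
      Set.range (fun i : Fin d => -(Pi.single i 1 : Fin d → ℝ)))

/-- The prism over a polytope. -/
def prism {E : Type*} (P : Set E) : Set (E × ℝ) := P ×ˢ Set.Icc (0 : ℝ) 1

/-! ### Permutation groups and permutation polytopes -/

/-- The permutation matrix of `σ`, with a `1` in position `(σ j, j)` for each `j`
(Mathlib's `permMatrix` has its ones in the positions `(i, σ i)`). -/
def permMat {n : ℕ} (σ : Equiv.Perm (Fin n)) : Matrix (Fin n) (Fin n) ℝ :=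
  (σ⁻¹).permMatrix ℝ

/-- The permutation polytope `P(G)`: the convex hull of the permutation matrices of the
elements of `G ≤ S_n`. -/
def permPolytope {n : ℕ} (G : Subgroup (Equiv.Perm (Fin n))) : Set (Matrix (Fin n) (Fin n) ℝ) :=
  convexHull ℝ (permMat '' (G : Set (Equiv.Perm (Fin n))))

/-- The Birkhoff polytope `B_n = P(S_n)`. -/
def birkhoffPolytope (n : ℕ) : Set (Matrix (Fin n) (Fin n) ℝ) :=
  permPolytope (⊤ : Subgroup (Equiv.Perm (Fin n)))

/-- The real representation of a permutation group `G ≤ S_n` on `ℝ^n` by permutation matrices. -/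
noncomputable def permRep {n : ℕ} (G : Subgroup (Equiv.Perm (Fin n))) :
    Representation ℝ G (Fin n → ℝ) where
  toFun g := Matrix.toLin' (permMat (g : Equiv.Perm (Fin n)))
  map_one' := by
    simp only [permMat, Subgroup.coe_one, inv_one, Matrix.permMatrix_one, Matrix.toLin'_one]
    rfl
  map_mul' g h := by
    simp only [permMat, Subgroup.coe_mul, mul_inv_rev, Matrix.permMatrix_mul, Matrix.toLin'_mul]
    rfl

/-! ### Stable and effective equivalence -/

/-- The affine kernel of a representation `ρ`: all `∑ λ_g g` in the group algebra `ℝ[G]` with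
`∑ λ_g ρ(g) = 0` and `∑ λ_g = 0`. -/
def affineKernel {G V : Type*} [Group G] [AddCommGroup V] [Module ℝ V]
    (ρ : Representation ℝ G V) : Set (MonoidAlgebra ℝ G) :=
  {x | (x.coeff.sum fun g a => a • ρ g) = 0 ∧ (x.coeff.sum fun _ a => a) = 0}

/-- `ρ'` is an affine quotient of `ρ` if the affine kernel of `ρ` is contained in the affine
kernel of `ρ'`. -/
def IsAffineQuotient {G V V' : Type*} [Group G] [AddCommGroup V] [Module ℝ V]
    [AddCommGroup V'] [Module ℝ V']
    (ρ' : Representation ℝ G V') (ρ : Representation ℝ G V) : Prop :=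
  affineKernel ρ ⊆ affineKernel ρ'

/-- `ρ₁` and `ρ₂` are stably equivalent if there are finite-dimensional affine quotients `ρ₁'` of
`ρ₁` and `ρ₂'` of `ρ₂` such that `ρ₁ ⊕ ρ₁'` and `ρ₂ ⊕ ρ₂'` are isomorphic representations. -/
def StablyEquivalent {G V₁ V₂ : Type} [Group G] [AddCommGroup V₁] [Module ℝ V₁]
    [AddCommGroup V₂] [Module ℝ V₂]
    (ρ₁ : Representation ℝ G V₁) (ρ₂ : Representation ℝ G V₂) : Prop :=
  ∃ (W₁ W₂ : Type) (_ : AddCommGroup W₁) (_ : Module ℝ W₁) (_ : FiniteDimensional ℝ W₁)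
    (_ : AddCommGroup W₂) (_ : Module ℝ W₂) (_ : FiniteDimensional ℝ W₂)
    (ρ₁' : Representation ℝ G W₁) (ρ₂' : Representation ℝ G W₂),
    IsAffineQuotient ρ₁' ρ₁ ∧ IsAffineQuotient ρ₂' ρ₂ ∧
      Nonempty ((ρ₁.prod ρ₁').Equiv (ρ₂.prod ρ₂'))

/-- Permutation groups `G₁ ≤ S_m` and `G₂ ≤ S_n` are effectively equivalent if, for some group
isomorphism `φ : G₁ ≃ G₂`, the permutation representation `ρ₁` of `G₁` and the pullback `ρ₂ ∘ φ` of
the permutation representation of `G₂` are stably equivalent. -/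
def EffectivelyEquivalent {m n : ℕ} (G₁ : Subgroup (Equiv.Perm (Fin m)))
    (G₂ : Subgroup (Equiv.Perm (Fin n))) : Prop :=
  ∃ φ : G₁ ≃* G₂, StablyEquivalent (permRep G₁) ((permRep G₂).comp φ.toMonoidHom)

/-! ### The table -/

/-- The rows of the table. -/
inductive TableRow
  | triangle
  | square
  | tetrahedronCyclic
  | tetrahedronKlein
  | triangularPrism
  | cube3
  | simplex4
  | birkhoff3
  | tetrahedralPrismZ2Z4
  | tetrahedralPrismZ2Cubed
  | crosspolytope4
  | productOfTriangles
  | prismOverTriangularPrism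
  | cube4

namespace TableRow

/-- The dimension of the polytope of a row. -/
def dim : TableRow → ℕ
  | triangle => 2
  | square => 2
  | tetrahedronCyclic => 3
  | tetrahedronKlein => 3
  | triangularPrism => 3
  | cube3 => 3
  | simplex4 => 4
  | birkhoff3 => 4
  | tetrahedralPrismZ2Z4 => 4
  | tetrahedralPrismZ2Cubed => 4
  | crosspolytope4 => 4
  | productOfTriangles => 4
  | prismOverTriangularPrism => 4
  | cube4 => 4

/-- The combinatorial type column: the polytope `P` has the combinatorial type listed in the
row. -/
def HasCombType {E : Type*} [AddCommGroup E] [Module ℝ E] [TopologicalSpace E] (P : Set E) :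
    TableRow → Prop
  | triangle => CombinatoriallyEquivalent P (simplex 2)
  | square => CombinatoriallyEquivalent P (cube 2)
  | tetrahedronCyclic => CombinatoriallyEquivalent P (simplex 3)
  | tetrahedronKlein => CombinatoriallyEquivalent P (simplex 3)
  | triangularPrism => CombinatoriallyEquivalent P (prism (simplex 2))
  | cube3 => CombinatoriallyEquivalent P (cube 3)
  | simplex4 => CombinatoriallyEquivalent P (simplex 4)
  | birkhoff3 => CombinatoriallyEquivalent P (birkhoffPolytope 3)
  | tetrahedralPrismZ2Z4 => CombinatoriallyEquivalent P (prism (simplex 3))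
  | tetrahedralPrismZ2Cubed => CombinatoriallyEquivalent P (prism (simplex 3))
  | crosspolytope4 => CombinatoriallyEquivalent P (crosspolytope 4)
  | productOfTriangles => CombinatoriallyEquivalent P (simplex 2 ×ˢ simplex 2)
  | prismOverTriangularPrism => CombinatoriallyEquivalent P (prism (prism (simplex 2)))
  | cube4 => CombinatoriallyEquivalent P (cube 4)

/-- The isomorphism type column: the group `H` has the isomorphism type listed in the row. -/
def HasIsoType (H : Type*) [Group H] : TableRow → Prop
  | triangle => Nonempty (H ≃* Multiplicative (ZMod 3))
  | square => Nonempty (H ≃* Multiplicative (Fin 2 → ZMod 2))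
  | tetrahedronCyclic => Nonempty (H ≃* Multiplicative (ZMod 4))
  | tetrahedronKlein => Nonempty (H ≃* Multiplicative (Fin 2 → ZMod 2))
  | triangularPrism => Nonempty (H ≃* Multiplicative (ZMod 6))
  | cube3 => Nonempty (H ≃* Multiplicative (Fin 3 → ZMod 2))
  | simplex4 => Nonempty (H ≃* Multiplicative (ZMod 5))
  | birkhoff3 => Nonempty (H ≃* Equiv.Perm (Fin 3))
  | tetrahedralPrismZ2Z4 => Nonempty (H ≃* Multiplicative (ZMod 2 × ZMod 4))
  | tetrahedralPrismZ2Cubed => Nonempty (H ≃* Multiplicative (Fin 3 → ZMod 2))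
  | crosspolytope4 => Nonempty (H ≃* Multiplicative (Fin 3 → ZMod 2))
  | productOfTriangles => Nonempty (H ≃* Multiplicative (Fin 2 → ZMod 3))
  | prismOverTriangularPrism => Nonempty (H ≃* Multiplicative (ZMod 6 × ZMod 2))
  | cube4 => Nonempty (H ≃* Multiplicative (Fin 4 → ZMod 2))

/-- The number of points on which the group of a row acts. -/
def degree : TableRow → ℕ
  | triangle => 3
  | square => 4
  | tetrahedronCyclic => 4
  | tetrahedronKlein => 4
  | triangularPrism => 5
  | cube3 => 6
  | simplex4 => 5
  | birkhoff3 => 3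
  | tetrahedralPrismZ2Z4 => 6
  | tetrahedralPrismZ2Cubed => 6
  | crosspolytope4 => 8
  | productOfTriangles => 6
  | prismOverTriangularPrism => 7
  | cube4 => 8

/-- The effective equivalence type column: the permutation group of the row, by generators in
cycle notation. The points `1, …, n` of the table are here the elements `0, …, n - 1` of `Fin n`. -/
def group : (r : TableRow) → Subgroup (Equiv.Perm (Fin r.degree))
  | triangle =>
      (Subgroup.closure {c[0, 1, 2]} :
      Subgroup (Equiv.Perm (Fin 3)))
  | square =>
      (Subgroup.closure {c[0, 1], c[2, 3]} :
      Subgroup (Equiv.Perm (Fin 4)))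
  | tetrahedronCyclic =>
      (Subgroup.closure {c[0, 1, 2, 3]} :
      Subgroup (Equiv.Perm (Fin 4)))
  | tetrahedronKlein =>
      (Subgroup.closure {c[0, 1] * c[2, 3], c[0, 2] * c[1, 3]} :
      Subgroup (Equiv.Perm (Fin 4)))
  | triangularPrism =>
      (Subgroup.closure {c[0, 1], c[2, 3, 4]} :
      Subgroup (Equiv.Perm (Fin 5)))
  | cube3 =>
      (Subgroup.closure {c[0, 1], c[2, 3], c[4, 5]} :
      Subgroup (Equiv.Perm (Fin 6)))
  | simplex4 =>
      (Subgroup.closure {c[0, 1, 2, 3, 4]} :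
      Subgroup (Equiv.Perm (Fin 5)))
  | birkhoff3 =>
      (Subgroup.closure {c[0, 1], c[0, 1, 2]} :
      Subgroup (Equiv.Perm (Fin 3)))
  | tetrahedralPrismZ2Z4 =>
      (Subgroup.closure {c[0, 1, 2, 3], c[4, 5]} :
      Subgroup (Equiv.Perm (Fin 6)))
  | tetrahedralPrismZ2Cubed =>
      (Subgroup.closure {c[0, 1] * c[2, 3], c[0, 2] * c[1, 3], c[4, 5]} :
      Subgroup (Equiv.Perm (Fin 6)))
  | crosspolytope4 =>
      (Subgroup.closure {c[0, 1] * c[2, 3], c[2, 3] * c[6, 7], c[4, 5] * c[6, 7]} :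
      Subgroup (Equiv.Perm (Fin 8)))
  | productOfTriangles =>
      (Subgroup.closure {c[0, 1, 2], c[3, 4, 5]} :
      Subgroup (Equiv.Perm (Fin 6)))
  | prismOverTriangularPrism =>
      (Subgroup.closure {c[0, 1], c[2, 3, 4], c[5, 6]} :
      Subgroup (Equiv.Perm (Fin 7)))
  | cube4 =>
      (Subgroup.closure {c[0, 1], c[2, 3], c[4, 5], c[6, 7]} :
      Subgroup (Equiv.Perm (Fin 8)))

end TableRow

/-! Everything is read off from the sum-zero linear relations `affDep` among the permutation
matrices of the group elements. The affine kernel of a direct sum is the intersection of the affine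
kernels, so two representations are stably equivalent exactly when their affine kernels coincide
(`stablyEquivalent_iff`). Hence an effective equivalence is a group isomorphism that matches these
relations. The relations determine the polytope up to affine isomorphism, in particular its
dimension and its face lattice.

For abelian `G`, Fourier analysis identifies the complexified relations with the annihilator of
`charSet`, the characters trivial on some point stabilizer together with the trivial one. Therefore
`dim P(G) + 1 = |charSet|`. The set contains the trivial character, is closed under powers and
generates the dual group because the action is faithful. By duality, `G` is determined up to
effective equivalence by the pair (dual group, `charSet`). The theorem thus becomes a classification
of generating subsets with three to five elements that contain zero and are closed under multiples
(`exists_model`). It yields 13 pairs, and each is realized by the group of its row.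

For nonabelian `G` with `dim P(G) ≤ 4`, some point stabilizer moves a point of its own orbit;
otherwise `G` acts on every orbit through a group of order at most five, hence commutatively. An
orbit of `m` points of this kind forces dimension greater than `m` and has at least three points, so
`m = 3`, the dimension is four, and `G` is `S_3` acting on that orbit
(`effectivelyEquivalent_birkhoff3`).

The rows are distinguished by dimension, group order and the existence of an element of order four.
The one remaining pair, the crosspolytope and the prism over the tetrahedron with group `(ℤ/2)³`, is
separated by central symmetry of the polytope. -/

/-- The sum-zero linear dependencies of a finite family of vectors. -/
def affDep {ι E : Type*} [Fintype ι] [AddCommGroup E] [Module ℝ E] (v : ι → E) :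
    Submodule ℝ (ι → ℝ) where
  carrier := {x | ∑ i, x i • v i = 0 ∧ ∑ i, x i = 0}
  add_mem' := by
    rintro x y ⟨hx, hx'⟩ ⟨hy, hy'⟩
    simp [add_smul, Finset.sum_add_distrib, hx, hx', hy, hy']
  zero_mem' := by simp
  smul_mem' := by
    rintro c x ⟨hx, hx'⟩
    simp [mul_smul, ← Finset.smul_sum, ← Finset.mul_sum, hx, hx']

/-! ### Affine dependencies and the dimension of a convex hull. -/

section AffDep

variable {ι E F : Type*} [Fintype ι] [AddCommGroup E] [Module ℝ E] [AddCommGroup F] [Module ℝ F]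

theorem mem_affDep {v : ι → E} {x : ι → ℝ} :
    x ∈ affDep v ↔ ∑ i, x i • v i = 0 ∧ ∑ i, x i = 0 := Iff.rfl

theorem mem_vectorSpan_range_iff {v : ι → E} {y : E} :
    y ∈ vectorSpan ℝ (Set.range v) ↔ ∃ x : ι → ℝ, ∑ i, x i = 0 ∧ ∑ i, x i • v i = y := by
  classical
  constructor
  · intro h
    obtain ⟨s, w, hw, rfl⟩ := (mem_vectorSpan_iff_eq_weightedVSub ℝ).1 h
    refine ⟨fun i => if i ∈ s then w i else 0, by simpa using hw, ?_⟩
    rw [s.weightedVSub_eq_linear_combination hw]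
    simp
  · rintro ⟨x, hx, rfl⟩
    exact (mem_vectorSpan_iff_eq_weightedVSub ℝ).2
      ⟨Finset.univ, x, hx, (Finset.univ.weightedVSub_eq_linear_combination hx).symm⟩

theorem polytopeDim_convexHull_range {ι E : Type*} [AddCommGroup E] [Module ℝ E] (v : ι → E) :
    polytopeDim (convexHull ℝ (Set.range v)) =
      Module.finrank ℝ (vectorSpan ℝ (Set.range v)) := by
  rw [polytopeDim, affineSpan_convexHull, direction_affineSpan]

/-- Rank-nullity for the linear combination map restricted to coefficients of sum zero: the domain
has dimension `card ι - 1`, the image is the direction space of the hull, and the kernel is `affDep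
v`. -/
theorem polytopeDim_add_finrank_affDep [Nonempty ι] (v : ι → E) :
    polytopeDim (convexHull ℝ (Set.range v)) + Module.finrank ℝ (affDep v) + 1 =
      Fintype.card ι := by
  classical
  let s : (ι → ℝ) →ₗ[ℝ] ℝ := Fintype.linearCombination ℝ (fun _ => (1 : ℝ))
  have hs : ∀ x, s x = ∑ i, x i := fun x => by simp [s, Fintype.linearCombination_apply]
  let M := (Fintype.linearCombination ℝ v).domRestrict (LinearMap.ker s)
  have hM : ∀ x, M x = ∑ i, x.1 i • v i := fun x => by simp [M, Fintype.linearCombination_apply]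
  have hsurj : LinearMap.range s = ⊤ := by
    rw [LinearMap.range_eq_top]
    intro c
    obtain ⟨i⟩ := ‹Nonempty ι›
    exact ⟨Pi.single i c, by rw [hs]; simp⟩
  have h1 := LinearMap.finrank_range_add_finrank_ker s
  rw [hsurj, finrank_top, Module.finrank_self, Module.finrank_fintype_fun_eq_card] at h1
  have h2 := LinearMap.finrank_range_add_finrank_ker M
  have h3 : LinearMap.range M = vectorSpan ℝ (Set.range v) := by
    ext y
    rw [mem_vectorSpan_range_iff]
    constructor
    · rintro ⟨x, rfl⟩
      exact ⟨x, by rw [← hs]; exact x.2, (hM x).symm⟩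
    · rintro ⟨x, hx, rfl⟩
      exact ⟨⟨x, by rw [LinearMap.mem_ker, hs, hx]⟩, hM _⟩
  have h4 : (LinearMap.ker M).map (LinearMap.ker s).subtype = affDep v := by
    ext x
    simp only [Submodule.mem_map, LinearMap.mem_ker, mem_affDep]
    constructor
    · rintro ⟨y, hy, rfl⟩
      exact ⟨by rw [← hy, hM]; rfl, by rw [← hs]; exact y.2⟩
    · rintro ⟨hx, hx'⟩
      exact ⟨⟨x, by rw [LinearMap.mem_ker, hs, hx']⟩, by rw [hM]; exact hx, rfl⟩
  have h5 := Submodule.finrank_map_subtype_eq (LinearMap.ker s) (LinearMap.ker M)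
  rw [h4] at h5
  rw [polytopeDim_convexHull_range, ← h3, h5]
  omega

theorem sum_sub_single_smul [DecidableEq ι] (u : ι → E) (x : ι → ℝ) (i₀ : ι) :
    ∑ i, (x - Pi.single i₀ (∑ j, x j) : ι → ℝ) i • u i = ∑ i, x i • (u i - u i₀) := by
  simp [sub_smul, smul_sub, Finset.sum_sub_distrib, Pi.single_apply, Finset.sum_smul]

/-- A linear map that realizes an inclusion of sum-zero dependencies. -/
theorem exists_linearMap_of_affDep_le {v : ι → E} {w : ι → F} (h : affDep v ≤ affDep w) (i₀ : ι) :
    ∃ T : E →ₗ[ℝ] F, ∀ i, T (v i - v i₀) = w i - w i₀ := by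
  classical
  let Lv := Fintype.linearCombination ℝ (fun i => v i - v i₀)
  let Lw := Fintype.linearCombination ℝ (fun i => w i - w i₀)
  have key : LinearMap.ker Lv ≤ LinearMap.ker Lw := by
    intro x hx
    rw [LinearMap.mem_ker, Fintype.linearCombination_apply] at hx ⊢
    -- Changing the coefficient at `i₀` makes the total zero and does not affect a combination of
    -- the differences from `v i₀`.
    have h1 : x - Pi.single i₀ (∑ j, x j) ∈ affDep v :=
      ⟨by rw [sum_sub_single_smul]; exact hx, by simp⟩
    rw [← sum_sub_single_smul]
    exact (h h1).1
  obtain ⟨s, hs⟩ := LinearMap.exists_rightInverse_of_surjective Lv.rangeRestrict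
    (LinearMap.range_rangeRestrict _)
  obtain ⟨T, hT⟩ := LinearMap.exists_extend (Lw ∘ₗ s)
  refine ⟨T, fun i => ?_⟩
  have h1 : ∀ x, T (Lv x) = Lw x := by
    intro x
    have h2 : T (Lv x) = Lw (s (Lv.rangeRestrict x)) :=
      LinearMap.congr_fun hT (Lv.rangeRestrict x)
    have h3 : s (Lv.rangeRestrict x) - x ∈ LinearMap.ker Lw := by
      apply key
      have := congrArg Subtype.val (LinearMap.congr_fun hs (Lv.rangeRestrict x))
      simp only [LinearMap.comp_apply, LinearMap.id_apply] at this
      rw [LinearMap.mem_ker, map_sub, sub_eq_zero]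
      exact this
    rw [h2]
    exact sub_eq_zero.1 (by rw [← map_sub]; exact h3)
  have := h1 (Pi.single i 1)
  simpa [Lv, Lw, Fintype.linearCombination_apply, Pi.single_apply, Finset.sum_ite_eq] using this

end AffDep

/-! ### Equal affine dependencies give isomorphic face lattices. -/

section Combinatorial

variable {E F : Type*} [AddCommGroup E] [Module ℝ E] [TopologicalSpace E]
  [AddCommGroup F] [Module ℝ F] [TopologicalSpace F]

/-- A functional exposing `A` is pulled back along the linear part `S` of the inverse map; the
translation by `c` only adds a constant. The empty face needs no functional, by the definition of
`IsExposed`. -/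
theorem isExposed_image {P : Set E} {Q : Set F} {τ : E → F} (S : F →L[ℝ] E) (c : E)
    (hτ : Set.MapsTo τ P Q) (hσ : Set.MapsTo (fun y => S y + c) Q P)
    (h1 : ∀ x ∈ P, S (τ x) + c = x) (h2 : ∀ y ∈ Q, τ (S y + c) = y)
    {A : Set E} (hA : IsExposed ℝ P A) : IsExposed ℝ Q (τ '' A) := by
  rintro ⟨_, a, ha, rfl⟩
  obtain ⟨l, rfl⟩ := hA ⟨a, ha⟩
  refine ⟨l.comp S, ?_⟩
  ext z
  constructor
  · rintro ⟨x, ⟨hx, hmax⟩, rfl⟩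
    refine ⟨hτ hx, fun y hy => ?_⟩
    have := hmax _ (hσ hy)
    rw [← h1 x hx] at this
    simpa using this
  · rintro ⟨hz, hmax⟩
    refine ⟨S z + c, ⟨hσ hz, fun y hy => ?_⟩, h2 z hz⟩
    have := hmax _ (hτ hy)
    rw [← h1 y hy]
    simpa using this

/-- The two affine maps need to be mutually inverse only on `P` and `Q`, so the ambient spaces may
have different dimensions. -/
theorem combinatoriallyEquivalent_of_maps {P : Set E} {Q : Set F} (T : E →L[ℝ] F) (b : F)
    (S : F →L[ℝ] E) (c : E)
    (hτ : Set.MapsTo (fun x => T x + b) P Q) (hσ : Set.MapsTo (fun y => S y + c) Q P)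
    (h1 : ∀ x ∈ P, S (T x + b) + c = x) (h2 : ∀ y ∈ Q, T (S y + c) + b = y) :
    CombinatoriallyEquivalent P Q := by
  have e1 : ∀ A ⊆ P, (fun y => S y + c) '' ((fun x => T x + b) '' A) = A := by
    intro A hA
    rw [Set.image_image]
    exact (Set.image_congr fun x hx => h1 x (hA hx)).trans (Set.image_id _)
  have e2 : ∀ A ⊆ Q, (fun x => T x + b) '' ((fun y => S y + c) '' A) = A := by
    intro A hA
    rw [Set.image_image]
    exact (Set.image_congr fun x hx => h2 x (hA hx)).trans (Set.image_id _)
  refine ⟨{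
    toFun := fun A => ⟨(fun x => T x + b) '' A.1, isExposed_image S c hτ hσ h1 h2 A.2⟩
    invFun := fun B => ⟨(fun y => S y + c) '' B.1, isExposed_image T b hσ hτ h2 h1 B.2⟩
    left_inv := fun A => Subtype.ext (e1 _ A.2.subset)
    right_inv := fun B => Subtype.ext (e2 _ B.2.subset)
    map_rel_iff' := ?_ }⟩
  intro A B
  constructor
  · intro h
    have : (fun y => S y + c) '' ((fun x => T x + b) '' A.1) ⊆
        (fun y => S y + c) '' ((fun x => T x + b) '' B.1) := Set.image_mono h
    rwa [e1 _ A.2.subset, e1 _ B.2.subset] at this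
  · intro h
    exact Set.image_mono h

theorem mapsTo_convexHull_range {ι E F : Type*} [AddCommGroup E] [Module ℝ E] [AddCommGroup F]
    [Module ℝ F] {v : ι → E} {w : ι → F} (T : E →ₗ[ℝ] F) (b : F) (h : ∀ i, T (v i) + b = w i) :
    Set.MapsTo (fun x => T x + b) (convexHull ℝ (Set.range v)) (convexHull ℝ (Set.range w)) := by
  intro x hx
  have h1 : Convex ℝ ((fun x => T x + b) ⁻¹' convexHull ℝ (Set.range w)) := by
    intro x hx y hy s t hs ht hst
    have := convex_convexHull ℝ (Set.range w) hx hy hs ht hst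
    have e : T (s • x + t • y) + b = s • (T x + b) + t • (T y + b) := by
      rw [smul_add, smul_add, add_add_add_comm, ← add_smul, hst, one_smul, map_add, map_smul,
        map_smul]
    exact (congrArg (· ∈ convexHull ℝ (Set.range w)) e).mpr this
  refine convexHull_min ?_ h1 hx
  rintro _ ⟨i, rfl⟩
  exact subset_convexHull ℝ _ ⟨i, (h i).symm⟩

theorem eq_on_convexHull_range {ι E : Type*} [AddCommGroup E] [Module ℝ E]
    {v : ι → E} (T : E →ₗ[ℝ] E) (b : E) (h : ∀ i, T (v i) + b = v i) :
    ∀ x ∈ convexHull ℝ (Set.range v), T x + b = x := by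
  intro x hx
  have h1 : Convex ℝ {x | T x + b = x} := by
    intro x hx y hy s t hs ht hst
    simp only [Set.mem_ofPred_eq] at hx hy ⊢
    nth_rw 2 [← hx, ← hy]
    rw [smul_add, smul_add, add_add_add_comm, ← add_smul, hst, one_smul, map_add, map_smul,
        map_smul]
  refine convexHull_min ?_ h1 hx
  rintro _ ⟨i, rfl⟩
  exact h i

/-- Each inclusion of dependencies yields a linear map on differences. Corrected by translations,
the two maps exchange `v i` and `w i`, hence are inverse to each other on the convex hulls. -/
theorem combinatoriallyEquivalent_of_affDep_eq {ι : Type*} [Fintype ι] [Nonempty ι]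
    [IsTopologicalAddGroup E] [ContinuousSMul ℝ E] [T2Space E] [FiniteDimensional ℝ E]
    [IsTopologicalAddGroup F] [ContinuousSMul ℝ F] [T2Space F] [FiniteDimensional ℝ F]
    {v : ι → E} {w : ι → F} (h : affDep v = affDep w) :
    CombinatoriallyEquivalent (convexHull ℝ (Set.range v)) (convexHull ℝ (Set.range w)) := by
  obtain ⟨i₀⟩ := ‹Nonempty ι›
  obtain ⟨T, hT⟩ := exists_linearMap_of_affDep_le h.le i₀
  obtain ⟨S, hS⟩ := exists_linearMap_of_affDep_le h.ge i₀
  have hT' : ∀ i, T (v i) + (w i₀ - T (v i₀)) = w i := fun i => by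
    have := hT i
    rw [map_sub] at this
    rw [add_sub, add_sub_right_comm, this, sub_add_cancel]
  have hS' : ∀ i, S (w i) + (v i₀ - S (w i₀)) = v i := fun i => by
    have := hS i
    rw [map_sub] at this
    rw [add_sub, add_sub_right_comm, this, sub_add_cancel]
  refine combinatoriallyEquivalent_of_maps (LinearMap.toContinuousLinearMap T)
    (w i₀ - T (v i₀)) (LinearMap.toContinuousLinearMap S) (v i₀ - S (w i₀))
    (mapsTo_convexHull_range T _ hT') (mapsTo_convexHull_range S _ hS') ?_ ?_
  · intro x hx
    have := eq_on_convexHull_range (v := v) (S ∘ₗ T) (S (w i₀ - T (v i₀)) + (v i₀ - S (w i₀)))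
      (fun i => by
        rw [LinearMap.comp_apply, ← add_assoc, ← map_add, hT', hS']) x hx
    rw [LinearMap.comp_apply, ← add_assoc, ← map_add] at this
    exact this
  · intro x hx
    have := eq_on_convexHull_range (v := w) (T ∘ₗ S) (T (v i₀ - S (w i₀)) + (w i₀ - T (v i₀)))
      (fun i => by
        rw [LinearMap.comp_apply, ← add_assoc, ← map_add, hS', hT']) x hx
    rw [LinearMap.comp_apply, ← add_assoc, ← map_add] at this
    exact this

end Combinatorial

/-! ### Effective equivalence as equality of affine dependencies. -/

theorem permMat_apply {n : ℕ} (σ : Equiv.Perm (Fin n)) (i j : Fin n) :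
    permMat σ i j = if σ j = i then 1 else 0 := by
  simp [permMat, Equiv.Perm.permMatrix, PEquiv.toMatrix_apply, Equiv.symm_apply_eq, eq_comm (a :=
      i)]

/-- The permutation matrices of a finite group acting on `n` points. -/
def actMat {H : Type*} [Group H] {n : ℕ} (f : H →* Equiv.Perm (Fin n)) (h : H) :
    Matrix (Fin n) (Fin n) ℝ :=
  permMat (f h)

section Act

variable {H : Type*} [Group H] [Fintype H] {n : ℕ} (f : H →* Equiv.Perm (Fin n))

theorem mem_affDep_actMat {x : H → ℝ} :
    x ∈ affDep (actMat f) ↔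
      (∀ i j, ∑ h, (if f h j = i then x h else 0) = 0) ∧ ∑ h, x h = 0 := by
  rw [mem_affDep, ← Matrix.ext_iff]
  simp [Matrix.sum_apply, actMat, permMat_apply]

end Act

theorem permPolytope_eq {n : ℕ} (G : Subgroup (Equiv.Perm (Fin n))) :
    permPolytope G = convexHull ℝ (Set.range (actMat G.subtype)) := by
  rw [permPolytope]
  congr 1
  ext M
  simp [actMat]

theorem mem_affineKernel_permRep {n : ℕ} (G : Subgroup (Equiv.Perm (Fin n))) [Fintype G]
    {H : Type*} [Group H] [Fintype H] (φ : H ≃* G) (x : MonoidAlgebra ℝ H) :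
    x ∈ affineKernel ((permRep G).comp φ.toMonoidHom) ↔
      (x.coeff : H → ℝ) ∈ affDep (actMat (G.subtype.comp φ.toMonoidHom)) := by
  have h1 : (x.coeff.sum fun g a => a • ((permRep G).comp φ.toMonoidHom) g) =
      Matrix.toLin' (∑ g, x.coeff g • actMat (G.subtype.comp φ.toMonoidHom) g) := by
    rw [Finsupp.sum_fintype _ _ (by simp), map_sum]
    simp [permRep, actMat]
  rw [affineKernel, Set.mem_ofPred_eq, h1, Finsupp.sum_fintype _ _ (by simp), mem_affDep,
    LinearEquiv.map_eq_zero_iff]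

theorem affineKernel_prod {G V W : Type*} [Group G] [AddCommGroup V] [Module ℝ V]
    [AddCommGroup W] [Module ℝ W] (ρ : Representation ℝ G V) (σ : Representation ℝ G W) :
    affineKernel (ρ.prod σ) = affineKernel ρ ∩ affineKernel σ := by
  ext x
  have h1 : (x.coeff.sum fun g a => a • (ρ.prod σ) g) =
      (x.coeff.sum fun g a => a • ρ g).prodMap (x.coeff.sum fun g a => a • σ g) := by
    ext v <;> simp [Finsupp.sum, LinearMap.sum_apply, Prod.fst_sum, Prod.snd_sum]
  have h2 : ∀ (a : V →ₗ[ℝ] V) (b : W →ₗ[ℝ] W), a.prodMap b = 0 ↔ a = 0 ∧ b = 0 := by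
    intro a b
    constructor
    · intro h
      constructor <;> ext v
      · simpa using congrArg Prod.fst (LinearMap.congr_fun h (v, 0))
      · simpa using congrArg Prod.snd (LinearMap.congr_fun h (0, v))
    · rintro ⟨rfl, rfl⟩
      ext <;> simp
  simp only [affineKernel, Set.mem_ofPred_eq, Set.mem_inter_iff, h1, h2]
  tauto

theorem affineKernel_eq_of_equiv {G V W : Type*} [Group G] [AddCommGroup V] [Module ℝ V]
    [AddCommGroup W] [Module ℝ W] {ρ : Representation ℝ G V} {σ : Representation ℝ G W}
    (e : ρ.Equiv σ) : affineKernel ρ = affineKernel σ := by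
  ext x
  have hint : ∀ g v, e.toLinearEquiv (ρ g v) = σ g (e.toLinearEquiv v) := fun g v =>
    LinearMap.congr_fun (e.isIntertwining' g) v
  have h1 : ∀ v, (x.coeff.sum fun g a => a • σ g) (e.toLinearEquiv v) =
      e.toLinearEquiv ((x.coeff.sum fun g a => a • ρ g) v) := by
    intro v
    simp [Finsupp.sum, LinearMap.sum_apply, hint]
  have h2 : (x.coeff.sum fun g a => a • ρ g) = 0 ↔ (x.coeff.sum fun g a => a • σ g) = 0 := by
    constructor
    · intro h
      ext w
      obtain ⟨v, rfl⟩ := e.toLinearEquiv.surjective w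
      rw [h1, h]
      simp
    · intro h
      ext v
      apply e.toLinearEquiv.injective
      rw [← h1, h]
      simp
  simp only [affineKernel, Set.mem_ofPred_eq, h2]

/-- Adding an affine quotient leaves the affine kernel unchanged, which gives one direction.
Conversely, if the kernels agree, then `σ` and `ρ` are affine quotients of each other, and `ρ ⊕ σ ≅
σ ⊕ ρ` by swapping the factors. -/
theorem stablyEquivalent_iff {G V W : Type} [Group G] [AddCommGroup V] [Module ℝ V]
    [AddCommGroup W] [Module ℝ W] [FiniteDimensional ℝ V] [FiniteDimensional ℝ W]
    (ρ : Representation ℝ G V) (σ : Representation ℝ G W) :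
    StablyEquivalent ρ σ ↔ affineKernel ρ = affineKernel σ := by
  constructor
  · rintro ⟨_, _, _, _, _, _, _, _, ρ', σ', h1, h2, ⟨e⟩⟩
    have := affineKernel_eq_of_equiv e
    rwa [affineKernel_prod, affineKernel_prod, Set.inter_eq_left.2 h1,
      Set.inter_eq_left.2 h2] at this
  · intro h
    refine ⟨W, V, inferInstance, inferInstance, inferInstance, inferInstance, inferInstance,
      inferInstance, σ, ρ, h.le, h.ge, ⟨Representation.Equiv.mk (LinearEquiv.prodComm ℝ V W) ?_⟩⟩
    intro g
    ext <;> simp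

/-- This criterion replaces the definition from here on: representations no longer occur, only
relations among permutation matrices. -/
theorem effectivelyEquivalent_iff {m n : ℕ} (G₁ : Subgroup (Equiv.Perm (Fin m)))
    (G₂ : Subgroup (Equiv.Perm (Fin n))) [Fintype G₁] [Fintype G₂] :
    EffectivelyEquivalent G₁ G₂ ↔ ∃ φ : G₁ ≃* G₂,
      affDep (actMat G₁.subtype) = affDep (actMat (G₂.subtype.comp φ.toMonoidHom)) := by
  refine exists_congr fun φ => ?_
  rw [stablyEquivalent_iff]
  have h1 : ∀ x, x ∈ affineKernel (permRep G₁) ↔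
      (x.coeff : G₁ → ℝ) ∈ affDep (actMat G₁.subtype) := fun x =>
    mem_affineKernel_permRep G₁ (MulEquiv.refl G₁) x
  have h2 := mem_affineKernel_permRep G₂ φ
  rw [Set.ext_iff, SetLike.ext_iff]
  simp only [h1, h2]
  constructor
  · intro h x
    simpa using h (MonoidAlgebra.ofCoeff (Finsupp.equivFunOnFinite.symm x))
  · intro h x
    exact h _

theorem mem_affDep_comp_equiv {ι κ E : Type*} [Fintype ι] [Fintype κ] [AddCommGroup E] [Module ℝ E]
    (v : κ → E) (φ : ι ≃ κ) (x : ι → ℝ) :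
    x ∈ affDep (v ∘ φ) ↔ x ∘ φ.symm ∈ affDep v := by
  rw [mem_affDep, mem_affDep, ← φ.sum_comp, ← φ.sum_comp]
  simp

theorem affDep_comp_equiv_eq {ι κ E F : Type*} [Fintype ι] [Fintype κ] [AddCommGroup E]
    [Module ℝ E] [AddCommGroup F] [Module ℝ F] {v : κ → E} {w : κ → F} (φ : ι ≃ κ)
    (h : affDep v = affDep w) : affDep (v ∘ φ) = affDep (w ∘ φ) := by
  ext x
  rw [mem_affDep_comp_equiv, mem_affDep_comp_equiv, h]

theorem effectivelyEquivalent_symm {m n : ℕ} {G₁ : Subgroup (Equiv.Perm (Fin m))}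
    {G₂ : Subgroup (Equiv.Perm (Fin n))} (h : EffectivelyEquivalent G₁ G₂) :
    EffectivelyEquivalent G₂ G₁ := by
  classical
  rw [effectivelyEquivalent_iff] at h ⊢
  obtain ⟨φ, h⟩ := h
  refine ⟨φ.symm, ?_⟩
  have := affDep_comp_equiv_eq φ.symm.toEquiv h
  rw [show actMat G₁.subtype ∘ φ.symm.toEquiv =
    actMat (G₁.subtype.comp φ.symm.toMonoidHom) from rfl] at this
  rw [this]
  congr 1
  ext x : 1
  simp [actMat]

theorem effectivelyEquivalent_trans {l m n : ℕ} {G₁ : Subgroup (Equiv.Perm (Fin l))}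
    {G₂ : Subgroup (Equiv.Perm (Fin m))} {G₃ : Subgroup (Equiv.Perm (Fin n))}
    (h : EffectivelyEquivalent G₁ G₂) (h' : EffectivelyEquivalent G₂ G₃) :
    EffectivelyEquivalent G₁ G₃ := by
  classical
  rw [effectivelyEquivalent_iff] at *
  obtain ⟨φ, h⟩ := h
  obtain ⟨ψ, h'⟩ := h'
  exact ⟨φ.trans ψ, h.trans (affDep_comp_equiv_eq φ.toEquiv h')⟩

/-- The permutation polytope up to reindexing. -/
theorem permPolytope_eq_of_mulEquiv {n : ℕ} (G : Subgroup (Equiv.Perm (Fin n))) {H : Type*}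
    [Group H] (φ : H ≃* G) :
    permPolytope G = convexHull ℝ (Set.range (actMat (G.subtype.comp φ.toMonoidHom))) := by
  rw [permPolytope_eq]
  congr 1
  exact (φ.surjective.range_comp (actMat G.subtype)).symm

theorem CombinatoriallyEquivalent.trans {E F L : Type*}
    [AddCommGroup E] [Module ℝ E] [TopologicalSpace E]
    [AddCommGroup F] [Module ℝ F] [TopologicalSpace F]
    [AddCommGroup L] [Module ℝ L] [TopologicalSpace L] {P : Set E} {Q : Set F} {R : Set L}
    (h : CombinatoriallyEquivalent P Q) (h' : CombinatoriallyEquivalent Q R) :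
    CombinatoriallyEquivalent P R :=
  ⟨h.some.trans h'.some⟩

theorem polytopeDim_eq_of_effectivelyEquivalent {m n : ℕ} {G₁ : Subgroup (Equiv.Perm (Fin m))}
    {G₂ : Subgroup (Equiv.Perm (Fin n))} (h : EffectivelyEquivalent G₁ G₂) :
    polytopeDim (permPolytope G₁) = polytopeDim (permPolytope G₂) := by
  classical
  rw [effectivelyEquivalent_iff] at h
  obtain ⟨φ, h⟩ := h
  rw [permPolytope_eq G₁, permPolytope_eq_of_mulEquiv G₂ φ]
  have h1 := polytopeDim_add_finrank_affDep (actMat G₁.subtype)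
  have h2 := polytopeDim_add_finrank_affDep (actMat (G₂.subtype.comp φ.toMonoidHom))
  rw [← h] at h2
  omega

theorem combinatoriallyEquivalent_of_effectivelyEquivalent {m n : ℕ}
    {G₁ : Subgroup (Equiv.Perm (Fin m))}
    {G₂ : Subgroup (Equiv.Perm (Fin n))} (h : EffectivelyEquivalent G₁ G₂) :
    CombinatoriallyEquivalent (permPolytope G₁) (permPolytope G₂) := by
  classical
  rw [effectivelyEquivalent_iff] at h
  obtain ⟨φ, h⟩ := h
  rw [permPolytope_eq G₁, permPolytope_eq_of_mulEquiv G₂ φ]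
  exact combinatoriallyEquivalent_of_affDep_eq h

/-! ### Characters of abelian permutation groups. -/

section Characters

variable {H : Type*} [CommGroup H] {n : ℕ}

/-- The characters occurring in the permutation representation of an abelian group, together with
the trivial character: those that are trivial on the stabilizer of some point. -/
def charSet (f : H →* Equiv.Perm (Fin n)) : Set (H →* ℂˣ) :=
  {χ | χ = 1 ∨ ∃ j, ∀ h, f h j = j → χ h = 1}

theorem one_mem_charSet (f : H →* Equiv.Perm (Fin n)) : 1 ∈ charSet f := Or.inl rfl

/-- This closure property drives the classification: a character of order `k` brings `k` characters
into the set. -/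
theorem pow_mem_charSet {f : H →* Equiv.Perm (Fin n)} {χ : H →* ℂˣ} (hχ : χ ∈ charSet f) (k : ℕ) :
    χ ^ k ∈ charSet f := by
  rcases hχ with rfl | ⟨j, hj⟩
  · exact Or.inl (by ext; simp)
  · exact Or.inr ⟨j, fun h hh => by simp [hj h hh]⟩

/-- The stabilizer of a point under a permutation action. -/
def pointStab {H : Type*} [Group H] (f : H →* Equiv.Perm (Fin n)) (j : Fin n) : Subgroup H where
  carrier := {h | f h j = j}
  mul_mem' := by
    intro a b ha hb
    simp only [Set.mem_ofPred_eq] at *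
    rw [map_mul, Equiv.Perm.mul_apply, hb, ha]
  one_mem' := by simp
  inv_mem' := by
    intro a ha
    simp only [Set.mem_ofPred_eq] at *
    rw [map_inv, Equiv.Perm.inv_eq_iff_eq, ha]

theorem mem_pointStab {H : Type*} [Group H] {f : H →* Equiv.Perm (Fin n)} {j : Fin n} {h : H} :
    h ∈ pointStab f j ↔ f h j = j := Iff.rfl

/-- Multiplication by `ψ` permutes `D`, so the sum is unchanged when multiplied by `ψ g ≠ 1`. -/
theorem sum_subgroup_characters_eq_zero (D : Subgroup (H →* ℂˣ)) [Fintype D] {g : H}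
    {ψ : H →* ℂˣ} (hψ : ψ ∈ D) (hg : ψ g ≠ 1) : ∑ χ : D, ((χ.1 g : ℂˣ) : ℂ) = 0 := by
  have h1 := Equiv.sum_comp (Equiv.mulLeft (⟨ψ, hψ⟩ : D)) fun χ : D => ((χ.1 g : ℂˣ) : ℂ)
  simp only [Equiv.coe_mulLeft, Subgroup.coe_mul, MonoidHom.mul_apply, Units.val_mul,
    ← Finset.mul_sum] at h1
  have h2 : ((ψ g : ℂˣ) : ℂ) ≠ 1 := fun h => hg (Units.ext h)
  have h3 : (((ψ g : ℂˣ) : ℂ) - 1) * ∑ χ : D, ((χ.1 g : ℂˣ) : ℂ) = 0 := by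
    rw [sub_mul, h1, one_mul, sub_self]
  exact (mul_eq_zero.1 h3).resolve_left (sub_ne_zero.2 h2)

variable [Fintype H]

/-- Fourier inversion on the orbit of each `j`: the indicators of the cosets of the stabilizer and
the characters trivial on it span the same functions. Complex coefficients are allowed so that
dimensions can be counted over `ℂ`. -/
theorem sum_mul_char_eq_zero_iff (f : H →* Equiv.Perm (Fin n)) (z : H → ℂ) :
    (∀ χ ∈ charSet f, ∑ h, z h * χ h = 0) ↔
      (∀ i j, ∑ h, (if f h j = i then z h else 0) = 0) ∧ ∑ h, z h = 0 := by
  classical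
  constructor
  · intro hz
    refine ⟨fun i j => ?_, by simpa using hz 1 (one_mem_charSet f)⟩
    by_cases hi : ∃ h₀, f h₀ j = i
    swap
    · push Not at hi
      exact Finset.sum_eq_zero fun h _ => if_neg (hi h)
    obtain ⟨h₀, rfl⟩ := hi
    -- `D` is the annihilator of the stabilizer of `j`. Summing its characters at `h₀⁻¹ * h` gives
    -- `|D|` times the indicator of `f h j = f h₀ j`.
    let D : Subgroup (H →* ℂˣ) := (CommGroup.subgroupOrderIsoSubgroupMonoidHom H ℂ
      (pointStab f j)).ofDual
    have hD : ∀ χ, χ ∈ D ↔ ∀ g ∈ pointStab f j, χ g = 1 := fun χ =>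
      CommGroup.mem_subgroupOrderIsoSubgroupMonoidHom_iff ℂ _ χ
    have : Finite (H →* ℂˣ) := Finite.of_equiv _
      (CommGroup.monoidHom_mulEquiv_of_hasEnoughRootsOfUnity H ℂ).some.toEquiv.symm
    have := Fintype.ofFinite D
    have key : ∀ h, ∑ χ : D, ((χ.1 (h₀⁻¹ * h) : ℂˣ) : ℂ) =
        if f h j = f h₀ j then (Fintype.card D : ℂ) else 0 := by
      intro h
      have hmem : h₀⁻¹ * h ∈ pointStab f j ↔ f h j = f h₀ j := by
        rw [mem_pointStab, map_mul, map_inv, Equiv.Perm.mul_apply, Equiv.Perm.inv_eq_iff_eq]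
      split_ifs with hh
      · rw [Finset.sum_congr rfl fun χ _ => by rw [(hD _).1 χ.2 _ (hmem.2 hh)]]
        simp
      · rw [← hmem, ← CommGroup.forall_monoidHom_apply_eq_one_iff ℂ] at hh
        push Not at hh
        obtain ⟨ψ, h1, h2⟩ := hh
        exact sum_subgroup_characters_eq_zero D ((hD ψ).2 h1) h2
    have h1 : ∑ h, z h * ∑ χ : D, ((χ.1 (h₀⁻¹ * h) : ℂˣ) : ℂ) = 0 := by
      simp_rw [Finset.mul_sum]
      rw [Finset.sum_comm]
      refine Finset.sum_eq_zero fun χ _ => ?_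
      have h2 := hz χ.1 (Or.inr ⟨j, fun h hh => (hD _).1 χ.2 h hh⟩)
      simp_rw [map_mul, Units.val_mul, mul_left_comm (z _), ← Finset.mul_sum]
      rw [h2, mul_zero]
    simp_rw [key, mul_ite, mul_zero] at h1
    have h2 : (∑ h, if f h j = f h₀ j then z h else 0) * (Fintype.card D : ℂ) = 0 := by
      refine Eq.trans ?_ h1
      simp_rw [Finset.sum_mul, ite_mul, zero_mul]
    exact (mul_eq_zero.1 h2).resolve_right (Nat.cast_ne_zero.2 Fintype.card_ne_zero)
  · rintro ⟨h1, h2⟩ χ (rfl | ⟨j, hj⟩)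
    · simpa using h2
    -- A character trivial on the stabilizer of `j` is constant on each fibre of `h ↦ f h j`, so the
    -- sum over the fibre is a multiple of a vanishing sum.
    · rw [← Finset.sum_fiberwise Finset.univ (fun h => f h j)]
      refine Finset.sum_eq_zero fun i _ => ?_
      rw [Finset.sum_filter]
      by_cases hi : ∃ h₀, f h₀ j = i
      · obtain ⟨h₀, rfl⟩ := hi
        have := h1 (f h₀ j) j
        refine Eq.trans ?_ ((congrArg (· * ((χ h₀ : ℂˣ) : ℂ)) this).trans (zero_mul _))
        rw [Finset.sum_mul]
        refine Finset.sum_congr rfl fun h _ => ?_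
        rw [ite_mul, zero_mul]
        split_ifs with hh
        · have : χ (h₀⁻¹ * h) = 1 := hj _ (by
            rw [map_mul, map_inv, Equiv.Perm.mul_apply, Equiv.Perm.inv_eq_iff_eq, hh])
          rw [map_mul, map_inv, inv_mul_eq_one] at this
          rw [this]
        · rfl
      · push Not at hi
        exact Finset.sum_eq_zero fun h _ => if_neg (hi h)

theorem mem_affDep_actMat_iff_char (f : H →* Equiv.Perm (Fin n)) (x : H → ℝ) :
    x ∈ affDep (actMat f) ↔ ∀ χ ∈ charSet f, ∑ h, (x h : ℂ) * χ h = 0 := by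
  rw [sum_mul_char_eq_zero_iff f (fun h => (x h : ℂ)), mem_affDep_actMat]
  refine and_congr (forall₂_congr fun i j => ?_) ?_
  · rw [← Complex.ofReal_inj]
    simp [apply_ite]
  · rw [← Complex.ofReal_inj]
    simp

/-- Over `ℂ` the relations form the kernel of the matrix of character values, whose rows are
independent because distinct characters are. -/
theorem finrank_affDep_add_card_charSet (f : H →* Equiv.Perm (Fin n)) :
    Module.finrank ℝ (affDep (actMat f)) + (charSet f).ncard = Fintype.card H := by
  classical
  have : Finite (H →* ℂˣ) := Finite.of_equiv _
      (CommGroup.monoidHom_mulEquiv_of_hasEnoughRootsOfUnity H ℂ).some.toEquiv.symm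
  have := Fintype.ofFinite (charSet f)
  let M : Matrix (charSet f) H ℂ := Matrix.of fun χ h => ((χ.1 h : ℂˣ) : ℂ)
  have hind : LinearIndependent ℂ M.row := by
    have h1 := linearIndependent_monoidHom H ℂ
    have h2 := h1.comp (fun χ : charSet f => (Units.coeHom ℂ).comp χ.1) (by
      intro χ ψ h
      ext g
      exact DFunLike.congr_fun h g)
    exact h2
  have hrank := hind.rank_matrix
  let K := LinearMap.ker M.mulVecLin
  have hK : ∀ z, z ∈ K ↔ (∀ i j, ∑ h, (if f h j = i then z h else 0) = 0) ∧ ∑ h, z h = 0 := by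
    intro z
    rw [← sum_mul_char_eq_zero_iff, LinearMap.mem_ker]
    simp [funext_iff, Matrix.mulVec, dotProduct, M, mul_comm]
  have hdim : Module.finrank ℂ K + Fintype.card (charSet f) = Fintype.card H := by
    have := LinearMap.finrank_range_add_finrank_ker M.mulVecLin
    rw [Module.finrank_fintype_fun_eq_card] at this
    rw [← this, ← hrank, Matrix.rank, add_comm]
  -- The equations in `hK` have real coefficients, so `K` consists of the vectors whose real and
  -- imaginary parts both lie in `affDep`. This turns the complex dimension of `K` into the real
  -- dimension of `affDep`.
  let e : (affDep (actMat f) × affDep (actMat f)) →ₗ[ℝ] (H → ℂ) :=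
    { toFun := fun p h => ⟨p.1.1 h, p.2.1 h⟩
      map_add' := fun p q => funext fun h => Complex.ext rfl rfl
      map_smul' := fun c p => funext fun h => Complex.ext (by simp) (by simp) }
  have he : Function.Injective e := by
    intro p q h
    ext g
    · exact congrArg Complex.re (congrFun h g)
    · exact congrArg Complex.im (congrFun h g)
  have hr : LinearMap.range e = K.restrictScalars ℝ := by
    ext z
    rw [Submodule.restrictScalars_mem, hK]
    have hre : ∀ w : H → ℂ, ∑ h, w h = 0 ↔ ∑ h, (w h).re = 0 ∧ ∑ h, (w h).im = 0 := by
      intro w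
      rw [Complex.ext_iff]
      simp
    have hz : ((∀ i j, ∑ h, (if f h j = i then z h else 0) = 0) ∧ ∑ h, z h = 0) ↔
        (fun h => (z h).re) ∈ affDep (actMat f) ∧ (fun h => (z h).im) ∈ affDep (actMat f) := by
      simp only [hre, mem_affDep_actMat, apply_ite Complex.re, apply_ite Complex.im,
        Complex.zero_re, Complex.zero_im, forall_and]
      tauto
    rw [hz]
    constructor
    · rintro ⟨p, rfl⟩
      exact ⟨p.1.2, p.2.2⟩
    · rintro ⟨h1, h2⟩
      exact ⟨(⟨_, h1⟩, ⟨_, h2⟩), by ext h; simp [e]⟩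
  have h1 := LinearMap.finrank_range_of_inj he
  rw [hr, Module.finrank_prod] at h1
  have h2 : Module.finrank ℝ K = 2 * Module.finrank ℂ K := finrank_real_of_complex K
  have h3 : Module.finrank ℝ (K.restrictScalars ℝ) = Module.finrank ℝ K := rfl
  rw [Set.ncard_eq_toFinset_card', Set.toFinset_card]
  omega

theorem polytopeDim_actMat (f : H →* Equiv.Perm (Fin n)) :
    polytopeDim (convexHull ℝ (Set.range (actMat f))) + 1 = (charSet f).ncard := by
  have h1 := finrank_affDep_add_card_charSet f
  have h2 := polytopeDim_add_finrank_affDep (actMat f)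
  omega

/-- An element killed by `charSet f` is killed by every character trivial on the stabilizer of `j`,
hence lies in that stabilizer, for each `j`. By faithfulness it is trivial, and the duality of
subgroups turns this into generation. -/
theorem closure_charSet {f : H →* Equiv.Perm (Fin n)} (hf : Function.Injective f) :
    Subgroup.closure (charSet f) = ⊤ := by
  set Φ := Subgroup.closure (charSet f)
  have h1 : (CommGroup.subgroupOrderIsoSubgroupMonoidHom H ℂ).symm (OrderDual.toDual Φ) = ⊥ := by
    rw [eq_bot_iff]
    intro g hg
    rw [CommGroup.mem_subgroupOrderIsoSubgroupMonoidHom_symm_iff] at hg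
    rw [Subgroup.mem_bot]
    apply hf
    ext j : 1
    rw [map_one, Equiv.Perm.one_apply]
    rw [← mem_pointStab, ← CommGroup.forall_monoidHom_apply_eq_one_iff ℂ]
    intro χ hχ
    exact hg χ (Subgroup.subset_closure (Or.inr ⟨j, fun h hh => hχ h hh⟩))
  rw [OrderIso.symm_apply_eq, map_bot] at h1
  exact congrArg OrderDual.ofDual h1

end Characters

/-! ### The dual group with its character set determines the affine dependencies. -/

section Model

/-- An additive group `A` with a subset `W` is a model of the dual of `H` with a set `X` of
characters. -/
def IsDualModel {H A : Type*} [CommGroup H] [AddCommGroup A] (W : Set A) (X : Set (H →* ℂˣ)) :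
    Prop :=
  ∃ θ : Multiplicative A ≃* (H →* ℂˣ), ∀ a, a ∈ W ↔ θ (Multiplicative.ofAdd a) ∈ X

variable {H₁ H₂ : Type*} [CommGroup H₁] [CommGroup H₂]

theorem charSet_comp_equiv {n : ℕ} (f : H₂ →* Equiv.Perm (Fin n)) (φ : H₁ ≃* H₂)
    (χ : H₂ →* ℂˣ) :
    χ.comp φ.toMonoidHom ∈ charSet (f.comp φ.toMonoidHom) ↔ χ ∈ charSet f := by
  simp only [charSet, Set.mem_ofPred_eq]
  refine or_congr ?_ (exists_congr fun j => ?_)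
  · constructor
    · intro h
      ext g
      obtain ⟨g, rfl⟩ := φ.surjective g
      exact congrArg Units.val (DFunLike.congr_fun h g)
    · rintro rfl
      rfl
  · exact (φ.surjective.forall (p := fun h => f h j = j → χ h = 1)).symm

variable [Fintype H₁] [Fintype H₂]

/-- Two models on the same pair give an isomorphism of dual groups respecting the character sets.
Its dual is `φ`, and relations among permutation matrices depend only on the character set. -/
theorem exists_mulEquiv_of_dualModel {m n : ℕ} {A : Type*} [AddCommGroup A] {W : Set A}
    {f₁ : H₁ →* Equiv.Perm (Fin m)} {f₂ : H₂ →* Equiv.Perm (Fin n)}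
    (h₁ : IsDualModel W (charSet f₁)) (h₂ : IsDualModel W (charSet f₂)) :
    ∃ φ : H₁ ≃* H₂, affDep (actMat f₁) = affDep (actMat (f₂.comp φ.toMonoidHom)) := by
  obtain ⟨θ₁, hθ₁⟩ := h₁
  obtain ⟨θ₂, hθ₂⟩ := h₂
  let Θ := θ₁.symm.trans θ₂
  let φ : H₁ ≃* H₂ := (CommGroup.monoidHomMonoidHomEquiv H₁ ℂ).symm.trans
    ((MulEquiv.monoidHomCongrLeft (N := ℂˣ) Θ).trans (CommGroup.monoidHomMonoidHomEquiv H₂ ℂ))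
  -- Double duality: pulling back along `φ` inverts `Θ`.
  have hφ : ∀ χ, (Θ χ).comp φ.toMonoidHom = χ := by
    intro χ
    ext g
    simp [φ]
  refine ⟨φ, ?_⟩
  ext x
  rw [mem_affDep_actMat_iff_char, mem_affDep_actMat_iff_char]
  have : charSet f₁ = charSet (f₂.comp φ.toMonoidHom) := by
    ext χ
    rw [← hφ χ, charSet_comp_equiv, hφ]
    obtain ⟨a, rfl⟩ := θ₁.surjective χ
    rw [show Θ (θ₁ a) = θ₂ a by simp [Θ]]
    exact (hθ₁ a.toAdd).symm.trans (hθ₂ a.toAdd)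
  rw [this]

end Model

/-! ### Dimension bounds from orbits, and the nonabelian case. -/

section Transitive

variable {H : Type*} [Group H] {m : ℕ} (f : H →* Equiv.Perm (Fin m))

theorem actMat_apply (g : H) (i j : Fin m) : actMat f g i j = if f g j = i then 1 else 0 :=
  permMat_apply _ _ _

theorem actMat_one_apply (i j : Fin m) : actMat f 1 i j = if j = i then 1 else 0 := by
  rw [actMat, map_one, permMat_apply]
  rfl

theorem actMat_mul_apply (g h : H) (i j : Fin m) :
    actMat f (g * h) i j = if f g (f h j) = i then 1 else 0 := by
  rw [actMat, map_mul, permMat_apply]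
  rfl

/-- Evaluation of matrices in the direction space of the permutation polytope at a point. -/
def evalCol (p : Fin m) :
    vectorSpan ℝ (Set.range (actMat f)) →ₗ[ℝ] (Fin m → ℝ) where
  toFun M i := M.1 i p
  map_add' _ _ := rfl
  map_smul' _ _ := rfl

theorem actMat_sub_mem (g h : H) :
    actMat f g - actMat f h ∈ vectorSpan ℝ (Set.range (actMat f)) :=
  vsub_mem_vectorSpan ℝ ⟨g, rfl⟩ ⟨h, rfl⟩

variable {f}

theorem evalCol_apply {p : Fin m} (M : vectorSpan ℝ (Set.range (actMat f))) (i : Fin m) :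
    evalCol f p M i = M.1 i p := rfl

/-- By transitivity, column `p` of the permutation matrices takes every standard basis vector as
value, and the differences `e_q - e_p` with `q ≠ p` are independent. -/
theorem le_finrank_range_evalCol {p : Fin m} (ht : ∀ q, ∃ g, f g p = q) :
    m ≤ Module.finrank ℝ (LinearMap.range (evalCol f p)) + 1 := by
  have hmem : ∀ q : Fin m, (Pi.single q 1 - Pi.single p 1 : Fin m → ℝ) ∈
      LinearMap.range (evalCol f p) := by
    intro q
    obtain ⟨g, rfl⟩ := ht q
    refine ⟨⟨_, actMat_sub_mem f g 1⟩, ?_⟩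
    ext i
    rw [evalCol_apply]
    simp only [Matrix.sub_apply, actMat_one_apply, Pi.sub_apply, Pi.single_apply, eq_comm (a := i)]
    rw [actMat_apply]
  have hind : LinearIndependent ℝ (fun q : {q : Fin m // q ≠ p} =>
      (⟨_, hmem q.1⟩ : LinearMap.range (evalCol f p))) := by
    apply LinearIndependent.of_comp (Submodule.subtype _)
    rw [Fintype.linearIndependent_iff]
    intro c hc q
    have := congrFun hc q.1
    simp only [Function.comp_apply, Submodule.subtype_apply, Finset.sum_apply, Pi.smul_apply,
      Pi.sub_apply, smul_eq_mul] at this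
    rw [Finset.sum_eq_single q] at this
    · simpa [Pi.single_apply, q.2] using this
    · intro r _ hr
      have : q.1 ≠ r.1 := fun h => hr (Subtype.ext h.symm)
      simp [q.2, this]
    · simp
  have := hind.fintype_card_le_finrank
  rw [Fintype.card_subtype_compl, Fintype.card_fin, Fintype.card_subtype_eq] at this
  omega

theorem le_polytopeDim_of_transitive {p : Fin m} (ht : ∀ q, ∃ g, f g p = q) :
    m ≤ polytopeDim (convexHull ℝ (Set.range (actMat f))) + 1 := by
  rw [polytopeDim_convexHull_range]
  have h1 := le_finrank_range_evalCol ht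
  have h2 := LinearMap.finrank_range_add_finrank_ker (evalCol f p)
  omega

/-- Column `p` accounts for `m - 1` dimensions. With `q = g p`, the differences `h - 1` and `g h -
g` of permutation matrices vanish in column `p` and are independent, which adds two more. -/
theorem lt_polytopeDim_of_transitive {p q : Fin m} (ht : ∀ q, ∃ g, f g p = q) {h : H}
    (hp : f h p = p) (hq : f h q ≠ q) :
    m < polytopeDim (convexHull ℝ (Set.range (actMat f))) := by
  rw [polytopeDim_convexHull_range]
  have h1 := le_finrank_range_evalCol ht
  have h2 := LinearMap.finrank_range_add_finrank_ker (evalCol f p)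
  suffices 2 ≤ Module.finrank ℝ (LinearMap.ker (evalCol f p)) by omega
  obtain ⟨g, rfl⟩ := ht q
  set q := f g p
  obtain ⟨j, hj⟩ := (f h).surjective q
  have hjq : j ≠ q := by
    rintro rfl
    exact hq hj
  let y₁ : LinearMap.ker (evalCol f p) := ⟨⟨_, actMat_sub_mem f h 1⟩, by
    ext i
    change (actMat f h - actMat f 1) i p = 0
    rw [Matrix.sub_apply, actMat_one_apply, actMat_apply, hp, sub_self]⟩
  let y₂ : LinearMap.ker (evalCol f p) := ⟨⟨_, actMat_sub_mem f (g * h) g⟩, by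
    ext i
    change (actMat f (g * h) - actMat f g) i p = 0
    rw [Matrix.sub_apply, actMat_mul_apply, actMat_apply, hp, sub_self]⟩
  let ψ := (LinearMap.toSpanSingleton ℝ _ y₁).coprod (LinearMap.toSpanSingleton ℝ _ y₂)
  have hψ : Function.Injective ψ := by
    refine (injective_iff_map_eq_zero ψ).2 ?_
    rintro ⟨a, b⟩ hab
    have hab0 : a • (actMat f h - actMat f 1) + b • (actMat f (g * h) - actMat f g) = 0 :=
      congrArg (fun y : LinearMap.ker (evalCol f p) => y.1.1) hab
    have hab' : ∀ i k, a * ((if f h k = i then 1 else 0) - (if k = i then 1 else 0)) +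
        b * ((if f g (f h k) = i then 1 else 0) - (if f g k = i then 1 else 0)) = 0 := by
      intro i k
      have := congrFun (congrFun hab0 i) k
      rwa [Matrix.add_apply, Matrix.smul_apply, Matrix.sub_apply, Matrix.smul_apply,
        Matrix.sub_apply, actMat_mul_apply, actMat_one_apply, actMat_apply, actMat_apply] at this
    -- This makes the coefficient of `b` in entry `(q, j)` vanish, so that entry isolates `a`; entry
    -- `(f g q, j)` then isolates `b`.
    have e1 : f g q = q ↔ f g j = q := by
      rw [(f g).injective.eq_iff (a := q) (b := p), (f g).injective.eq_iff, ← hj]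
      nth_rw 1 [← hp]
      exact (f h).injective.eq_iff
    have ha : a = 0 := by
      have := hab' q j
      simpa [hj, hjq, e1] using this
    refine Prod.ext ha ?_
    have := hab' (f g q) j
    simpa [hj, hjq, ha] using this
  have := LinearMap.finrank_le_finrank_of_injective hψ
  rwa [Module.finrank_prod, Module.finrank_self] at this

end Transitive

theorem mul_comm_of_card_le_five {Q : Type*} [Group Q] [Finite Q] (h : Nat.card Q ≤ 5) (a b : Q) :
    a * b = b * a := by
  have hpos : 0 < Nat.card Q := Nat.card_pos
  have hprime : ∀ p, p.Prime → Nat.card Q = p → a * b = b * a := by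
    intro p hp hc
    have := Fact.mk hp
    have := isCyclic_of_prime_card hc
    exact IsCyclic.isMulCommutative.is_comm.comm a b
  interval_cases hc : Nat.card Q
  · have := (Nat.card_eq_one_iff_unique.1 hc).1
    exact Subsingleton.elim _ _
  · exact hprime 2 Nat.prime_two rfl
  · exact hprime 3 Nat.prime_three rfl
  · have := Fact.mk Nat.prime_two
    exact (IsPGroup.isMulCommutative_of_card_eq_prime_sq (p := 2) hc).is_comm.comm a b
  · exact hprime 5 Nat.prime_five rfl

section Orbit

variable {n : ℕ} (G : Subgroup (Equiv.Perm (Fin n))) (p : Fin n) {m : ℕ}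

/-- The action on an orbit whose points are numbered by `e`. -/
def orbitAction (e : MulAction.orbit G p ≃ Fin m) : G →* Equiv.Perm (Fin m) :=
  e.permCongrHom.toMonoidHom.comp (MulAction.toPermHom G (MulAction.orbit G p))

variable {G p} (e : MulAction.orbit G p ≃ Fin m)

theorem coe_symm_orbitAction (g : G) (i : Fin m) :
    ((e.symm (orbitAction G p e g i) : MulAction.orbit G p) : Fin n) = g.1 (e.symm i) := by
  simp [orbitAction]
  rfl

theorem orbitAction_apply_eq_iff (g : G) (i j : Fin m) :
    orbitAction G p e g j = i ↔ g.1 (e.symm j) = e.symm i := by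
  rw [← coe_symm_orbitAction, Subtype.coe_inj, EmbeddingLike.apply_eq_iff_eq]

theorem orbitAction_transitive (q : Fin m) :
    ∃ g, orbitAction G p e g (e ⟨p, MulAction.mem_orbit_self p⟩) = q := by
  obtain ⟨g, hg⟩ := (e.symm q).2
  refine ⟨g, ?_⟩
  rw [orbitAction_apply_eq_iff, Equiv.symm_apply_apply]
  exact hg

/-- The matrices of the action on an orbit are blocks of the full permutation matrices, so every
relation restricts to them. -/
theorem affDep_le_affDep_orbitAction [Fintype G] :
    affDep (actMat G.subtype) ≤ affDep (actMat (orbitAction G p e)) := by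
  intro x hx
  rw [mem_affDep_actMat] at hx ⊢
  refine ⟨fun i j => ?_, hx.2⟩
  simp_rw [orbitAction_apply_eq_iff]
  exact hx.1 (e.symm i) (e.symm j)

theorem polytopeDim_le_of_affDep_le {ι E F : Type*} [Fintype ι] [Nonempty ι] [AddCommGroup E]
    [Module ℝ E] [AddCommGroup F] [Module ℝ F] {v : ι → E} {w : ι → F}
    (h : affDep v ≤ affDep w) :
    polytopeDim (convexHull ℝ (Set.range w)) ≤ polytopeDim (convexHull ℝ (Set.range v)) := by
  have h1 := polytopeDim_add_finrank_affDep v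
  have h2 := polytopeDim_add_finrank_affDep w
  have h3 := Submodule.finrank_mono h
  omega

theorem actMat_injective {H : Type*} [Group H] {n : ℕ} {f : H →* Equiv.Perm (Fin n)}
    (hf : Function.Injective f) : Function.Injective (actMat f) := by
  intro g h hgh
  apply hf
  ext j : 1
  have := congrFun (congrFun hgh (f g j)) j
  rw [actMat_apply, actMat_apply, if_pos rfl] at this
  by_contra hne
  rw [if_neg (Ne.symm hne)] at this
  exact one_ne_zero this

/-- A coincidence `w i = w j` is itself a dependency. This is how faithfulness passes from `G` to
its action on one orbit. -/
theorem injective_of_affDep_le {ι E F : Type*} [Fintype ι] [AddCommGroup E]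
    [Module ℝ E] [AddCommGroup F] [Module ℝ F] {v : ι → E} {w : ι → F}
    (h : affDep w ≤ affDep v) (hv : Function.Injective v) : Function.Injective w := by
  classical
  intro i j hij
  apply hv
  have h1 : (Pi.single i 1 - Pi.single j 1 : ι → ℝ) ∈ affDep w := by
    constructor
    · simp [sub_smul, Finset.sum_sub_distrib, Pi.single_apply, hij]
    · simp
  have := (h h1).1
  simpa [sub_smul, Finset.sum_sub_distrib, Pi.single_apply, sub_eq_zero] using this

end Orbit

theorem Perm.surjective_of_transitive_fin_three {H : Type*} [Group H] (f : H →* Equiv.Perm (Fin 3))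
    {p : Fin 3} (ht : ∀ q, ∃ g, f g p = q) {h : H} (hp : f h p = p) (hne : f h ≠ 1) :
    Function.Surjective f := by
  -- The list contains the stabilizer `{1, σ}` and its two other left cosets.
  have key : ∀ (p : Fin 3) (σ τ₁ τ₂ π : Equiv.Perm (Fin 3)),
      (σ p = p ∧ σ ≠ 1 ∧ τ₁ p = p + 1 ∧ τ₂ p = p + 2) →
        π ∈ [1, σ, τ₁, τ₁ * σ, τ₂, τ₂ * σ] := by
    decide +kernel
  obtain ⟨g₁, h₁⟩ := ht (p + 1)
  obtain ⟨g₂, h₂⟩ := ht (p + 2)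
  intro π
  have := key p _ _ _ π ⟨hp, hne, h₁, h₂⟩
  simp only [List.mem_cons, List.not_mem_nil, or_false] at this
  rcases this with rfl | rfl | rfl | rfl | rfl | rfl
  exacts [⟨1, map_one f⟩, ⟨h, rfl⟩, ⟨g₁, rfl⟩, ⟨g₁ * h, map_mul f _ _⟩, ⟨g₂, rfl⟩,
    ⟨g₂ * h, map_mul f _ _⟩]

theorem birkhoff3_group_eq_top : TableRow.birkhoff3.group = ⊤ := by
  have key : ∀ π : Equiv.Perm (Fin 3), π = 1 ∨ π = c[0, 1] ∨ π = c[0, 1, 2] ∨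
      π = c[0, 1, 2] * c[0, 1, 2] ∨ π = c[0, 1] * c[0, 1, 2] ∨ π = c[0, 1, 2] * c[0, 1] := by
    decide +kernel
  rw [eq_top_iff]
  intro π _
  have ha : (c[0, 1] : Equiv.Perm (Fin 3)) ∈ TableRow.birkhoff3.group :=
    Subgroup.subset_closure (Or.inl rfl)
  have hb : (c[0, 1, 2] : Equiv.Perm (Fin 3)) ∈ TableRow.birkhoff3.group :=
    Subgroup.subset_closure (Or.inr rfl)
  rcases key π with h | h | h | h | h | h <;> rw [h]
  exacts [one_mem _, ha, hb, mul_mem hb hb, mul_mem ha hb, mul_mem hb ha]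

section

variable {n : ℕ} {G : Subgroup (Equiv.Perm (Fin n))}

/-- If all point stabilizers act trivially on the orbits of their points and the polytope has
dimension at most four, then the group is abelian. -/
theorem mul_comm_of_regular_orbits (hd : polytopeDim (permPolytope G) ≤ 4)
    (hreg : ∀ (p : Fin n) (h g : G), h.1 p = p → h.1 (g.1 p) = g.1 p) (g h : G) :
    g * h = h * g := by
  classical
  ext p : 2
  let e := Fintype.equivFin (MulAction.orbit G p)
  have ht := orbitAction_transitive e
  have h1 := le_polytopeDim_of_transitive ht
  have h2 := polytopeDim_le_of_affDep_le (affDep_le_affDep_orbitAction e)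
  rw [← permPolytope_eq] at h2
  set f := orbitAction G p e
  set q := e ⟨p, MulAction.mem_orbit_self p⟩
  -- An element of the image is determined by its value at `q`: the stabilizer of a point acts
  -- trivially on the orbit. So the image has at most as many elements as the orbit, that is, at
  -- most five.
  have hinj : Function.Injective (fun σ : f.range => σ.1 q) := by
    rintro ⟨_, a, rfl⟩ ⟨_, b, rfl⟩ hab
    have h3 : f (b⁻¹ * a) q = q := by
      rw [map_mul, map_inv, Equiv.Perm.mul_apply, Equiv.Perm.inv_eq_iff_eq]
      exact hab
    have h4 : f (b⁻¹ * a) = 1 := by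
      ext r : 1
      obtain ⟨g, rfl⟩ := ht r
      rw [orbitAction_apply_eq_iff, Equiv.symm_apply_apply] at h3
      rw [Equiv.Perm.one_apply, orbitAction_apply_eq_iff, coe_symm_orbitAction]
      exact hreg _ _ _ (by simpa [q] using h3)
    rw [map_mul, map_inv, inv_mul_eq_one] at h4
    exact Subtype.ext h4.symm
  have hcard : Nat.card f.range ≤ 5 := by
    have := Nat.card_le_card_of_injective _ hinj
    rw [Nat.card_fin] at this
    omega
  have hc := mul_comm_of_card_le_five hcard ⟨f g, g, rfl⟩ ⟨f h, h, rfl⟩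
  have hc' : f (g * h) = f (h * g) := by
    rw [map_mul, map_mul]
    exact congrArg Subtype.val hc
  have := congrArg (fun r : Fin _ => (e.symm r : Fin n)) (congrArg (fun σ => σ q) hc')
  simp only [f, coe_symm_orbitAction] at this
  simpa [q] using this

/-- A single orbit on which a stabilizer acts nontrivially already exhausts the dimension available,
so all other orbits add nothing to the affine dependencies. -/
theorem effectivelyEquivalent_birkhoff3 (hd : polytopeDim (permPolytope G) ≤ 4)
    (hG : ¬ ∀ g h : G, g * h = h * g) :
    EffectivelyEquivalent G TableRow.birkhoff3.group := by
  classical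
  have hreg := mt (mul_comm_of_regular_orbits hd) hG
  push Not at hreg
  obtain ⟨p, h, g, hp, hq⟩ := hreg
  obtain ⟨m, ⟨e⟩⟩ : ∃ m, Nonempty (MulAction.orbit G p ≃ Fin m) := ⟨_, ⟨Fintype.equivFin _⟩⟩
  have ht := orbitAction_transitive e
  have hle := affDep_le_affDep_orbitAction e
  have h2 := polytopeDim_le_of_affDep_le hle
  rw [← permPolytope_eq] at h2
  have hp' : orbitAction G p e h (e ⟨p, MulAction.mem_orbit_self p⟩) =
      e ⟨p, MulAction.mem_orbit_self p⟩ := by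
    rw [orbitAction_apply_eq_iff]
    simpa using hp
  have hq' : orbitAction G p e h (e ⟨g.1 p, g, rfl⟩) ≠ e ⟨g.1 p, g, rfl⟩ := by
    rw [Ne, orbitAction_apply_eq_iff]
    simpa using hq
  have h3 := lt_polytopeDim_of_transitive ht hp' hq'
  have hne : e ⟨g.1 p, g, rfl⟩ ≠ e ⟨p, MulAction.mem_orbit_self p⟩ := by
    intro heq
    rw [heq] at hq'
    exact hq' hp'
  have hm : 3 ≤ m := by
    have : ({e ⟨p, MulAction.mem_orbit_self p⟩, e ⟨g.1 p, g, rfl⟩,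
        orbitAction G p e h (e ⟨g.1 p, g, rfl⟩)} : Finset (Fin m)).card = 3 := by
      rw [Finset.card_eq_three]
      refine ⟨_, _, _, hne.symm, ?_, hq'.symm, rfl⟩
      intro heq
      nth_rw 1 [← hp'] at heq
      exact hne.symm ((orbitAction G p e h).injective heq)
    calc 3 = _ := this.symm
      _ ≤ Fintype.card (Fin m) := Finset.card_le_univ _
      _ = m := Fintype.card_fin m
  -- The bounds are `3 ≤ m` and `m < dim ≤ 4`; the same inequalities leave only dimension four for
  -- both the orbit polytope and `P(G)`.
  obtain rfl : m = 3 := by omega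
  set f := orbitAction G p e
  have heq : affDep (actMat G.subtype) = affDep (actMat f) := by
    refine Submodule.eq_of_le_of_finrank_eq hle ?_
    have h4 := polytopeDim_add_finrank_affDep (actMat G.subtype)
    have h5 := polytopeDim_add_finrank_affDep (actMat f)
    rw [← permPolytope_eq] at h4
    omega
  have hinj : Function.Injective f := by
    have := injective_of_affDep_le heq.ge (actMat_injective G.subtype_injective)
    intro a b hab
    exact this (congrArg permMat hab)
  have hsurj : Function.Surjective f :=
    Perm.surjective_of_transitive_fin_three f ht hp' fun h1 => hq' (by rw [h1]; rfl)
  let φ : G ≃* TableRow.birkhoff3.group :=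
    (MulEquiv.ofBijective f ⟨hinj, hsurj⟩).trans
      (Subgroup.topEquiv.symm.trans (MulEquiv.subgroupCongr birkhoff3_group_eq_top.symm))
  rw [effectivelyEquivalent_iff]
  exact ⟨φ, heq⟩

/-- The orbit bound gives dimension greater than three. The sign character gives a nonzero relation,
as the two permutations sending `j` to `i` have opposite signs, and so bounds the dimension by `6 -
1 - 1`. -/
theorem polytopeDim_birkhoff3 :
    polytopeDim (permPolytope TableRow.birkhoff3.group) = 4 := by
  classical
  rw [birkhoff3_group_eq_top]
  change polytopeDim (permPolytope (⊤ : Subgroup (Equiv.Perm (Fin 3)))) = 4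
  rw [permPolytope_eq_of_mulEquiv _ (Subgroup.topEquiv (G := Equiv.Perm (Fin 3))).symm]
  set f := (⊤ : Subgroup (Equiv.Perm (Fin 3))).subtype.comp
    (Subgroup.topEquiv (G := Equiv.Perm (Fin 3))).symm.toMonoidHom
  have hf : ∀ g, f g = g := fun g => rfl
  have h1 := lt_polytopeDim_of_transitive (f := f) (p := 0) (q := 1) (h := Equiv.swap 1 2)
    (fun q => ⟨Equiv.swap 0 q, by rw [hf]; simp⟩) (by rw [hf]; decide) (by rw [hf]; decide)
  have h2 := polytopeDim_add_finrank_affDep (actMat f)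
  have h3 : (fun σ => ((Equiv.Perm.sign σ : ℤ) : ℝ)) ∈ affDep (actMat f) := by
    rw [mem_affDep_actMat]
    have k1 : ∀ i j : Fin 3, ∑ σ : Equiv.Perm (Fin 3),
        (if σ j = i then (Equiv.Perm.sign σ : ℤ) else 0) = 0 := by decide +kernel
    have k2 : ∑ σ : Equiv.Perm (Fin 3), (Equiv.Perm.sign σ : ℤ) = 0 := by decide +kernel
    refine ⟨fun i j => ?_, by exact_mod_cast k2⟩
    have := congrArg (Int.cast : ℤ → ℝ) (k1 i j)
    push_cast at this
    exact this
  have h4 : 0 < Module.finrank ℝ (affDep (actMat f)) := by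
    rw [Module.finrank_pos_iff_exists_ne_zero]
    refine ⟨⟨_, h3⟩, fun h0 => ?_⟩
    have := congrFun (congrArg Subtype.val h0) 1
    simp at this
  rw [Fintype.card_perm, Fintype.card_fin, show Nat.factorial 3 = 6 from rfl] at h2
  omega

end

/-! ### Models of subsets closed under multiples: elements of order at least three. -/

/-- A subset `X` of an additive group is modelled by the finite subset `W` of the group `A`. -/
def IsAddModel {A D : Type*} [AddCommGroup A] [AddCommGroup D] (W : Finset A) (X : Set D) : Prop :=
  ∃ θ : A ≃+ D, ∀ a, a ∈ W ↔ θ a ∈ X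

section Construct

variable {A B D : Type*} [AddCommGroup A] [AddCommGroup B] [AddCommGroup D]

theorem IsAddModel.of_equiv {W : Finset A} {W' : Finset B} {X : Set D} (e : A ≃+ B)
    (hW : ∀ a, a ∈ W ↔ e a ∈ W') (h : IsAddModel W' X) : IsAddModel W X := by
  obtain ⟨θ, hθ⟩ := h
  exact ⟨e.trans θ, fun a => (hW a).trans (hθ (e a))⟩

/-- Surjectivity comes for free, since the image contains a generating set; only the kernel has to
be computed. -/
theorem isAddModel_of_hom {W : Finset A} {X : Set D} (hgen : AddSubgroup.closure X = ⊤)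
    (θ : A →+ D) (hinj : ∀ a, θ a = 0 → a = 0) (hW : ∀ a ∈ W, θ a ∈ X)
    (hX : ∀ x ∈ X, ∃ a ∈ W, θ a = x) : IsAddModel W X := by
  have hinj' : Function.Injective θ := (injective_iff_map_eq_zero θ).2 hinj
  have hsurj : Function.Surjective θ := by
    rw [← AddMonoidHom.range_eq_top, eq_top_iff, ← hgen, AddSubgroup.closure_le]
    intro x hx
    obtain ⟨a, _, rfl⟩ := hX x hx
    exact ⟨a, rfl⟩
  refine ⟨AddEquiv.ofBijective θ ⟨hinj', hsurj⟩, fun a => ⟨hW a, fun h => ?_⟩⟩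
  obtain ⟨b, hb, hab⟩ := hX _ h
  rw [← hinj' hab]
  exact hb

/-- The homomorphism out of `ZMod n` with a prescribed value at `1`. -/
def zmodHom (n : ℕ) [NeZero n] (x : D) (hx : n • x = 0) : ZMod n →+ D where
  toFun a := a.val • x
  map_zero' := by simp
  map_add' a b := by rw [ZMod.val_add, ← nsmul_eq_mod_nsmul _ hx, add_nsmul]

theorem zmodHom_apply {n : ℕ} [NeZero n] {x : D} (hx : n • x = 0) (a : ZMod n) :
    zmodHom n x hx a = a.val • x := rfl

theorem zmodHom_addOrderOf_eq_zero {x : D} [NeZero (addOrderOf x)] {a : ZMod (addOrderOf x)}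
    (h : a.val • x = 0) : a = 0 := by
  rw [← addOrderOf_dvd_iff_nsmul_eq_zero] at h
  exact (ZMod.val_eq_zero a).1 (Nat.eq_zero_of_dvd_of_lt h a.val_lt)

theorem exists_val_nsmul_of_mem_zmultiples {n : ℕ} [NeZero n] {x y : D} (hx : n • x = 0)
    (hy : y ∈ AddSubgroup.zmultiples x) : ∃ a : ZMod n, a.val • x = y := by
  obtain ⟨k, rfl⟩ := hy
  refine ⟨(k : ZMod n), ?_⟩
  have : ((k : ZMod n).val : ℤ) • x = k • x := by
    rw [ZMod.val_intCast, ← sub_eq_zero, ← sub_smul, Int.emod_def, sub_sub_cancel_left, neg_smul,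
      mul_comm, mul_smul, natCast_zsmul, hx, smul_zero, neg_zero]
  rwa [natCast_zsmul] at this

theorem nsmul_mem_zmultiples' (x : D) (k : ℕ) : k • x ∈ AddSubgroup.zmultiples x :=
  AddSubgroup.nsmul_mem _ (AddSubgroup.mem_zmultiples x) k

end Construct

section Classify

variable {D : Type*} [AddCommGroup D] {X : Finset D}

theorem val_eq_of_addOrderOf {n : ℕ} [NeZero n] {x : D} (hx : addOrderOf x = n) {a : ZMod n}
    (h : a.val • x = 0) : a = 0 := by
  subst hx
  exact zmodHom_addOrderOf_eq_zero h

/-- The multiples of `x` stay in the finite set `X`. Finiteness of the ambient group is never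
assumed. -/
theorem addOrderOf_ne_zero_of_mem (hsmul : ∀ x ∈ X, ∀ k : ℕ, k • x ∈ X) {x : D} (hx : x ∈ X) :
    addOrderOf x ≠ 0 := by
  rw [addOrderOf_ne_zero_iff]
  have hfin : (Set.range fun k : ℕ => k • x).Finite :=
    X.finite_toSet.subset (by rintro _ ⟨k, rfl⟩; exact hsmul x hx k)
  by_contra h
  have hinj := injective_nsmul_iff_not_isOfFinAddOrder.2 h
  exact Set.infinite_range_of_injective hinj hfin

theorem neg_mem_of_smul_closed (hsmul : ∀ x ∈ X, ∀ k : ℕ, k • x ∈ X) {x : D} (hx : x ∈ X) :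
    -x ∈ X := by
  have h0 := addOrderOf_ne_zero_of_mem hsmul hx
  have : -x = (addOrderOf x - 1) • x := by
    rw [neg_eq_iff_add_eq_zero, ← succ_nsmul', Nat.sub_add_cancel (Nat.pos_of_ne_zero h0),
      addOrderOf_nsmul_eq_zero]
  rw [this]
  exact hsmul x hx _

/-- The homomorphism out of an elementary abelian 2-group given by elements of order two. -/
def involutionHom {k : ℕ} (a : Fin k → D) (ha : ∀ j, 2 • a j = 0) : (Fin k → ZMod 2) →+ D where
  toFun e := ∑ j, (e j).val • a j
  map_zero' := by simp
  map_add' e e' := by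
    rw [← Finset.sum_add_distrib]
    refine Finset.sum_congr rfl fun j _ => ?_
    exact (zmodHom 2 (a j) (ha j)).map_add (e j) (e' j)

theorem involutionHom_apply {k : ℕ} {a : Fin k → D} (ha : ∀ j, 2 • a j = 0) (e : Fin k → ZMod 2) :
    involutionHom a ha e = ∑ j, (e j).val • a j := rfl

/-- The multiples of an element of finite order, as a finset. -/
noncomputable def multiples [DecidableEq D] (x : D) : Finset D :=
  (Finset.range (addOrderOf x)).image (· • x)

variable [DecidableEq D]

theorem multiples_subset (hsmul : ∀ x ∈ X, ∀ k : ℕ, k • x ∈ X) {x : D} (hx : x ∈ X) :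
    multiples x ⊆ X := by
  intro y hy
  obtain ⟨k, _, rfl⟩ := Finset.mem_image.1 hy
  exact hsmul x hx k

theorem card_multiples (x : D) : (multiples x).card = addOrderOf x := by
  rw [multiples, Finset.card_image_of_injOn, Finset.card_range]
  intro a ha b hb hab
  rw [Finset.coe_range] at ha hb
  exact nsmul_injOn_Iio_addOrderOf ha hb hab

theorem mem_multiples {x y : D} (hx : addOrderOf x ≠ 0) :
    y ∈ multiples x ↔ y ∈ AddSubgroup.zmultiples x := by
  have := NeZero.mk hx
  constructor
  · intro hy
    obtain ⟨k, _, rfl⟩ := Finset.mem_image.1 hy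
    exact nsmul_mem_zmultiples' x k
  · intro hy
    obtain ⟨a, rfl⟩ := exists_val_nsmul_of_mem_zmultiples (addOrderOf_nsmul_eq_zero x) hy
    exact Finset.mem_image.2 ⟨a.val, Finset.mem_range.2 a.val_lt, rfl⟩

theorem isAddModel_cyclic {n : ℕ} [NeZero n] (hgen : AddSubgroup.closure (X : Set D) = ⊤)
    (hsmul : ∀ x ∈ X, ∀ k : ℕ, k • x ∈ X) {x : D} (hx : x ∈ X) (ho : addOrderOf x = n)
    (hc : X.card = n) : IsAddModel (Finset.univ : Finset (ZMod n)) (X : Set D) := by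
  have hnx : n • x = 0 := ho ▸ addOrderOf_nsmul_eq_zero x
  have hX : multiples x = X := by
    refine Finset.eq_of_subset_of_card_le (multiples_subset hsmul hx) ?_
    rw [card_multiples, hc, ho]
  refine isAddModel_of_hom hgen (zmodHom n x hnx) (fun a => val_eq_of_addOrderOf ho)
    (fun a _ => hsmul x hx _) ?_
  intro y hy
  rw [Finset.mem_coe, ← hX, mem_multiples (ho ▸ NeZero.ne n)] at hy
  obtain ⟨a, ha⟩ := exists_val_nsmul_of_mem_zmultiples hnx hy
  exact ⟨a, Finset.mem_univ a, ha⟩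

/-- Exactly one element `y` of `X` lies outside the multiples of `x`. Its negative is another such
element, so `-y = y`, and `y` spans a complementary factor `ℤ/2`. -/
theorem isAddModel_prism {n : ℕ} [NeZero n] (hgen : AddSubgroup.closure (X : Set D) = ⊤)
    (hsmul : ∀ x ∈ X, ∀ k : ℕ, k • x ∈ X) {x : D} (hx : x ∈ X) (ho : addOrderOf x = n)
    (hc : X.card = n + 1) :
    IsAddModel (Finset.univ.filter fun a : ZMod 2 × ZMod n => a.1 = 0 ∨ a.2 = 0) (X : Set D) := by
  have hnx : n • x = 0 := ho ▸ addOrderOf_nsmul_eq_zero x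
  obtain ⟨y, hy, hX⟩ := Finset.exists_eq_insert_iff.2
    ⟨multiples_subset hsmul hx, by rw [card_multiples, hc, ho]⟩
  have hyX : y ∈ X := hX ▸ Finset.mem_insert_self _ _
  rw [mem_multiples (ho ▸ NeZero.ne n)] at hy
  have h2y : 2 • y = 0 := by
    have := neg_mem_of_smul_closed hsmul hyX
    rw [← hX, Finset.mem_insert, mem_multiples (ho ▸ NeZero.ne n), neg_mem_iff] at this
    have h3 := this.resolve_right hy
    rw [two_nsmul]
    nth_rw 1 [← h3]
    exact neg_add_cancel y
  have hz2 : ∀ a : ZMod 2, a = 0 ∨ a = 1 := by decide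
  refine isAddModel_of_hom hgen ((zmodHom 2 y h2y).coprod (zmodHom n x hnx)) ?_ ?_ ?_
  · rintro ⟨a, b⟩ hab
    rw [AddMonoidHom.coprod_apply, zmodHom_apply, zmodHom_apply] at hab
    rcases hz2 a with rfl | rfl
    · rw [ZMod.val_zero, zero_smul, zero_add] at hab
      dsimp only at hab
      rw [val_eq_of_addOrderOf ho hab]
      rfl
    · rw [ZMod.val_one, one_smul] at hab
      rw [eq_neg_of_add_eq_zero_left hab, neg_mem_iff] at hy
      exact absurd (nsmul_mem_zmultiples' x _) hy
  · rintro ⟨a, b⟩ hab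
    rw [AddMonoidHom.coprod_apply, zmodHom_apply, zmodHom_apply]
    rcases (Finset.mem_filter.1 hab).2 with h | h
    · dsimp only at h ⊢
      rw [h, ZMod.val_zero, zero_smul, zero_add]
      exact hsmul x hx _
    · dsimp only at h ⊢
      rw [h, ZMod.val_zero, zero_smul, add_zero]
      exact hsmul y hyX _
  · intro z hz
    rw [Finset.mem_coe, ← hX, Finset.mem_insert, mem_multiples (ho ▸ NeZero.ne n)] at hz
    rcases hz with rfl | hz
    · refine ⟨(1, 0), by simp, ?_⟩
      simp [zmodHom_apply, ZMod.val_one]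
    · obtain ⟨b, rfl⟩ := exists_val_nsmul_of_mem_zmultiples hnx hz
      refine ⟨(0, b), by simp, ?_⟩
      simp [zmodHom_apply]

/-- The case of a subgroup of order three and two further elements. -/
theorem isAddModel_three_add_two (hgen : AddSubgroup.closure (X : Set D) = ⊤)
    (hsmul : ∀ x ∈ X, ∀ k : ℕ, k • x ∈ X) {x : D} (hx : x ∈ X) (ho : addOrderOf x = 3)
    (hc : X.card = 5) (h4 : ∀ y ∈ X, addOrderOf y ≤ 3) :
    IsAddModel (Finset.univ.filter fun a : ZMod 3 × ZMod 3 => a.1 = 0 ∨ a.2 = 0) (X : Set D) ∨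
    IsAddModel (Finset.univ.filter fun a : ZMod 3 × (ZMod 2 × ZMod 2) =>
      a.2 = 0 ∨ (a.1 = 0 ∧ (a.2.1 = 0 ∨ a.2.2 = 0))) (X : Set D) := by
  have ho' : addOrderOf x ≠ 0 := by omega
  have hnx : 3 • x = 0 := ho ▸ addOrderOf_nsmul_eq_zero x
  have hsub := multiples_subset hsmul hx
  have hcard : (X \ multiples x).card = 2 := by
    rw [Finset.card_sdiff_of_subset hsub, card_multiples, hc, ho]
  obtain ⟨y, w, hyw, hX⟩ := Finset.card_eq_two.1 hcard
  have hmem : ∀ z, z ∈ X ∧ z ∉ AddSubgroup.zmultiples x ↔ z = y ∨ z = w := by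
    intro z
    rw [← mem_multiples ho', ← Finset.mem_sdiff, hX, Finset.mem_insert, Finset.mem_singleton]
  obtain ⟨hyX, hy⟩ := (hmem y).2 (Or.inl rfl)
  obtain ⟨hwX, hw⟩ := (hmem w).2 (Or.inr rfl)
  have hz2 : ∀ a : ZMod 2, a = 0 ∨ a = 1 := by decide
  have hz3 : ∀ a : ZMod 3, a = 0 ∨ a = 1 ∨ a = 2 := by decide
  have v2 : (2 : ZMod 3).val = 2 := rfl
  have hcase : ∀ z ∈ (X : Set D), z = y ∨ z = w ∨ z ∈ AddSubgroup.zmultiples x := by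
    intro z hz
    by_cases h : z ∈ AddSubgroup.zmultiples x
    · exact Or.inr (Or.inr h)
    · rcases (hmem z).1 ⟨hz, h⟩ with h | h
      exacts [Or.inl h, Or.inr (Or.inl h)]
  have two_of_neg : ∀ z : D, -z = z → 2 • z = 0 := by
    intro z hz
    rw [two_nsmul]
    nth_rw 1 [← hz]
    exact neg_add_cancel z
  have hneg : -y = y ∨ -y = w := (hmem (-y)).1
    ⟨neg_mem_of_smul_closed hsmul hyX, by rwa [neg_mem_iff]⟩
  have hneg' : -w = y ∨ -w = w := (hmem (-w)).1
    ⟨neg_mem_of_smul_closed hsmul hwX, by rwa [neg_mem_iff]⟩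
  -- Negation permutes the two elements outside the multiples of `x`. Either it fixes both, giving
  -- two involutions, or it swaps them, giving the nonzero elements of a second subgroup of order
  -- three.
  rcases hneg with hneg | hneg
  · right
    have h2y := two_of_neg y hneg
    have h2w : 2 • w = 0 := by
      refine two_of_neg w (hneg'.resolve_left fun h => hyw ?_)
      rw [← hneg, ← h, neg_neg]
    refine isAddModel_of_hom hgen
      ((zmodHom 3 x hnx).coprod ((zmodHom 2 y h2y).coprod (zmodHom 2 w h2w))) ?_ ?_ ?_
    · rintro ⟨a, b, c⟩ h
      simp only [AddMonoidHom.coprod_apply, zmodHom_apply] at h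
      have key : b.val • y + c.val • w = 0 := by
        -- Multiplication by three kills the `x` part and fixes the combination of involutions.
        have h1 : 3 • (a.val • x + (b.val • y + c.val • w)) = 0 := by rw [h, smul_zero]
        have h2 : b.val • y + c.val • w = 3 • (a.val • x + (b.val • y + c.val • w)) -
            a.val • (3 • x) - b.val • (2 • y) - c.val • (2 • w) := by module
        rw [h2, h1, hnx, h2y, h2w]
        simp
      rw [key, add_zero] at h
      rw [val_eq_of_addOrderOf ho h]
      rcases hz2 b with rfl | rfl <;> rcases hz2 c with rfl | rfl <;>
        simp only [ZMod.val_zero, ZMod.val_one, zero_smul, one_smul, add_zero, zero_add] at key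
      · rfl
      · exact absurd (key ▸ zero_mem _) hw
      · exact absurd (key ▸ zero_mem _) hy
      · exact absurd (by rw [← hneg]; exact neg_eq_of_add_eq_zero_right key) hyw
    · rintro ⟨a, b, c⟩ h
      simp only [AddMonoidHom.coprod_apply, zmodHom_apply]
      rcases (Finset.mem_filter.1 h).2 with h | ⟨h, h' | h'⟩ <;> dsimp only at *
      · obtain ⟨rfl, rfl⟩ := Prod.mk.inj h
        simpa using hsmul x hx _
      · subst h h'
        simpa using hsmul w hwX _
      · subst h h'
        simpa using hsmul y hyX _
    · intro z hz
      rcases hcase z hz with rfl | rfl | hz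
      · exact ⟨(0, 1, 0), by simp, by simp [zmodHom_apply, ZMod.val_one]⟩
      · exact ⟨(0, 0, 1), by simp, by simp [zmodHom_apply, ZMod.val_one]⟩
      · obtain ⟨b, rfl⟩ := exists_val_nsmul_of_mem_zmultiples hnx hz
        exact ⟨(b, 0, 0), by simp, by simp [zmodHom_apply]⟩
  · left
    have h3y : 3 • y = 0 := by
      have h1 := h4 y hyX
      have h2 := addOrderOf_nsmul_eq_zero y
      have h0 := addOrderOf_ne_zero_of_mem hsmul hyX
      have hy0 : y ≠ 0 := fun h => hy (h ▸ zero_mem _)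
      have hyy : 2 • y ≠ 0 := by
        intro h
        apply hyw
        rw [← hneg]
        rw [two_nsmul] at h
        exact (neg_eq_of_add_eq_zero_right h).symm
      interval_cases addOrderOf y
      · exact absurd rfl h0
      · exact absurd (by rwa [one_nsmul] at h2) hy0
      · exact absurd h2 hyy
      · exact h2
    have hw' : w = 2 • y := by
      rw [← hneg, neg_eq_iff_add_eq_zero, ← succ_nsmul', h3y]
    refine isAddModel_of_hom hgen ((zmodHom 3 x hnx).coprod (zmodHom 3 y h3y)) ?_ ?_ ?_
    · rintro ⟨a, b⟩ h
      simp only [AddMonoidHom.coprod_apply, zmodHom_apply] at h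
      have hb : b.val • y ∈ AddSubgroup.zmultiples x := by
        rw [eq_neg_of_add_eq_zero_right h, neg_mem_iff]
        exact nsmul_mem_zmultiples' x _
      rcases hz3 b with rfl | rfl | rfl
      · rw [ZMod.val_zero, zero_smul, add_zero] at h
        rw [val_eq_of_addOrderOf ho h]
        rfl
      · rw [ZMod.val_one, one_smul] at hb
        exact absurd hb hy
      · rw [v2, ← hw'] at hb
        exact absurd hb hw
    · rintro ⟨a, b⟩ h
      simp only [AddMonoidHom.coprod_apply, zmodHom_apply]
      rcases (Finset.mem_filter.1 h).2 with h | h <;> dsimp only at * <;> subst h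
      · simpa using hsmul y hyX _
      · simpa using hsmul x hx _
    · intro z hz
      rcases hcase z hz with rfl | rfl | hz
      · exact ⟨(0, 1), by simp, by simp [zmodHom_apply, ZMod.val_one]⟩
      · exact ⟨(0, 2), by simp, by simp [zmodHom_apply, v2, hw']⟩
      · obtain ⟨b, rfl⟩ := exists_val_nsmul_of_mem_zmultiples hnx hz
        exact ⟨(b, 0), by simp, by simp [zmodHom_apply]⟩

end Classify

/-! ### Models of sets of involutions. -/

section Involutions

variable {D : Type*} [AddCommGroup D] {X : Finset D}

theorem add_ne_zero_of_ne {a b : D} (ha : 2 • a = 0) (hab : a ≠ b) : a + b ≠ 0 := by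
  intro h
  apply hab
  rw [two_nsmul] at ha
  exact (eq_neg_of_add_eq_zero_left ha).trans (neg_eq_of_add_eq_zero_right h)

theorem zmod_two_eq (z : ZMod 2) : z = 0 ∨ z = 1 := by
  revert z
  decide

theorem isAddModel_square (hgen : AddSubgroup.closure (X : Set D) = ⊤)
    (h2 : ∀ x ∈ X, 2 • x = 0) {a b : D} (ha : a ≠ 0) (hb : b ≠ 0) (hab : a ≠ b)
    (hX : ∀ z, z ∈ X ↔ z = 0 ∨ z = a ∨ z = b) :
    IsAddModel ({0, ![1, 0], ![0, 1]} : Finset (Fin 2 → ZMod 2)) (X : Set D) := by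
  have h2a := h2 a ((hX a).2 (by simp))
  have h2b := h2 b ((hX b).2 (by simp))
  refine isAddModel_of_hom hgen (involutionHom ![a, b] (by simp [Fin.forall_fin_two, h2a, h2b]))
    ?_ ?_ ?_
  · intro e he
    rw [involutionHom_apply, Fin.sum_univ_two] at he
    have hab' := add_ne_zero_of_ne h2a hab
    ext j : 1
    rcases zmod_two_eq (e 0) with h0 | h0 <;> rcases zmod_two_eq (e 1) with h1 | h1 <;>
      simp [h0, h1, ZMod.val_one, ha, hb, hab'] at he
    fin_cases j <;> assumption
  · simp [involutionHom_apply, Fin.sum_univ_two, ZMod.val_one, hX]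
  · simp [involutionHom_apply, Fin.sum_univ_two, ZMod.val_one, hX]

theorem isAddModel_klein (hgen : AddSubgroup.closure (X : Set D) = ⊤)
    (h2 : ∀ x ∈ X, 2 • x = 0) {a b c : D} (ha : a ≠ 0) (hb : b ≠ 0) (hab : a ≠ b)
    (hc : a + b = c) (hX : ∀ z, z ∈ X ↔ z = 0 ∨ z = a ∨ z = b ∨ z = c) :
    IsAddModel ({0, ![1, 0], ![0, 1], ![1, 1]} : Finset (Fin 2 → ZMod 2)) (X : Set D) := by
  have h2a := h2 a ((hX a).2 (by simp))
  have h2b := h2 b ((hX b).2 (by simp))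
  refine isAddModel_of_hom hgen (involutionHom ![a, b] (by simp [Fin.forall_fin_two, h2a, h2b]))
    ?_ ?_ ?_
  · intro e he
    rw [involutionHom_apply, Fin.sum_univ_two] at he
    have hab' := add_ne_zero_of_ne h2a hab
    ext j : 1
    rcases zmod_two_eq (e 0) with h0 | h0 <;> rcases zmod_two_eq (e 1) with h1 | h1 <;>
      simp [h0, h1, ZMod.val_one, ha, hb, hab'] at he
    fin_cases j <;> assumption
  · simp [involutionHom_apply, Fin.sum_univ_two, ZMod.val_one, hX, hc]
  · simp [involutionHom_apply, Fin.sum_univ_two, ZMod.val_one, hX, hc]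

/-- The seven hypotheses on `a`, `b`, `c` say that no nonempty subset sum vanishes, that is, linear
independence over `ℤ/2`. Leaving `W` free serves the 3-cube, the prism over the tetrahedron and the
crosspolytope at once. -/
theorem isAddModel_of_three_independent (hgen : AddSubgroup.closure (X : Set D) = ⊤)
    {a b c : D} (h2a : 2 • a = 0) (h2b : 2 • b = 0) (h2c : 2 • c = 0)
    (ha : a ≠ 0) (hb : b ≠ 0) (hc : c ≠ 0) (hab : a ≠ b) (hac : a ≠ c) (hbc : b ≠ c)
    (habc : a + b + c ≠ 0) {W : Finset (Fin 3 → ZMod 2)}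
    (hX : ∀ z, z ∈ X ↔ ∃ e ∈ W, (e 0).val • a + (e 1).val • b + (e 2).val • c = z) :
    IsAddModel W (X : Set D) := by
  refine isAddModel_of_hom hgen
    (involutionHom ![a, b, c] (by simp [Fin.forall_fin_succ, h2a, h2b, h2c])) ?_ ?_ ?_
  · intro e he
    rw [involutionHom_apply, Fin.sum_univ_three] at he
    have hab' := add_ne_zero_of_ne h2a hab
    have hac' := add_ne_zero_of_ne h2a hac
    have hbc' := add_ne_zero_of_ne h2b hbc
    ext j : 1
    rcases zmod_two_eq (e 0) with h0 | h0 <;> rcases zmod_two_eq (e 1) with h1 | h1 <;>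
      rcases zmod_two_eq (e 2) with h2 | h2 <;>
      simp [h0, h1, h2, ZMod.val_one, ha, hb, hc, hab', hac', hbc', habc] at he
    fin_cases j <;> assumption
  · intro e he
    exact (hX _).2 ⟨e, he, by simp [involutionHom_apply, Fin.sum_univ_three]⟩
  · intro z hz
    obtain ⟨e, he, rfl⟩ := (hX z).1 hz
    exact ⟨e, he, by simp [involutionHom_apply, Fin.sum_univ_three]⟩

theorem isAddModel_cube_three (hgen : AddSubgroup.closure (X : Set D) = ⊤)
    (h2 : ∀ x ∈ X, 2 • x = 0) {a b c : D} (ha : a ≠ 0) (hb : b ≠ 0) (hc : c ≠ 0) (hab : a ≠ b)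
    (hac : a ≠ c) (hbc : b ≠ c) (habc : a + b ≠ c)
    (hX : ∀ z, z ∈ X ↔ z = 0 ∨ z = a ∨ z = b ∨ z = c) :
    IsAddModel ({0, ![1, 0, 0], ![0, 1, 0], ![0, 0, 1]} : Finset (Fin 3 → ZMod 2))
      (X : Set D) := by
  have h2a := h2 a ((hX a).2 (by simp))
  have h2b := h2 b ((hX b).2 (by simp))
  have h2c := h2 c ((hX c).2 (by simp))
  refine isAddModel_of_three_independent hgen h2a h2b h2c ha hb hc hab hac hbc
    (fun h => habc ?_) ?_
  · rw [two_nsmul] at h2c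
    exact (eq_neg_of_add_eq_zero_left h).trans (neg_eq_of_add_eq_zero_right h2c)
  · intro z
    simp [hX, ZMod.val_one, eq_comm (a := z)]

theorem isAddModel_prism_klein (hgen : AddSubgroup.closure (X : Set D) = ⊤)
    (h2 : ∀ x ∈ X, 2 • x = 0) {a b c d : D} (ha : a ≠ 0) (hb : b ≠ 0) (hd : d ≠ 0) (hab : a ≠ b)
    (had : a ≠ d) (hbd : b ≠ d) (hcd : c ≠ d) (habc : a + b = c)
    (hX : ∀ z, z ∈ X ↔ z = 0 ∨ z = a ∨ z = b ∨ z = c ∨ z = d) :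
    IsAddModel ({0, ![1, 0, 0], ![0, 1, 0], ![1, 1, 0], ![0, 0, 1]} : Finset (Fin 3 → ZMod 2))
      (X : Set D) := by
  have h2a := h2 a ((hX a).2 (by simp))
  have h2b := h2 b ((hX b).2 (by simp))
  have h2d := h2 d ((hX d).2 (by simp))
  refine isAddModel_of_three_independent hgen h2a h2b h2d ha hb hd hab had hbd
    (fun h => hcd ?_) ?_
  · rw [two_nsmul] at h2d
    rw [← habc]
    exact (eq_neg_of_add_eq_zero_left h).trans (neg_eq_of_add_eq_zero_right h2d)
  · intro z
    simp [hX, ZMod.val_one, eq_comm (a := z), habc]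

theorem isAddModel_crosspolytope (hgen : AddSubgroup.closure (X : Set D) = ⊤)
    (h2 : ∀ x ∈ X, 2 • x = 0) {a b c d : D} (ha : a ≠ 0) (hb : b ≠ 0) (hc : c ≠ 0) (hd : d ≠ 0)
    (hab : a ≠ b) (hac : a ≠ c) (hbc : b ≠ c) (habcd : a + b + c = d)
    (hX : ∀ z, z ∈ X ↔ z = 0 ∨ z = a ∨ z = b ∨ z = c ∨ z = d) :
    IsAddModel ({0, ![1, 0, 0], ![0, 1, 0], ![0, 0, 1], ![1, 1, 1]} : Finset (Fin 3 → ZMod 2))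
      (X : Set D) := by
  have h2a := h2 a ((hX a).2 (by simp))
  have h2b := h2 b ((hX b).2 (by simp))
  have h2c := h2 c ((hX c).2 (by simp))
  refine isAddModel_of_three_independent hgen h2a h2b h2c ha hb hc hab hac hbc
    (habcd ▸ hd) ?_
  intro z
  simp [hX, ZMod.val_one, eq_comm (a := z), habcd]

theorem isAddModel_cube_four (hgen : AddSubgroup.closure (X : Set D) = ⊤)
    (h2 : ∀ x ∈ X, 2 • x = 0) {a b c d : D} (ha : a ≠ 0) (hb : b ≠ 0) (hc : c ≠ 0) (hd : d ≠ 0)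
    (hab : a + b ≠ 0) (hac : a + c ≠ 0) (had : a + d ≠ 0) (hbc : b + c ≠ 0) (hbd : b + d ≠ 0)
    (hcd : c + d ≠ 0) (habc : a + b + c ≠ 0) (habd : a + b + d ≠ 0) (hacd : a + c + d ≠ 0)
    (hbcd : b + c + d ≠ 0) (habcd : a + b + c + d ≠ 0)
    (hX : ∀ z, z ∈ X ↔ z = 0 ∨ z = a ∨ z = b ∨ z = c ∨ z = d) :
    IsAddModel ({0, ![1, 0, 0, 0], ![0, 1, 0, 0], ![0, 0, 1, 0], ![0, 0, 0, 1]} :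
      Finset (Fin 4 → ZMod 2)) (X : Set D) := by
  have h2a := h2 a ((hX a).2 (by simp))
  have h2b := h2 b ((hX b).2 (by simp))
  have h2c := h2 c ((hX c).2 (by simp))
  have h2d := h2 d ((hX d).2 (by simp))
  refine isAddModel_of_hom hgen
    (involutionHom ![a, b, c, d] (by simp [Fin.forall_fin_succ, h2a, h2b, h2c, h2d])) ?_ ?_ ?_
  · intro e he
    rw [involutionHom_apply, Fin.sum_univ_four] at he
    ext j : 1
    rcases zmod_two_eq (e 0) with h0 | h0 <;> rcases zmod_two_eq (e 1) with h1 | h1 <;>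
      rcases zmod_two_eq (e 2) with h2 | h2 <;> rcases zmod_two_eq (e 3) with h3 | h3 <;>
      simp [h0, h1, h2, h3, ZMod.val_one, ha, hb, hc, hd, hab, hac, had, hbc, hbd, hcd, habc, habd,
        hacd, hbcd, habcd] at he
    fin_cases j <;> assumption
  · simp [involutionHom_apply, Fin.sum_univ_four, ZMod.val_one, hX]
  · simp [involutionHom_apply, Fin.sum_univ_four, ZMod.val_one, hX]

end Involutions

/-! ### The classification of generating sets with three to five elements. -/

/-- The subset `X` of the additive group `D` has the shape of the set of characters of the group of
the given row of the table. -/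
def TableRow.HasModel {D : Type*} [AddCommGroup D] (X : Set D) : TableRow → Prop
  | triangle => IsAddModel (Finset.univ : Finset (ZMod 3)) X
  | square => IsAddModel ({0, ![1, 0], ![0, 1]} : Finset (Fin 2 → ZMod 2)) X
  | tetrahedronCyclic => IsAddModel (Finset.univ : Finset (ZMod 4)) X
  | tetrahedronKlein =>
      IsAddModel ({0, ![1, 0], ![0, 1], ![1, 1]} : Finset (Fin 2 → ZMod 2)) X
  | triangularPrism => IsAddModel ({0, 2, 3, 4} : Finset (ZMod 6)) X
  | cube3 =>
      IsAddModel ({0, ![1, 0, 0], ![0, 1, 0], ![0, 0, 1]} : Finset (Fin 3 → ZMod 2)) X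
  | simplex4 => IsAddModel (Finset.univ : Finset (ZMod 5)) X
  | birkhoff3 => False
  | tetrahedralPrismZ2Z4 =>
      IsAddModel (Finset.univ.filter fun a : ZMod 2 × ZMod 4 => a.1 = 0 ∨ a.2 = 0) X
  | tetrahedralPrismZ2Cubed =>
      IsAddModel ({0, ![1, 0, 0], ![0, 1, 0], ![1, 1, 0], ![0, 0, 1]} :
        Finset (Fin 3 → ZMod 2)) X
  | crosspolytope4 =>
      IsAddModel ({0, ![1, 0, 0], ![0, 1, 0], ![0, 0, 1], ![1, 1, 1]} :
        Finset (Fin 3 → ZMod 2)) X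
  | productOfTriangles =>
      IsAddModel (Finset.univ.filter fun a : Fin 2 → ZMod 3 => a 0 = 0 ∨ a 1 = 0) X
  | prismOverTriangularPrism =>
      IsAddModel ({(0, 0), (2, 0), (3, 0), (4, 0), (0, 1)} : Finset (ZMod 6 × ZMod 2)) X
  | cube4 =>
      IsAddModel ({0, ![1, 0, 0, 0], ![0, 1, 0, 0], ![0, 0, 1, 0], ![0, 0, 0, 1]} :
        Finset (Fin 4 → ZMod 2)) X

/-- `ℤ/6 ≃ ℤ/2 × ℤ/3`. -/
noncomputable def zmodSixEquiv : ZMod 6 ≃+ ZMod 2 × ZMod 3 :=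
  AddEquiv.mk' (Equiv.ofBijective (fun a : ZMod 6 => ((a.val : ZMod 2), (a.val : ZMod 3)))
    (by decide)) (by decide)

/-- `ℤ/6 × ℤ/2 ≃ ℤ/3 × ℤ/2 × ℤ/2`. -/
noncomputable def zmodSixTwoEquiv : ZMod 6 × ZMod 2 ≃+ ZMod 3 × (ZMod 2 × ZMod 2) :=
  AddEquiv.mk' (Equiv.ofBijective
    (fun a : ZMod 6 × ZMod 2 => ((a.1.val : ZMod 3), (a.1.val : ZMod 2), a.2))
    (by decide +kernel)) (by decide +kernel)

/-- `(ℤ/3)² ≃ ℤ/3 × ℤ/3`. -/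
noncomputable def zmodThreeSqEquiv : (Fin 2 → ZMod 3) ≃+ ZMod 3 × ZMod 3 :=
  AddEquiv.mk' (Equiv.ofBijective (fun a : Fin 2 → ZMod 3 => (a 0, a 1))
    (by decide +kernel)) (by decide +kernel)

section Classification

variable {D : Type*} [AddCommGroup D] {X : Finset D}

theorem addOrderOf_le_card_of_smul_closed (hsmul : ∀ x ∈ X, ∀ k : ℕ,
    k • x ∈ X) {x : D} (hx : x ∈ X) :
    addOrderOf x ≤ X.card := by
  classical
  rw [← card_multiples]
  exact Finset.card_le_card (multiples_subset hsmul hx)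

theorem two_nsmul_eq_zero_of_addOrderOf_le {x : D} (h0 : addOrderOf x ≠ 0)
    (h : addOrderOf x ≤ 2) : 2 • x = 0 := by
  rw [← addOrderOf_dvd_iff_nsmul_eq_zero]
  interval_cases addOrderOf x
  · exact absurd rfl h0
  · exact one_dvd 2
  · exact dvd_rfl

/-- The shape depends only on which nonzero elements of `X` sum to zero. With four of them there are
three shapes: three sum to zero and the fourth is the prism direction, only all four sum to zero, or
there is no relation. -/
theorem exists_model_of_involutions (hgen : AddSubgroup.closure (X : Set D) = ⊤) (h0 : 0 ∈ X)
    (h2 : ∀ x ∈ X, 2 • x = 0) (hc : 3 ≤ X.card) (hc' : X.card ≤ 5) :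
    ∃ r : TableRow, r.dim + 1 = X.card ∧ r.HasModel (X : Set D) := by
  classical
  have hcard : (X.erase 0).card + 1 = X.card := Finset.card_erase_add_one h0
  have hmem : ∀ z, z ∈ X ↔ z = 0 ∨ z ∈ X.erase 0 := by
    intro z
    rw [Finset.mem_erase]
    by_cases h : z = 0
    · simp [h, h0]
    · simp [h]
  have hne : ∀ z ∈ X.erase 0, z ≠ 0 := fun z hz => Finset.ne_of_mem_erase hz
  obtain h | h | h : (X.erase 0).card = 2 ∨ (X.erase 0).card = 3 ∨ (X.erase 0).card = 4 := by omega
  · obtain ⟨a, b, hab, hX⟩ := Finset.card_eq_two.1 h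
    simp only [hX, Finset.mem_insert, Finset.mem_singleton] at hmem hne
    exact ⟨.square, by rw [← hcard, h]; rfl,
      isAddModel_square hgen h2 (hne a (by simp)) (hne b (by simp)) hab hmem⟩
  · obtain ⟨a, b, c, hab, hac, hbc, hX⟩ := Finset.card_eq_three.1 h
    simp only [hX, Finset.mem_insert, Finset.mem_singleton] at hmem hne
    have ha := hne a (by simp)
    have hb := hne b (by simp)
    have hc := hne c (by simp)
    by_cases habc : a + b = c
    · exact ⟨.tetrahedronKlein, by rw [← hcard, h]; rfl,
        isAddModel_klein hgen h2 ha hb hab habc hmem⟩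
    · exact ⟨.cube3, by rw [← hcard, h]; rfl,
        isAddModel_cube_three hgen h2 ha hb hc hab hac hbc habc hmem⟩
  · obtain ⟨a, haX⟩ : (X.erase 0).Nonempty := Finset.card_pos.1 (by omega)
    have h' : ((X.erase 0).erase a).card = 3 := by rw [Finset.card_erase_of_mem haX, h]
    obtain ⟨b, c, d, hbc, hbd, hcd, hX⟩ := Finset.card_eq_three.1 h'
    have hX' : X.erase 0 = {a, b, c, d} := by rw [← hX, Finset.insert_erase haX]
    have hnea : ∀ z ∈ (X.erase 0).erase a, z ≠ a := fun z hz => Finset.ne_of_mem_erase hz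
    rw [hX] at hnea
    simp only [hX', Finset.mem_insert, Finset.mem_singleton] at hmem hne hnea
    have ha := hne a (by simp)
    have hb := hne b (by simp)
    have hc := hne c (by simp)
    have hd := hne d (by simp)
    have hab := (hnea b (by simp)).symm
    have hac := (hnea c (by simp)).symm
    have had := (hnea d (by simp)).symm
    have h2a := h2 a ((hmem a).2 (by simp))
    have h2b := h2 b ((hmem b).2 (by simp))
    have h2c := h2 c ((hmem c).2 (by simp))
    have h2d := h2 d ((hmem d).2 (by simp))
    have hsum : ∀ s t : D, 2 • t = 0 → s + t = 0 → s = t := fun s t ht hst => by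
      rw [two_nsmul] at ht
      exact (eq_neg_of_add_eq_zero_left hst).trans (neg_eq_of_add_eq_zero_right ht)
    have hdim : 4 + 1 = X.card := by omega
    by_cases habc : a + b = c
    · exact ⟨.tetrahedralPrismZ2Cubed, hdim,
        isAddModel_prism_klein hgen h2 ha hb hd hab had hbd hcd habc hmem⟩
    by_cases habd : a + b = d
    · exact ⟨.tetrahedralPrismZ2Cubed, hdim,
        isAddModel_prism_klein hgen h2 ha hb hc hab hac hbc hcd.symm habd
          (fun z => (hmem z).trans (by tauto))⟩
    by_cases hacd : a + c = d
    · exact ⟨.tetrahedralPrismZ2Cubed, hdim,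
        isAddModel_prism_klein hgen h2 ha hc hb hac hab hbc.symm hbd.symm hacd
          (fun z => (hmem z).trans (by tauto))⟩
    by_cases hbcd : b + c = d
    · exact ⟨.tetrahedralPrismZ2Cubed, hdim,
        isAddModel_prism_klein hgen h2 hb hc ha hbc hab.symm hac.symm had.symm hbcd
          (fun z => (hmem z).trans (by tauto))⟩
    by_cases habcd : a + b + c = d
    · exact ⟨.crosspolytope4, hdim,
        isAddModel_crosspolytope hgen h2 ha hb hc hd hab hac hbc habcd hmem⟩
    · exact ⟨.cube4, hdim, isAddModel_cube_four hgen h2 ha hb hc hd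
        (add_ne_zero_of_ne h2a hab) (add_ne_zero_of_ne h2a hac) (add_ne_zero_of_ne h2a had)
        (add_ne_zero_of_ne h2b hbc) (add_ne_zero_of_ne h2b hbd) (add_ne_zero_of_ne h2c hcd)
        (fun h => habc (hsum _ _ h2c h)) (fun h => habd (hsum _ _ h2d h))
        (fun h => hacd (hsum _ _ h2d h)) (fun h => hbcd (hsum _ _ h2d h))
        (fun h => habcd (hsum _ _ h2d h)) hmem⟩

/-- Orders are at most `X.card ≤ 5`, since `X` contains all multiples of its elements. The largest
order occurring is split off case by case, leaving at most two elements outside its multiples unless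
all elements are involutions or zero. -/
theorem exists_model (hgen : AddSubgroup.closure (X : Set D) = ⊤) (h0 : 0 ∈ X)
    (hsmul : ∀ x ∈ X, ∀ k : ℕ, k • x ∈ X) (hc : 3 ≤ X.card) (hc' : X.card ≤ 5) :
    ∃ r : TableRow, r.dim + 1 = X.card ∧ r.HasModel (X : Set D) := by
  classical
  have hne : ∀ x ∈ X, addOrderOf x ≠ 0 := fun x hx => addOrderOf_ne_zero_of_mem hsmul hx
  have hle : ∀ x ∈ X, addOrderOf x ≤ X.card := fun x hx =>
      addOrderOf_le_card_of_smul_closed hsmul hx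
  by_cases h5 : ∃ x ∈ X, addOrderOf x = 5
  · obtain ⟨x, hx, ho⟩ := h5
    have hc5 : X.card = 5 := le_antisymm hc' (ho ▸ hle x hx)
    exact ⟨.simplex4, hc5.symm, isAddModel_cyclic hgen hsmul hx ho hc5⟩
  by_cases h4 : ∃ x ∈ X, addOrderOf x = 4
  · obtain ⟨x, hx, ho⟩ := h4
    have := ho ▸ hle x hx
    obtain h | h : X.card = 4 ∨ X.card = 5 := by omega
    · exact ⟨.tetrahedronCyclic, h.symm, isAddModel_cyclic hgen hsmul hx ho h⟩
    · exact ⟨.tetrahedralPrismZ2Z4, h.symm, isAddModel_prism hgen hsmul hx ho h⟩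
  push Not at h5 h4
  have hle3 : ∀ x ∈ X, addOrderOf x ≤ 3 := by
    intro x hx
    have h1 := hle x hx
    have h2 := h5 x hx
    have h3 := h4 x hx
    omega
  by_cases h3 : ∃ x ∈ X, addOrderOf x = 3
  · obtain ⟨x, hx, ho⟩ := h3
    obtain h | h | h : X.card = 3 ∨ X.card = 4 ∨ X.card = 5 := by omega
    · exact ⟨.triangle, h.symm, isAddModel_cyclic hgen hsmul hx ho h⟩
    · refine ⟨.triangularPrism, h.symm,
        IsAddModel.of_equiv zmodSixEquiv ?_ (isAddModel_prism hgen hsmul hx ho h)⟩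
      change ∀ a : ZMod 6, _ ↔ ((a.val : ZMod 2), (a.val : ZMod 3)) ∈ _
      decide
    · rcases isAddModel_three_add_two hgen hsmul hx ho h hle3 with hm | hm
      · refine ⟨.productOfTriangles, h.symm, IsAddModel.of_equiv zmodThreeSqEquiv ?_ hm⟩
        change ∀ a : Fin 2 → ZMod 3, _ ↔ (a 0, a 1) ∈ _
        decide
      · refine ⟨.prismOverTriangularPrism, h.symm, IsAddModel.of_equiv zmodSixTwoEquiv ?_ hm⟩
        change ∀ a : ZMod 6 × ZMod 2, _ ↔ ((a.1.val : ZMod 3), (a.1.val : ZMod 2), a.2) ∈ _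
        decide +kernel
  push Not at h3
  refine exists_model_of_involutions hgen h0 (fun x hx => ?_) hc hc'
  refine two_nsmul_eq_zero_of_addOrderOf_le (hne x hx) ?_
  have h1 := hle3 x hx
  have h2 := h3 x hx
  omega

end Classification

/-! ### Recognizing polytopes by zero-one coordinates. -/

section ZeroOne

/-- `Q` is the convex hull of points `u k` whose coordinates `ℓ c (u k)` are zero or one, as
prescribed by `B`. -/
def IsZeroOnePolytope {E κ C : Type*} [AddCommGroup E] [Module ℝ E] (Q : Set E)
    (B : κ → C → Bool) : Prop :=
  ∃ (u : κ → E) (ℓ : C → E →ₗ[ℝ] ℝ), Q = convexHull ℝ (Set.range u) ∧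
    (∀ x, (∀ c, ℓ c x = 0) → x = 0) ∧ ∀ k c, ℓ c (u k) = if B k c then 1 else 0

variable {E F κ C κ' C' : Type*} [AddCommGroup E] [Module ℝ E] [AddCommGroup F] [Module ℝ F]

theorem IsZeroOnePolytope.prod {Q : Set E} {Q' : Set F} {B : κ → C → Bool} {B' : κ' → C' → Bool}
    (h : IsZeroOnePolytope Q B) (h' : IsZeroOnePolytope Q' B') :
    IsZeroOnePolytope (Q ×ˢ Q') fun (k : κ × κ') (c : C ⊕ C') => Sum.elim (B k.1) (B' k.2) c := by
  obtain ⟨u, ℓ, rfl, h1, h2⟩ := h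
  obtain ⟨u', ℓ', rfl, h1', h2'⟩ := h'
  refine ⟨Prod.map u u', Sum.elim (fun c => ℓ c ∘ₗ LinearMap.fst ℝ E F)
    (fun c => ℓ' c ∘ₗ LinearMap.snd ℝ E F), ?_, ?_, ?_⟩
  · rw [Set.range_prodMap, convexHull_prod]
  · rintro ⟨x, y⟩ hxy
    rw [Sum.forall] at hxy
    exact Prod.ext (h1 x hxy.1) (h1' y hxy.2)
  · rintro k (c | c)
    · exact h2 k.1 c
    · exact h2' k.2 c

theorem isZeroOnePolytope_Icc :
    IsZeroOnePolytope (Set.Icc (0 : ℝ) 1) fun (k : ZMod 2) (_ : Unit) => decide (k = 1) := by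
  refine ⟨fun k => if k = 1 then 1 else 0, fun _ => LinearMap.id, ?_, fun x hx => hx (), ?_⟩
  · have : Set.range (fun k : ZMod 2 => if k = 1 then (1 : ℝ) else 0) = {0, 1} := by
      ext x
      constructor
      · rintro ⟨k, rfl⟩
        dsimp only
        split_ifs <;> simp
      · rintro (rfl | rfl)
        exacts [⟨0, by simp⟩, ⟨1, by simp⟩]
    rw [this, convexHull_pair, segment_eq_Icc zero_le_one]
  · intro k c
    simp

theorem isZeroOnePolytope_cube (d : ℕ) :
    IsZeroOnePolytope (cube d) fun (k : Fin d → ZMod 2) (c : Fin d) => decide (k c = 1) := by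
  refine ⟨fun k c => if k c = 1 then 1 else 0, LinearMap.proj, ?_, fun x hx => funext hx, ?_⟩
  · have : Set.range (fun (k : Fin d → ZMod 2) (c : Fin d) => if k c = 1 then (1 : ℝ) else 0) =
        Set.pi Set.univ fun _ => {0, 1} := by
      ext x
      constructor
      · rintro ⟨k, rfl⟩ c _
        dsimp only
        split_ifs <;> simp
      · intro hx
        refine ⟨fun c => if x c = 1 then 1 else 0, funext fun c => ?_⟩
        rcases hx c (Set.mem_univ c) with h | h <;> simp_all
    rw [this, convexHull_pi]
    simp_rw [convexHull_pair, segment_eq_Icc (zero_le_one' ℝ)]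
    rw [Set.pi_univ_Icc]
    rfl
  · intro k c
    simp

theorem isZeroOnePolytope_simplex (d : ℕ) :
    IsZeroOnePolytope (simplex d) fun k c : Fin (d + 1) => decide (k = c) := by
  refine ⟨fun k c => if k = c then 1 else 0, LinearMap.proj,
    (convexHull_basis_eq_stdSimplex ℝ (Fin (d + 1))).symm, fun x hx => funext hx, ?_⟩
  intro k c
  simp

/-- Affine functions respect sum-zero dependencies, and the `ℓ c` jointly detect zero. -/
theorem affDep_le_of_affine_coordinates {ι C : Type*} [Fintype ι] {v : ι → E} {w : ι → F}
    (ℓ : C → F →ₗ[ℝ] ℝ) (hℓ : ∀ x, (∀ c, ℓ c x = 0) → x = 0)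
    (h : ∀ c, ∃ (T : E →ₗ[ℝ] ℝ) (b : ℝ), ∀ i, ℓ c (w i) = T (v i) + b) :
    affDep v ≤ affDep w := by
  rintro x ⟨hx, hx'⟩
  refine ⟨hℓ _ fun c => ?_, hx'⟩
  obtain ⟨T, b, hT⟩ := h c
  have h1 : T (∑ i, x i • v i) = 0 := by rw [hx, map_zero]
  simp only [map_sum, map_smul, smul_eq_mul] at h1 ⊢
  simp_rw [hT, mul_add, Finset.sum_add_distrib]
  rw [h1, ← Finset.sum_mul, hx', zero_mul, add_zero]

/-- An entry of a matrix, as a linear functional. -/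
def entryMap {n : ℕ} (i j : Fin n) : Matrix (Fin n) (Fin n) ℝ →ₗ[ℝ] ℝ where
  toFun M := M i j
  map_add' _ _ := rfl
  map_smul' _ _ := rfl

theorem entryMap_actMat {H : Type*} [Group H] {n : ℕ} (f : H →* Equiv.Perm (Fin n)) (i j : Fin n)
    (h : H) : entryMap i j (actMat f h) = if f h j = i then 1 else 0 :=
  actMat_apply f h i j

theorem eq_zero_of_entryMap {n : ℕ} (M : Matrix (Fin n) (Fin n) ℝ)
    (h : ∀ c : Fin n × Fin n, entryMap c.1 c.2 M = 0) : M = 0 := by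
  ext i j
  exact h (i, j)

/-- Each matrix entry is identically zero, a coordinate of `Q` or one minus a coordinate, and each
coordinate occurs as an entry. So the two vertex families are affine functions of each other. The
hypotheses are finite Boolean checks. -/
theorem combinatoriallyEquivalent_of_isZeroOnePolytope {H : Type*} [Group H] [Fintype H] {n : ℕ}
    (f : H →* Equiv.Perm (Fin n)) [TopologicalSpace E] [IsTopologicalAddGroup E]
    [ContinuousSMul ℝ E] [T2Space E] [FiniteDimensional ℝ E] {Q : Set E} {B : κ → C → Bool}
    (hQ : IsZeroOnePolytope Q B) (idx : H → κ) (hidx : Function.Surjective idx)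
    (h1 : ∀ i j, (∀ h, f h j ≠ i) ∨ ∃ c, (∀ h, f h j = i ↔ B (idx h) c = true) ∨
      ∀ h, f h j = i ↔ B (idx h) c = false)
    (h2 : ∀ c, ∃ i j, ∀ h, B (idx h) c = true ↔ f h j = i) :
    CombinatoriallyEquivalent (convexHull ℝ (Set.range (actMat f))) Q := by
  obtain ⟨u, ℓ, rfl, hℓ, hu⟩ := hQ
  rw [← hidx.range_comp u]
  refine combinatoriallyEquivalent_of_affDep_eq (le_antisymm ?_ ?_)
  · refine affDep_le_of_affine_coordinates ℓ hℓ fun c => ?_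
    obtain ⟨i, j, hij⟩ := h2 c
    refine ⟨entryMap i j, 0, fun h => ?_⟩
    rw [entryMap_actMat, Function.comp_apply, hu, add_zero]
    exact if_congr (hij h) rfl rfl
  · refine affDep_le_of_affine_coordinates (fun c : Fin n × Fin n => entryMap c.1 c.2)
      eq_zero_of_entryMap ?_
    rintro ⟨i, j⟩
    simp only [entryMap_actMat]
    rcases h1 i j with h0 | ⟨c, hc | hc⟩
    · exact ⟨0, 0, fun h => by simp [h0 h]⟩
    · refine ⟨ℓ c, 0, fun h => ?_⟩
      rw [Function.comp_apply, hu, add_zero]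
      exact if_congr (hc h) rfl rfl
    · refine ⟨-ℓ c, 1, fun h => ?_⟩
      rw [LinearMap.neg_apply, Function.comp_apply, hu]
      by_cases hh : f h j = i
      · rw [if_pos hh, (hc h).1 hh]
        simp
      · have hB : B (idx h) c = true := by simpa using mt (hc h).2 hh
        rw [if_neg hh, hB]
        simp

end ZeroOne

/-! ### Applying the classification to character sets. -/

section Models

variable {H : Type*} [CommGroup H] {n : ℕ}

/-- The set of characters of a permutation action, in additive notation. -/
def addCharSet (f : H →* Equiv.Perm (Fin n)) : Set (Additive (H →* ℂˣ)) :=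
  {χ | χ.toMul ∈ charSet f}

theorem IsAddModel.isDualModel {A : Type*} [AddCommGroup A] {W : Finset A}
    {f : H →* Equiv.Perm (Fin n)} (h : IsAddModel W (addCharSet f)) :
    IsDualModel (W : Set A) (charSet f) := by
  obtain ⟨θ, hθ⟩ := h
  exact ⟨⟨θ.toEquiv, fun a b => θ.map_add a b⟩, hθ⟩

theorem exists_mulEquiv_of_hasModel {H' : Type*} [CommGroup H'] [Fintype H] [Fintype H'] {m : ℕ}
    {f : H →* Equiv.Perm (Fin n)} {f' : H' →* Equiv.Perm (Fin m)} (r : TableRow)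
    (h : r.HasModel (addCharSet f)) (h' : r.HasModel (addCharSet f')) :
    ∃ φ : H ≃* H', affDep (actMat f) = affDep (actMat (f'.comp φ.toMonoidHom)) := by
  cases r
  case birkhoff3 => exact h.elim
  all_goals
    exact exists_mulEquiv_of_dualModel (IsAddModel.isDualModel h) (IsAddModel.isDualModel h')

theorem ncard_eq_of_isAddModel {A D : Type*} [AddCommGroup A] [AddCommGroup D] {W : Finset A}
    {X : Set D} (h : IsAddModel W X) : X.ncard = W.card := by
  obtain ⟨θ, hθ⟩ := h
  have : X = θ '' W := by
    ext x
    constructor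
    · intro hx
      refine ⟨θ.symm x, (hθ _).2 (by simpa using hx), by simp⟩
    · rintro ⟨a, ha, rfl⟩
      exact (hθ a).1 ha
  rw [this, Set.ncard_image_of_injective _ θ.injective, Set.ncard_coe_finset]

theorem TableRow.ncard_eq_of_hasModel {D : Type*} [AddCommGroup D] {X : Set D} {r : TableRow}
    (h : r.HasModel X) : X.ncard = r.dim + 1 := by
  cases r
  case birkhoff3 => exact h.elim
  all_goals exact (ncard_eq_of_isAddModel h).trans (by decide +kernel)

theorem ncard_addCharSet (f : H →* Equiv.Perm (Fin n)) :
    (addCharSet f).ncard = (charSet f).ncard :=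
  Set.ncard_congr (fun χ _ => χ.toMul) (fun _ h => h) (fun _ _ _ _ h => h)
    fun χ h => ⟨Additive.ofMul χ, h, rfl⟩

variable [Fintype H]

theorem polytopeDim_of_isAddModel {A : Type*} [AddCommGroup A] {W : Finset A}
    {f : H →* Equiv.Perm (Fin n)} (h : IsAddModel W (addCharSet f)) :
    polytopeDim (convexHull ℝ (Set.range (actMat f))) + 1 = W.card := by
  rw [polytopeDim_actMat, ← ncard_addCharSet, ncard_eq_of_isAddModel h]

theorem polytopeDim_of_hasModel {r : TableRow}
    {f : H →* Equiv.Perm (Fin n)} (h : r.HasModel (addCharSet f)) :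
    polytopeDim (convexHull ℝ (Set.range (actMat f))) = r.dim := by
  have := polytopeDim_actMat f
  rw [← ncard_addCharSet, TableRow.ncard_eq_of_hasModel h] at this
  omega

theorem finite_charSet (f : H →* Equiv.Perm (Fin n)) : (addCharSet f).Finite := by
  have : Finite (H →* ℂˣ) := Finite.of_equiv _
      (CommGroup.monoidHom_mulEquiv_of_hasEnoughRootsOfUnity H ℂ).some.toEquiv.symm
  exact Set.toFinite (α := H →* ℂˣ) _

theorem closure_addCharSet {f : H →* Equiv.Perm (Fin n)} (hf : Function.Injective f) :
    AddSubgroup.closure (addCharSet f) = ⊤ := by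
  have h := closure_charSet hf
  rw [eq_top_iff]
  intro χ _
  have hχ : χ.toMul ∈ Subgroup.closure (charSet f) := h ▸ Subgroup.mem_top _
  refine Subgroup.closure_induction (p := fun χ _ => Additive.ofMul χ ∈
    AddSubgroup.closure (addCharSet f)) ?_ ?_ ?_ ?_ hχ
  · exact fun ψ hψ => AddSubgroup.subset_closure hψ
  · exact zero_mem _
  · exact fun ψ ψ' _ _ h h' => add_mem h h'
  · exact fun ψ _ h => neg_mem h

/-- These are the hypotheses of `exists_model`, with the cardinality expressed by the dimension of
the polytope. -/
theorem exists_finset_addCharSet {f : H →* Equiv.Perm (Fin n)} (hf : Function.Injective f) :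
    ∃ X : Finset (Additive (H →* ℂˣ)), (X : Set (Additive (H →* ℂˣ))) = addCharSet f ∧
      AddSubgroup.closure (X : Set (Additive (H →* ℂˣ))) = ⊤ ∧ 0 ∈ X ∧
      (∀ x ∈ X, ∀ k : ℕ, k • x ∈ X) ∧
      X.card = polytopeDim (convexHull ℝ (Set.range (actMat f))) + 1 := by
  refine ⟨(finite_charSet f).toFinset, Set.Finite.coe_toFinset _, ?_, ?_, ?_, ?_⟩
  · rw [Set.Finite.coe_toFinset, closure_addCharSet hf]
  · rw [Set.Finite.mem_toFinset]
    exact one_mem_charSet f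
  · intro x hx k
    rw [Set.Finite.mem_toFinset] at hx ⊢
    exact pow_mem_charSet hx k
  · rw [polytopeDim_actMat, ← ncard_addCharSet, Set.ncard_eq_toFinset_card _ (finite_charSet f)]

theorem exists_hasModel {f : H →* Equiv.Perm (Fin n)} (hf : Function.Injective f)
    (h2 : 2 ≤ polytopeDim (convexHull ℝ (Set.range (actMat f))))
    (h4 : polytopeDim (convexHull ℝ (Set.range (actMat f))) ≤ 4) :
    ∃ r : TableRow, r.HasModel (addCharSet f) := by
  obtain ⟨X, hX, hgen, h0, hsmul, hcard⟩ := exists_finset_addCharSet hf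
  obtain ⟨r, _, hr⟩ := exists_model (X := X) hgen h0 hsmul (by omega) (by omega)
  exact ⟨r, hX ▸ hr⟩

end Models

/-! ### Character sets from bilinear pairings. -/

section Pairing

variable {A : Type} [AddCommGroup A] {n N : ℕ} [NeZero N]

/-- The character of `A` defined by a homomorphism to `ZMod N`. -/
noncomputable def charOfHom (p : A →+ ZMod N) : Multiplicative A →* ℂˣ :=
  Circle.toUnits.comp ((ZMod.toCircle (N := N)).toMonoidHom.comp (AddMonoidHom.toMultiplicative p))

theorem charOfHom_eq_one_iff (p : A →+ ZMod N) (a : A) :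
    charOfHom p (Multiplicative.ofAdd a) = 1 ↔ p a = 0 := by
  have h1 : charOfHom p (Multiplicative.ofAdd a) = Circle.toUnits (ZMod.toCircle (p a)) := rfl
  rw [h1]
  constructor
  · intro h
    apply ZMod.injective_toCircle (N := N)
    rw [AddChar.map_zero_eq_one]
    exact Circle.ext (by simpa using congrArg Units.val h)
  · intro h
    rw [h, AddChar.map_zero_eq_one, map_one]

/-- A nondegenerate pairing embeds `A` in its dual, and the cardinalities agree, so it is an
isomorphism. This reduces the computation of a character set to a decidable condition on `W`. -/
theorem isAddModel_of_pairing [Fintype A] [NeZero n] (f : Multiplicative A →* Equiv.Perm (Fin n))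
    (p : A → A → ZMod N) (hp₁ : ∀ a b c, p (a + b) c = p a c + p b c)
    (hp₂ : ∀ a b c, p a (b + c) = p a b + p a c) (hp : ∀ a, (∀ b, p a b = 0) → a = 0)
    (W : Finset A)
    (hW : ∀ e, e ∈ W ↔ ∃ j, ∀ a : A, f (Multiplicative.ofAdd a) j = j → p e a = 0) :
    IsAddModel W (addCharSet f) := by
  let P : A → A →+ ZMod N := fun e => AddMonoidHom.mk' (p e) (hp₂ e)
  have hP : ∀ e a, charOfHom (P e) (Multiplicative.ofAdd a) = 1 ↔ p e a = 0 := fun e a =>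
    charOfHom_eq_one_iff (P e) a
  let θ : A →+ Additive (Multiplicative A →* ℂˣ) :=
    AddMonoidHom.mk' (fun e => Additive.ofMul (charOfHom (P e))) (by
      intro e e'
      apply Additive.toMul.injective
      ext a
      have : P (e + e') = P e + P e' := AddMonoidHom.ext (hp₁ e e')
      rw [this]
      simp [charOfHom, AddChar.map_add_eq_mul])
  have hinj : Function.Injective θ := by
    refine (injective_iff_map_eq_zero θ).2 fun e he => hp e fun b => ?_
    rw [← hP]
    exact DFunLike.congr_fun (congrArg Additive.toMul he) (Multiplicative.ofAdd b)
  have : Finite (Multiplicative A →* ℂˣ) := Finite.of_equiv _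
    (CommGroup.monoidHom_mulEquiv_of_hasEnoughRootsOfUnity (Multiplicative A) ℂ).some.toEquiv.symm
  have hbij : Function.Bijective θ := by
    refine (Nat.bijective_iff_injective_and_card θ).2 ⟨hinj, ?_⟩
    exact (CommGroup.card_monoidHom_of_hasEnoughRootsOfUnity (Multiplicative A) ℂ).symm
  refine ⟨AddEquiv.ofBijective θ hbij, fun e => ?_⟩
  rw [hW]
  constructor
  · rintro ⟨j, hj⟩
    exact Or.inr ⟨j, fun a ha => (hP e a.toAdd).2 (hj _ ha)⟩
  · rintro (h | ⟨j, hj⟩)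
    -- The trivial character needs no clause of its own in `hW`: as `n ≠ 0`, there is a point, and
    -- that character is trivial on its stabilizer.
    · exact ⟨0, fun a _ => (hP e a).1 (DFunLike.congr_fun h _)⟩
    · exact ⟨j, fun a ha => (hP e a).1 (hj _ ha)⟩

end Pairing

/-! ### Realizing the abelian rows. -/

/-- An abelian group with a faithful permutation action that realizes a row of the table. -/
def TableRow.IsRealized (r : TableRow) : Prop :=
  ∃ (H : Type) (_ : CommGroup H) (_ : Fintype H) (f : H →* Equiv.Perm (Fin r.degree)),
    Function.Injective f ∧ f.range = r.group ∧ r.HasModel (addCharSet f) ∧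
      r.HasCombType (convexHull ℝ (Set.range (actMat f))) ∧ r.HasIsoType H

section Rows

variable {A : Type} [AddCommGroup A] {n : ℕ}

/-- A multiplicative family of permutations, as a homomorphism. -/
def permHom (F : A → Equiv.Perm (Fin n)) (hF : ∀ a b, F (a + b) = F a * F b) :
    Multiplicative A →* Equiv.Perm (Fin n) :=
  MonoidHom.mk' (fun a => F a.toAdd) fun a b => hF a.toAdd b.toAdd

theorem permHom_injective {F : A → Equiv.Perm (Fin n)} (hF : ∀ a b, F (a + b) = F a * F b)
    (h : ∀ a, F a = 1 → a = 0) : Function.Injective (permHom F hF) :=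
  (injective_iff_map_eq_one _).2 fun a ha => h a.toAdd ha

theorem permHom_range {F : A → Equiv.Perm (Fin n)} (hF : ∀ a b, F (a + b) = F a * F b)
    {S : Set (Equiv.Perm (Fin n))} (h₁ : ∀ a, F a ∈ Subgroup.closure S)
    (h₂ : ∀ s ∈ S, ∃ a, F a = s) : (permHom F hF).range = Subgroup.closure S := by
  refine le_antisymm ?_ ((Subgroup.closure_le _).2 fun s hs => ?_)
  · rintro _ ⟨a, rfl⟩
    exact h₁ a.toAdd
  · obtain ⟨a, rfl⟩ := h₂ s hs
    exact ⟨Multiplicative.ofAdd a, rfl⟩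

end Rows

-- The zero-one rows share one pattern: an explicit parametrization `F` of the row's group, a
-- self-pairing of the parameter group for the character set, and a labelling of the vertices of the
-- target polytope by group elements. The `change` steps expose closed finite statements for
-- `decide`.
open Subgroup in
theorem isRealized_triangle : TableRow.triangle.IsRealized := by
  let F : ZMod 3 → Equiv.Perm (Fin 3) := fun e =>
    c[0, 1, 2] ^ e.val
  have hF : ∀ a b, F (a + b) = F a * F b := by decide +kernel
  refine ⟨_, inferInstance, inferInstance, permHom F hF,
    permHom_injective hF (by decide +kernel),
    permHom_range hF (fun a => pow_mem (subset_closure (by simp)) _) ?_, ?_, ?_, ⟨MulEquiv.refl _⟩⟩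
  · rintro s rfl
    exact ⟨(1 : ZMod 3), by decide +kernel⟩
  · exact isAddModel_of_pairing (n := 3) (N := 3) _ (· * ·) add_mul mul_add
      (by decide +kernel) _ (by
        change ∀ e : ZMod 3, _ ↔ ∃ j : Fin 3, ∀ a, F a j = j → _
        decide +kernel)
  · refine combinatoriallyEquivalent_of_isZeroOnePolytope (n := 3) _ (isZeroOnePolytope_simplex 2)
      Multiplicative.toAdd Multiplicative.toAdd.surjective ?_ ?_
    · change ∀ i j : Fin 3, (∀ a, F a j ≠ i) ∨ ∃ c : Fin 3,
        (∀ a : ZMod 3, F a j = i ↔ _) ∨ (∀ a : ZMod 3, F a j = i ↔ _)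
      decide +kernel
    · change ∀ c : Fin 3, ∃ i j : Fin 3, ∀ a : ZMod 3, _ ↔ F a j = i
      decide +kernel

open Subgroup in
theorem isRealized_square : TableRow.square.IsRealized := by
  let F : (Fin 2 → ZMod 2) → Equiv.Perm (Fin 4) := fun e =>
    c[0, 1] ^ (e 0).val * c[2, 3] ^ (e 1).val
  have hF : ∀ a b, F (a + b) = F a * F b := by decide +kernel
  refine ⟨_, inferInstance, inferInstance, permHom F hF,
    permHom_injective hF (by decide +kernel),
    permHom_range hF (fun a => mul_mem (pow_mem (subset_closure (by simp)) _)
        (pow_mem (subset_closure (by simp)) _)) ?_, ?_, ?_, ⟨MulEquiv.refl _⟩⟩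
  · rintro s (rfl | rfl)
    exacts [⟨![1, 0], by decide +kernel⟩, ⟨![0, 1], by decide +kernel⟩]
  · exact isAddModel_of_pairing (n := 4) (N := 2) _ dotProduct add_dotProduct dotProduct_add
      (by decide +kernel) _ (by
        change ∀ e : (Fin 2 → ZMod 2), _ ↔ ∃ j : Fin 4, ∀ a, F a j = j → _
        decide +kernel)
  · refine combinatoriallyEquivalent_of_isZeroOnePolytope (n := 4) _ (isZeroOnePolytope_cube 2)
      Multiplicative.toAdd Multiplicative.toAdd.surjective ?_ ?_
    · change ∀ i j : Fin 4, (∀ a, F a j ≠ i) ∨ ∃ c : Fin 2,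
        (∀ a : (Fin 2 → ZMod 2), F a j = i ↔ _) ∨ (∀ a : (Fin 2 → ZMod 2), F a j = i ↔ _)
      decide +kernel
    · change ∀ c : Fin 2, ∃ i j : Fin 4, ∀ a : (Fin 2 → ZMod 2), _ ↔ F a j = i
      decide +kernel

open Subgroup in
theorem isRealized_tetrahedronCyclic : TableRow.tetrahedronCyclic.IsRealized := by
  let F : ZMod 4 → Equiv.Perm (Fin 4) := fun e =>
    c[0, 1, 2, 3] ^ e.val
  have hF : ∀ a b, F (a + b) = F a * F b := by decide +kernel
  refine ⟨_, inferInstance, inferInstance, permHom F hF,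
    permHom_injective hF (by decide +kernel),
    permHom_range hF (fun a => pow_mem (subset_closure (by simp)) _) ?_, ?_, ?_, ⟨MulEquiv.refl _⟩⟩
  · rintro s rfl
    exact ⟨(1 : ZMod 4), by decide +kernel⟩
  · exact isAddModel_of_pairing (n := 4) (N := 4) _ (· * ·) add_mul mul_add
      (by decide +kernel) _ (by
        change ∀ e : ZMod 4, _ ↔ ∃ j : Fin 4, ∀ a, F a j = j → _
        decide +kernel)
  · refine combinatoriallyEquivalent_of_isZeroOnePolytope (n := 4) _ (isZeroOnePolytope_simplex 3)
      Multiplicative.toAdd Multiplicative.toAdd.surjective ?_ ?_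
    · change ∀ i j : Fin 4, (∀ a, F a j ≠ i) ∨ ∃ c : Fin 4,
        (∀ a : ZMod 4, F a j = i ↔ _) ∨ (∀ a : ZMod 4, F a j = i ↔ _)
      decide +kernel
    · change ∀ c : Fin 4, ∃ i j : Fin 4, ∀ a : ZMod 4, _ ↔ F a j = i
      decide +kernel

open Subgroup in
theorem isRealized_tetrahedronKlein : TableRow.tetrahedronKlein.IsRealized := by
  let F : (Fin 2 → ZMod 2) → Equiv.Perm (Fin 4) := fun e =>
    (c[0, 1] * c[2, 3]) ^ (e 0).val * (c[0, 2] * c[1, 3]) ^ (e 1).val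
  have hF : ∀ a b, F (a + b) = F a * F b := by decide +kernel
  refine ⟨_, inferInstance, inferInstance, permHom F hF,
    permHom_injective hF (by decide +kernel),
    permHom_range hF (fun a => mul_mem (pow_mem (subset_closure (by simp)) _)
        (pow_mem (subset_closure (by simp)) _)) ?_, ?_, ?_, ⟨MulEquiv.refl _⟩⟩
  · rintro s (rfl | rfl)
    exacts [⟨![1, 0], by decide +kernel⟩, ⟨![0, 1], by decide +kernel⟩]
  · exact isAddModel_of_pairing (n := 4) (N := 2) _ dotProduct add_dotProduct dotProduct_add
      (by decide +kernel) _ (by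
        change ∀ e : (Fin 2 → ZMod 2), _ ↔ ∃ j : Fin 4, ∀ a, F a j = j → _
        decide +kernel)
  · refine combinatoriallyEquivalent_of_isZeroOnePolytope (n := 4) _ (isZeroOnePolytope_simplex 3)
      -- Binary digits number the four group elements as vertices of the simplex.
      (fun a => Fin.ofNat 4 (2 * (a.toAdd 0).val + (a.toAdd 1).val)) (by decide +kernel) ?_ ?_
    · change ∀ i j : Fin 4, (∀ a, F a j ≠ i) ∨ ∃ c : Fin 4,
        (∀ a : (Fin 2 → ZMod 2), F a j = i ↔ _) ∨ (∀ a : (Fin 2 → ZMod 2), F a j = i ↔ _)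
      decide +kernel
    · change ∀ c : Fin 4, ∃ i j : Fin 4, ∀ a : (Fin 2 → ZMod 2), _ ↔ F a j = i
      decide +kernel

open Subgroup in
theorem isRealized_triangularPrism : TableRow.triangularPrism.IsRealized := by
  let F : ZMod 6 → Equiv.Perm (Fin 5) := fun e =>
    c[0, 1] ^ e.val * c[2, 3, 4] ^ e.val
  have hF : ∀ a b, F (a + b) = F a * F b := by decide +kernel
  refine ⟨_, inferInstance, inferInstance, permHom F hF,
    permHom_injective hF (by decide +kernel),
    permHom_range hF (fun a => mul_mem (pow_mem (subset_closure (by simp)) _)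
        (pow_mem (subset_closure (by simp)) _)) ?_, ?_, ?_, ⟨MulEquiv.refl _⟩⟩
  -- By the Chinese remainder theorem, `3` is `(1, 0)` and `4` is `(0, 1)` modulo `(2, 3)`.
  · rintro s (rfl | rfl)
    exacts [⟨(3 : ZMod 6), by decide +kernel⟩, ⟨(4 : ZMod 6), by decide +kernel⟩]
  · exact isAddModel_of_pairing (n := 5) (N := 6) _ (· * ·) add_mul mul_add
      (by decide +kernel) _ (by
        change ∀ e : ZMod 6, _ ↔ ∃ j : Fin 5, ∀ a, F a j = j → _
        decide +kernel)
  · refine combinatoriallyEquivalent_of_isZeroOnePolytope (n := 5) _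
      ((isZeroOnePolytope_simplex 2).prod isZeroOnePolytope_Icc)
      (fun a => (Fin.ofNat 3 a.toAdd.val, (a.toAdd.val : ZMod 2))) (by decide +kernel) ?_ ?_
    · change ∀ i j : Fin 5, (∀ a, F a j ≠ i) ∨ ∃ c : Fin 3 ⊕ Unit,
        (∀ a : ZMod 6, F a j = i ↔ _) ∨ (∀ a : ZMod 6, F a j = i ↔ _)
      decide +kernel
    · change ∀ c : Fin 3 ⊕ Unit, ∃ i j : Fin 5, ∀ a : ZMod 6, _ ↔ F a j = i
      decide +kernel

open Subgroup in
theorem isRealized_cube3 : TableRow.cube3.IsRealized := by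
  let F : (Fin 3 → ZMod 2) → Equiv.Perm (Fin 6) := fun e =>
    c[0, 1] ^ (e 0).val * c[2, 3] ^ (e 1).val * c[4, 5] ^ (e 2).val
  have hF : ∀ a b, F (a + b) = F a * F b := by decide +kernel
  refine ⟨_, inferInstance, inferInstance, permHom F hF,
    permHom_injective hF (by decide +kernel),
    permHom_range hF (fun a => mul_mem (mul_mem (pow_mem (subset_closure (by simp)) _)
        (pow_mem (subset_closure (by simp)) _)) (pow_mem (subset_closure (by simp)) _)) ?_, ?_, ?_,
            ⟨MulEquiv.refl _⟩⟩
  · rintro s (rfl | rfl | rfl)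
    exacts [⟨![1, 0, 0], by decide +kernel⟩, ⟨![0, 1, 0], by decide +kernel⟩, ⟨![0, 0, 1],
        by decide +kernel⟩]
  · exact isAddModel_of_pairing (n := 6) (N := 2) _ dotProduct add_dotProduct dotProduct_add
      (by decide +kernel) _ (by
        change ∀ e : (Fin 3 → ZMod 2), _ ↔ ∃ j : Fin 6, ∀ a, F a j = j → _
        decide +kernel)
  · refine combinatoriallyEquivalent_of_isZeroOnePolytope (n := 6) _ (isZeroOnePolytope_cube 3)
      Multiplicative.toAdd Multiplicative.toAdd.surjective ?_ ?_
    · change ∀ i j : Fin 6, (∀ a, F a j ≠ i) ∨ ∃ c : Fin 3,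
        (∀ a : (Fin 3 → ZMod 2), F a j = i ↔ _) ∨ (∀ a : (Fin 3 → ZMod 2), F a j = i ↔ _)
      decide +kernel
    · change ∀ c : Fin 3, ∃ i j : Fin 6, ∀ a : (Fin 3 → ZMod 2), _ ↔ F a j = i
      decide +kernel

open Subgroup in
theorem isRealized_simplex4 : TableRow.simplex4.IsRealized := by
  let F : ZMod 5 → Equiv.Perm (Fin 5) := fun e =>
    c[0, 1, 2, 3, 4] ^ e.val
  have hF : ∀ a b, F (a + b) = F a * F b := by decide +kernel
  refine ⟨_, inferInstance, inferInstance, permHom F hF,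
    permHom_injective hF (by decide +kernel),
    permHom_range hF (fun a => pow_mem (subset_closure (by simp)) _) ?_, ?_, ?_, ⟨MulEquiv.refl _⟩⟩
  · rintro s rfl
    exact ⟨(1 : ZMod 5), by decide +kernel⟩
  · exact isAddModel_of_pairing (n := 5) (N := 5) _ (· * ·) add_mul mul_add
      (by decide +kernel) _ (by
        change ∀ e : ZMod 5, _ ↔ ∃ j : Fin 5, ∀ a, F a j = j → _
        decide +kernel)
  · refine combinatoriallyEquivalent_of_isZeroOnePolytope (n := 5) _ (isZeroOnePolytope_simplex 4)
      Multiplicative.toAdd Multiplicative.toAdd.surjective ?_ ?_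
    · change ∀ i j : Fin 5, (∀ a, F a j ≠ i) ∨ ∃ c : Fin 5,
        (∀ a : ZMod 5, F a j = i ↔ _) ∨ (∀ a : ZMod 5, F a j = i ↔ _)
      decide +kernel
    · change ∀ c : Fin 5, ∃ i j : Fin 5, ∀ a : ZMod 5, _ ↔ F a j = i
      decide +kernel

open Subgroup in
theorem isRealized_tetrahedralPrismZ2Z4 : TableRow.tetrahedralPrismZ2Z4.IsRealized := by
  let F : ZMod 2 × ZMod 4 → Equiv.Perm (Fin 6) := fun e =>
    c[0, 1, 2, 3] ^ e.2.val * c[4, 5] ^ e.1.val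
  have hF : ∀ a b, F (a + b) = F a * F b := by decide +kernel
  refine ⟨_, inferInstance, inferInstance, permHom F hF,
    permHom_injective hF (by decide +kernel),
    permHom_range hF (fun a => mul_mem (pow_mem (subset_closure (by simp)) _)
        (pow_mem (subset_closure (by simp)) _)) ?_, ?_, ?_, ⟨MulEquiv.refl _⟩⟩
  · rintro s (rfl | rfl)
    exacts [⟨((0, 1) : ZMod 2 × ZMod 4), by decide +kernel⟩, ⟨((1, 0) : ZMod 2 × ZMod 4),
        by decide +kernel⟩]
  -- The factor `2` embeds the values in `ℤ/2` of the first pairing into `ℤ/4`.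
  · exact isAddModel_of_pairing (n := 6) (N := 4) _ (fun a b =>
      2 * (a.1.val * b.1.val : ℕ) + a.2 * b.2) (by decide +kernel) (by decide +kernel)
      (by decide +kernel) _ (by
        change ∀ e : ZMod 2 × ZMod 4, _ ↔ ∃ j : Fin 6, ∀ a, F a j = j → _
        decide +kernel)
  · refine combinatoriallyEquivalent_of_isZeroOnePolytope (n := 6) _
      ((isZeroOnePolytope_simplex 3).prod isZeroOnePolytope_Icc)
      (fun a => (a.toAdd.2, a.toAdd.1)) (by decide +kernel) ?_ ?_
    · change ∀ i j : Fin 6, (∀ a, F a j ≠ i) ∨ ∃ c : Fin 4 ⊕ Unit,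
        (∀ a : ZMod 2 × ZMod 4, F a j = i ↔ _) ∨ (∀ a : ZMod 2 × ZMod 4, F a j = i ↔ _)
      decide +kernel
    · change ∀ c : Fin 4 ⊕ Unit, ∃ i j : Fin 6, ∀ a : ZMod 2 × ZMod 4, _ ↔ F a j = i
      decide +kernel

open Subgroup in
theorem isRealized_tetrahedralPrismZ2Cubed : TableRow.tetrahedralPrismZ2Cubed.IsRealized := by
  let F : (Fin 3 → ZMod 2) → Equiv.Perm (Fin 6) := fun e =>
    (c[0, 1] * c[2, 3]) ^ (e 0).val * (c[0, 2] * c[1, 3]) ^ (e 1).val * c[4, 5] ^ (e 2).val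
  have hF : ∀ a b, F (a + b) = F a * F b := by decide +kernel
  refine ⟨_, inferInstance, inferInstance, permHom F hF,
    permHom_injective hF (by decide +kernel),
    permHom_range hF (fun a => mul_mem (mul_mem (pow_mem (subset_closure (by simp)) _)
        (pow_mem (subset_closure (by simp)) _)) (pow_mem (subset_closure (by simp)) _)) ?_, ?_, ?_,
            ⟨MulEquiv.refl _⟩⟩
  · rintro s (rfl | rfl | rfl)
    exacts [⟨![1, 0, 0], by decide +kernel⟩, ⟨![0, 1, 0], by decide +kernel⟩, ⟨![0, 0, 1],
        by decide +kernel⟩]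
  · exact isAddModel_of_pairing (n := 6) (N := 2) _ dotProduct add_dotProduct dotProduct_add
      (by decide +kernel) _ (by
        change ∀ e : (Fin 3 → ZMod 2), _ ↔ ∃ j : Fin 6, ∀ a, F a j = j → _
        decide +kernel)
  · refine combinatoriallyEquivalent_of_isZeroOnePolytope (n := 6) _
      ((isZeroOnePolytope_simplex 3).prod isZeroOnePolytope_Icc)
      (fun a => (Fin.ofNat 4 (2 * (a.toAdd 0).val + (a.toAdd 1).val),
          a.toAdd 2)) (by decide +kernel) ?_ ?_
    · change ∀ i j : Fin 6, (∀ a, F a j ≠ i) ∨ ∃ c : Fin 4 ⊕ Unit,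
        (∀ a : (Fin 3 → ZMod 2), F a j = i ↔ _) ∨ (∀ a : (Fin 3 → ZMod 2), F a j = i ↔ _)
      decide +kernel
    · change ∀ c : Fin 4 ⊕ Unit, ∃ i j : Fin 6, ∀ a : (Fin 3 → ZMod 2), _ ↔ F a j = i
      decide +kernel

open Subgroup in
theorem isRealized_productOfTriangles : TableRow.productOfTriangles.IsRealized := by
  let F : (Fin 2 → ZMod 3) → Equiv.Perm (Fin 6) := fun e =>
    c[0, 1, 2] ^ (e 0).val * c[3, 4, 5] ^ (e 1).val
  have hF : ∀ a b, F (a + b) = F a * F b := by decide +kernel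
  refine ⟨_, inferInstance, inferInstance, permHom F hF,
    permHom_injective hF (by decide +kernel),
    permHom_range hF (fun a => mul_mem (pow_mem (subset_closure (by simp)) _)
        (pow_mem (subset_closure (by simp)) _)) ?_, ?_, ?_, ⟨MulEquiv.refl _⟩⟩
  · rintro s (rfl | rfl)
    exacts [⟨![1, 0], by decide +kernel⟩, ⟨![0, 1], by decide +kernel⟩]
  · exact isAddModel_of_pairing (n := 6) (N := 3) _ dotProduct add_dotProduct dotProduct_add
      (by decide +kernel) _ (by
        change ∀ e : (Fin 2 → ZMod 3), _ ↔ ∃ j : Fin 6, ∀ a, F a j = j → _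
        decide +kernel)
  · refine combinatoriallyEquivalent_of_isZeroOnePolytope (n := 6) _
      ((isZeroOnePolytope_simplex 2).prod (isZeroOnePolytope_simplex 2))
      (fun a => (a.toAdd 0, a.toAdd 1)) (by decide +kernel) ?_ ?_
    · change ∀ i j : Fin 6, (∀ a, F a j ≠ i) ∨ ∃ c : Fin 3 ⊕ Fin 3,
        (∀ a : (Fin 2 → ZMod 3), F a j = i ↔ _) ∨ (∀ a : (Fin 2 → ZMod 3), F a j = i ↔ _)
      decide +kernel
    · change ∀ c : Fin 3 ⊕ Fin 3, ∃ i j : Fin 6, ∀ a : (Fin 2 → ZMod 3), _ ↔ F a j = i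
      decide +kernel

open Subgroup in
theorem isRealized_prismOverTriangularPrism : TableRow.prismOverTriangularPrism.IsRealized := by
  let F : ZMod 6 × ZMod 2 → Equiv.Perm (Fin 7) := fun e =>
    c[0, 1] ^ e.1.val * c[2, 3, 4] ^ e.1.val * c[5, 6] ^ e.2.val
  have hF : ∀ a b, F (a + b) = F a * F b := by decide +kernel
  refine ⟨_, inferInstance, inferInstance, permHom F hF,
    permHom_injective hF (by decide +kernel),
    permHom_range hF (fun a => mul_mem (mul_mem (pow_mem (subset_closure (by simp)) _)
        (pow_mem (subset_closure (by simp)) _)) (pow_mem (subset_closure (by simp)) _)) ?_, ?_, ?_,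
            ⟨MulEquiv.refl _⟩⟩
  · rintro s (rfl | rfl | rfl)
    exacts [⟨((3, 0) : ZMod 6 × ZMod 2), by decide +kernel⟩, ⟨((4, 0) : ZMod 6 × ZMod 2),
        by decide +kernel⟩, ⟨((0, 1) : ZMod 6 × ZMod 2), by decide +kernel⟩]
  -- The factor `3` embeds the values in `ℤ/2` of the second pairing into `ℤ/6`.
  · exact isAddModel_of_pairing (n := 7) (N := 6) _ (fun a b =>
      a.1 * b.1 + 3 * (a.2.val * b.2.val : ℕ)) (by decide +kernel) (by decide +kernel)
      (by decide +kernel) _ (by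
        change ∀ e : ZMod 6 × ZMod 2, _ ↔ ∃ j : Fin 7, ∀ a, F a j = j → _
        decide +kernel)
  · refine combinatoriallyEquivalent_of_isZeroOnePolytope (n := 7) _
      (((isZeroOnePolytope_simplex 2).prod isZeroOnePolytope_Icc).prod isZeroOnePolytope_Icc)
      (fun a => ((Fin.ofNat 3 a.toAdd.1.val, (a.toAdd.1.val : ZMod 2)),
          a.toAdd.2)) (by decide +kernel) ?_ ?_
    · change ∀ i j : Fin 7, (∀ a, F a j ≠ i) ∨ ∃ c : (Fin 3 ⊕ Unit) ⊕ Unit,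
        (∀ a : ZMod 6 × ZMod 2, F a j = i ↔ _) ∨ (∀ a : ZMod 6 × ZMod 2, F a j = i ↔ _)
      decide +kernel
    · change ∀ c : (Fin 3 ⊕ Unit) ⊕ Unit, ∃ i j : Fin 7, ∀ a : ZMod 6 × ZMod 2, _ ↔ F a j = i
      decide +kernel

open Subgroup in
theorem isRealized_cube4 : TableRow.cube4.IsRealized := by
  let F : (Fin 4 → ZMod 2) → Equiv.Perm (Fin 8) := fun e =>
    c[0, 1] ^ (e 0).val * c[2, 3] ^ (e 1).val * c[4, 5] ^ (e 2).val * c[6, 7] ^ (e 3).val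
  have hF : ∀ a b, F (a + b) = F a * F b := by decide +kernel
  refine ⟨_, inferInstance, inferInstance, permHom F hF,
    permHom_injective hF (by decide +kernel),
    permHom_range hF (fun a => mul_mem (mul_mem (mul_mem (pow_mem (subset_closure (by simp)) _)
        (pow_mem (subset_closure (by simp)) _)) (pow_mem (subset_closure (by simp)) _))
            (pow_mem (subset_closure (by simp)) _)) ?_, ?_, ?_, ⟨MulEquiv.refl _⟩⟩
  · rintro s (rfl | rfl | rfl | rfl)
    exacts [⟨![1, 0, 0, 0], by decide +kernel⟩, ⟨![0, 1, 0, 0], by decide +kernel⟩, ⟨![0, 0, 1, 0],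
        by decide +kernel⟩, ⟨![0, 0, 0, 1], by decide +kernel⟩]
  · exact isAddModel_of_pairing (n := 8) (N := 2) _ dotProduct add_dotProduct dotProduct_add
      (by decide +kernel) _ (by
        change ∀ e : (Fin 4 → ZMod 2), _ ↔ ∃ j : Fin 8, ∀ a, F a j = j → _
        decide +kernel)
  · refine combinatoriallyEquivalent_of_isZeroOnePolytope (n := 8) _ (isZeroOnePolytope_cube 4)
      Multiplicative.toAdd Multiplicative.toAdd.surjective ?_ ?_
    · change ∀ i j : Fin 8, (∀ a, F a j ≠ i) ∨ ∃ c : Fin 4,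
        (∀ a : (Fin 4 → ZMod 2), F a j = i ↔ _) ∨ (∀ a : (Fin 4 → ZMod 2), F a j = i ↔ _)
      decide +kernel
    · change ∀ c : Fin 4, ∃ i j : Fin 8, ∀ a : (Fin 4 → ZMod 2), _ ↔ F a j = i
      decide +kernel

/-! ### The crosspolytope row. -/

/-- A symmetric matrix of signs with orthogonal rows. -/
def hadamardFour (i j : Fin 4) : ℤ :=
  if i = 0 ∨ j = 0 ∨ i = j then 1 else -1

theorem crosspolytope_eq_convexHull_range {κ : Type*} (w : κ → Fin 4 → ℤ)
    (h₁ : ∀ k, ∃ i, w k = Pi.single i 1 ∨ w k = -Pi.single i 1)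
    (h₂ : ∀ i, (∃ k, w k = Pi.single i 1) ∧ ∃ k, w k = -Pi.single i 1) :
    crosspolytope 4 = convexHull ℝ (Set.range fun k (c : Fin 4) => (w k c : ℝ)) := by
  have hp : ∀ i : Fin 4, (fun c => ((Pi.single i 1 : Fin 4 → ℤ) c : ℝ)) = Pi.single i 1 := by
    intro i
    ext c
    simp only [Pi.single_apply]
    split_ifs <;> simp
  have hn : ∀ i : Fin 4, (fun c => ((-Pi.single i 1 : Fin 4 → ℤ) c : ℝ)) = -Pi.single i 1 := by
    intro i
    rw [← hp]
    ext c
    simp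
  unfold crosspolytope
  congr 1
  ext x
  constructor
  · rintro (⟨i, rfl⟩ | ⟨i, rfl⟩)
    · obtain ⟨k, hk⟩ := (h₂ i).1
      exact ⟨k, by dsimp only; rw [hk, hp]⟩
    · obtain ⟨k, hk⟩ := (h₂ i).2
      exact ⟨k, by dsimp only; rw [hk, hn]⟩
  · rintro ⟨k, rfl⟩
    obtain ⟨i, hi | hi⟩ := h₁ k
    · exact Or.inl ⟨i, by dsimp only; rw [hi, hp]⟩
    · exact Or.inr ⟨i, by dsimp only; rw [hi, hn]⟩

-- Recording which of the four 2-point blocks are flipped gives the sign vectors in `{±1}⁴` with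
-- product one. These are the rows of the Hadamard matrix and their negatives, so the Hadamard
-- transform takes them to multiples of `±e_i`.
open Subgroup in
theorem isRealized_crosspolytope4 : TableRow.crosspolytope4.IsRealized := by
  -- The exponents are chosen so that the blocks are flipped according to `e 0`, `e 1`, `e 2` and `e
  -- 0 + e 1 + e 2`, the four nontrivial characters of the model.
  let F : (Fin 3 → ZMod 2) → Equiv.Perm (Fin 8) := fun e =>
    (c[0, 1] * c[2, 3]) ^ (e 0).val * (c[2, 3] * c[6, 7]) ^ (e 0 + e 1).val *
      (c[4, 5] * c[6, 7]) ^ (e 2).val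
  have hF : ∀ a b, F (a + b) = F a * F b := by decide +kernel
  refine ⟨_, inferInstance, inferInstance, permHom F hF,
    permHom_injective hF (by decide +kernel),
    permHom_range hF (fun a => mul_mem (mul_mem (pow_mem (subset_closure (by simp)) _)
      (pow_mem (subset_closure (by simp)) _)) (pow_mem (subset_closure (by simp)) _))
    ?_, ?_, ?_, ⟨MulEquiv.refl _⟩⟩
  · rintro s (rfl | rfl | rfl)
    exacts [⟨![1, 1, 0], by decide +kernel⟩, ⟨![0, 1, 0], by decide +kernel⟩,
      ⟨![0, 0, 1], by decide +kernel⟩]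
  · exact isAddModel_of_pairing (n := 8) (N := 2) _ dotProduct add_dotProduct dotProduct_add
      (by decide +kernel) _ (by
        change ∀ e : (Fin 3 → ZMod 2), _ ↔ ∃ j : Fin 8, ∀ a, F a j = j → _
        decide +kernel)
  · let f : Multiplicative (Fin 3 → ZMod 2) →* Equiv.Perm (Fin 8) := permHom F hF
    change CombinatoriallyEquivalent (convexHull ℝ (Set.range (actMat f))) (crosspolytope 4)
    let pt : Fin 4 → Fin 8 := ![0, 2, 4, 6]
    let bl : Fin 8 → Fin 4 := ![0, 0, 1, 1, 2, 2, 3, 3]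
    -- The integer division is exact: the transform of a row of the matrix is `±4` at one place and
    -- zero elsewhere.
    let w : Multiplicative (Fin 3 → ZMod 2) → Fin 4 → ℤ := fun a c =>
      (∑ j, hadamardFour c j * if F a.toAdd (pt j) = pt j then 1 else -1) / 4
    rw [crosspolytope_eq_convexHull_range w (by decide +kernel) (by decide +kernel)]
    refine combinatoriallyEquivalent_of_affDep_eq (le_antisymm ?_ ?_)
    · refine affDep_le_of_affine_coordinates LinearMap.proj (fun x hx => funext hx) fun c => ?_
      refine ⟨∑ j, ((hadamardFour c j : ℝ) / 2) • entryMap (n := 8) (pt j) (pt j),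
        -(∑ j, (hadamardFour c j : ℝ)) / 4, fun h => ?_⟩
      have key : ∀ h c, 4 * w h c = 2 * (∑ j, hadamardFour c j *
          if F h.toAdd (pt j) = pt j then 1 else 0) - ∑ j, hadamardFour c j := by decide +kernel
      have := congrArg (Int.cast : ℤ → ℝ) (key h c)
      simp only [LinearMap.proj_apply, LinearMap.sum_apply, LinearMap.smul_apply, smul_eq_mul]
      simp_rw [entryMap_actMat]
      change (w h c : ℝ) = ∑ j, (hadamardFour c j : ℝ) / 2 *
          (if F h.toAdd (pt j) = pt j then 1 else 0) + _
      push_cast at this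
      rw [Finset.mul_sum] at this
      have e : ∑ j, (hadamardFour c j : ℝ) / 2 * (if F h.toAdd (pt j) = pt j then 1 else 0) =
          (∑ j, 2 * ((hadamardFour c j : ℝ) * (if F h.toAdd (pt j) = pt j then 1 else 0))) / 4 := by
        rw [Finset.sum_div]
        exact Finset.sum_congr rfl fun j _ => by ring
      rw [e]
      linarith
    · refine affDep_le_of_affine_coordinates (fun c : Fin 8 × Fin 8 => entryMap c.1 c.2)
        eq_zero_of_entryMap ?_
      rintro ⟨i, j⟩
      let s : ℤ := if bl i = bl j then 1 else 0
      let t : ℤ := if i = j then 1 else -1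
      refine ⟨∑ k, ((s * t * hadamardFour (bl j) k : ℤ) / 2 : ℝ) • LinearMap.proj k,
        (s : ℝ) / 2, fun h => ?_⟩
      -- The matrix is symmetric with square `4`, so it recovers the sign of each block from `w`. An
      -- entry inside a block is then `(1 ± sign) / 2`, and an entry between different blocks is
      -- zero.
      have key : ∀ (i j : Fin 8) (h : Multiplicative (Fin 3 → ZMod 2)),
          2 * (if F h.toAdd j = i then 1 else 0) =
          (∑ k, (if bl i = bl j then 1 else 0) * (if i = j then 1 else -1) *
            hadamardFour (bl j) k * w h k) + if bl i = bl j then 1 else 0 := by decide +kernel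
      have := congrArg (Int.cast : ℤ → ℝ) (key i j h)
      simp only [LinearMap.proj_apply, LinearMap.sum_apply, LinearMap.smul_apply, smul_eq_mul]
      rw [entryMap_actMat]
      change (if F h.toAdd j = i then (1 : ℝ) else 0) = _
      have e : ∑ k, ((s * t * hadamardFour (bl j) k : ℤ) / 2 : ℝ) * (w h k : ℝ) =
          ((∑ k, s * t * hadamardFour (bl j) k * w h k : ℤ) : ℝ) / 2 := by
        push_cast
        rw [Finset.sum_div]
        exact Finset.sum_congr rfl fun j _ => by ring
      rw [e]
      change ((2 * (if F h.toAdd j = i then 1 else 0) : ℤ) : ℝ) =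
        ((∑ k, s * t * hadamardFour (bl j) k * w h k + s : ℤ) : ℝ) at this
      rw [Int.cast_add, Int.cast_mul, Int.cast_ite] at this
      push_cast at this ⊢
      linarith

/-! ### Existence of a row, and the properties of each row. -/

section RealizedRows

open TableRow

theorem TableRow.isRealized (r : TableRow) (hr : r ≠ birkhoff3) : r.IsRealized := by
  cases r
  case birkhoff3 => exact absurd rfl hr
  exacts [isRealized_triangle, isRealized_square, isRealized_tetrahedronCyclic,
    isRealized_tetrahedronKlein, isRealized_triangularPrism, isRealized_cube3, isRealized_simplex4,
    isRealized_tetrahedralPrismZ2Z4, isRealized_tetrahedralPrismZ2Cubed, isRealized_crosspolytope4,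
    isRealized_productOfTriangles, isRealized_prismOverTriangularPrism, isRealized_cube4]

theorem exists_mulEquiv_of_range_eq {H : Type*} [Group H] {n : ℕ} {f : H →* Equiv.Perm (Fin n)}
    {G : Subgroup (Equiv.Perm (Fin n))} (hf : Function.Injective f) (hG : f.range = G) :
    ∃ φ : H ≃* G, G.subtype.comp φ.toMonoidHom = f := by
  subst hG
  exact ⟨MonoidHom.ofInjective hf, rfl⟩

theorem TableRow.HasIsoType.congr {H K : Type*} [Group H] [Group K] {r : TableRow} (e : K ≃* H)
    (h : r.HasIsoType H) : r.HasIsoType K := by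
  cases r <;> exact ⟨e.trans h.some⟩

theorem TableRow.HasCombType.congr {E F : Type*} [AddCommGroup E] [Module ℝ E] [TopologicalSpace E]
    [AddCommGroup F] [Module ℝ F] [TopologicalSpace F] {P : Set E} {Q : Set F} {r : TableRow}
    (e : CombinatoriallyEquivalent P Q) (h : r.HasCombType Q) : r.HasCombType P := by
  cases r <;> exact e.trans h

theorem TableRow.group_spec (r : TableRow) :
    polytopeDim (permPolytope r.group) = r.dim ∧ r.HasCombType (permPolytope r.group) ∧
      r.HasIsoType r.group := by
  by_cases hr : r = birkhoff3
  · subst hr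
    refine ⟨polytopeDim_birkhoff3, ?_, ?_⟩
    · rw [birkhoff3_group_eq_top]
      exact ⟨OrderIso.refl _⟩
    · rw [birkhoff3_group_eq_top]
      exact ⟨Subgroup.topEquiv⟩
  · obtain ⟨H, _, _, f, hf, hG, hm, hc, hi⟩ := r.isRealized hr
    obtain ⟨φ, hφ⟩ := exists_mulEquiv_of_range_eq hf hG
    rw [permPolytope_eq_of_mulEquiv r.group φ, hφ]
    exact ⟨polytopeDim_of_hasModel hm, hc, hi.congr φ.symm⟩

theorem effectivelyEquivalent_of_affDep_eq {H : Type*} [Group H] {m n : ℕ}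
    {G : Subgroup (Equiv.Perm (Fin m))} {G' : Subgroup (Equiv.Perm (Fin n))} [Fintype G]
    {f : H →* Equiv.Perm (Fin n)} (hf : Function.Injective f) (hG : f.range = G') (φ : G ≃* H)
    (h : affDep (actMat G.subtype) = affDep (actMat (f.comp φ.toMonoidHom))) :
    EffectivelyEquivalent G G' := by
  classical
  obtain ⟨ψ, rfl⟩ := exists_mulEquiv_of_range_eq hf hG
  rw [effectivelyEquivalent_iff]
  exact ⟨φ.trans ψ, h⟩

variable {n : ℕ} (G : Subgroup (Equiv.Perm (Fin n)))

theorem exists_effectivelyEquivalent_row (h2 : 2 ≤ polytopeDim (permPolytope G))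
    (h4 : polytopeDim (permPolytope G) ≤ 4) :
    ∃ r : TableRow, EffectivelyEquivalent G r.group := by
  classical
  by_cases hG : ∀ g h : G, g * h = h * g
  · let _ : CommGroup G := { mul_comm := hG }
    rw [permPolytope_eq] at h2 h4
    obtain ⟨r, hr⟩ := exists_hasModel G.subtype_injective h2 h4
    have hne : r ≠ birkhoff3 := by
      rintro rfl
      exact hr
    obtain ⟨H, _, _, f, hf, hrange, hm, -⟩ := r.isRealized hne
    obtain ⟨φ, hφ⟩ := exists_mulEquiv_of_hasModel r hr hm
    exact ⟨r, effectivelyEquivalent_of_affDep_eq hf hrange φ hφ⟩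
  · exact ⟨birkhoff3, effectivelyEquivalent_birkhoff3 h4 hG⟩

variable {G}

theorem TableRow.spec_of_effectivelyEquivalent {r : TableRow}
    (h : EffectivelyEquivalent G r.group) :
    polytopeDim (permPolytope G) = r.dim ∧ r.HasCombType (permPolytope G) ∧ r.HasIsoType G := by
  obtain ⟨h1, h2, h3⟩ := r.group_spec
  exact ⟨(polytopeDim_eq_of_effectivelyEquivalent h).trans h1,
    h2.congr (combinatoriallyEquivalent_of_effectivelyEquivalent h), h3.congr h.choose⟩

end RealizedRows

/-! ### Invariants separating the rows. -/

section Uniqueness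

open TableRow

/-- The order of the group of a row. -/
def TableRow.order : TableRow → ℕ
  | triangle => 3
  | square => 4
  | tetrahedronCyclic => 4
  | tetrahedronKlein => 4
  | triangularPrism => 6
  | cube3 => 8
  | simplex4 => 5
  | birkhoff3 => 6
  | tetrahedralPrismZ2Z4 => 8
  | tetrahedralPrismZ2Cubed => 8
  | crosspolytope4 => 8
  | productOfTriangles => 9
  | prismOverTriangularPrism => 12
  | cube4 => 16

theorem TableRow.HasIsoType.card_eq {H : Type*} [Group H] {r : TableRow} (h : r.HasIsoType H) :
    Nat.card H = r.order := by
  cases r <;> obtain ⟨e⟩ := h <;> rw [Nat.card_congr e.toEquiv, Nat.card_eq_fintype_card] <;>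
    decide +kernel

/-- The rows whose group contains an element of order four. -/
def TableRow.HasElementOfOrderFour : TableRow → Prop
  | tetrahedronCyclic => True
  | tetrahedralPrismZ2Z4 => True
  | _ => False

/-- The condition says that `x` has order exactly four, in a form that can be decided on the model
groups. -/
theorem exists_mul_self_ne_one_congr {H K : Type*} [Group H] [Group K] (e : H ≃* K) :
    (∃ x : H, x * x ≠ 1 ∧ x * x * (x * x) = 1) ↔ ∃ x : K, x * x ≠ 1 ∧ x * x * (x * x) = 1 := by
  rw [e.surjective.exists]
  simp only [← map_mul, ne_eq, EmbeddingLike.map_eq_one_iff]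

theorem TableRow.HasIsoType.hasElementOfOrderFour_iff {H : Type*} [Group H] {r : TableRow}
    (h : r.HasIsoType H) :
    (∃ x : H, x * x ≠ 1 ∧ x * x * (x * x) = 1) ↔ r.HasElementOfOrderFour := by
  cases r <;> obtain ⟨e⟩ := h <;> rw [exists_mul_self_ne_one_congr e] <;>
    simp only [TableRow.HasElementOfOrderFour] <;> decide +kernel

theorem sum_single_smul {ι E : Type*} [Fintype ι] [DecidableEq ι] [AddCommGroup E] [Module ℝ E]
    (v : ι → E) (a b c d : ι) :
    ∑ i, (Pi.single a 1 + Pi.single b 1 - Pi.single c 1 - Pi.single d 1 : ι → ℝ) i • v i =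
      v a + v b - v c - v d := by
  simp [sub_smul, add_smul, Finset.sum_sub_distrib, Finset.sum_add_distrib, Pi.single_apply]

/-- Coincidence of the midpoints of two vertex pairs is a sum-zero dependency, hence an invariant of
effective equivalence. -/
theorem add_eq_add_of_affDep_le {ι E F : Type*} [Fintype ι] [AddCommGroup E]
    [Module ℝ E] [AddCommGroup F] [Module ℝ F] {v : ι → E} {w : ι → F}
    (h : affDep v ≤ affDep w) {a b c d : ι} (hv : v a + v b = v c + v d) :
    w a + w b = w c + w d := by
  classical
  have hx : (Pi.single a 1 + Pi.single b 1 - Pi.single c 1 - Pi.single d 1 : ι → ℝ) ∈ affDep v := by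
    refine mem_affDep.2 ⟨?_, ?_⟩
    · rw [sum_single_smul, hv]
      abel
    · simp [Finset.sum_sub_distrib, Finset.sum_add_distrib]
  have := (mem_affDep.1 (h hx)).1
  rw [sum_single_smul, sub_sub, sub_eq_zero] at this
  exact this

/-- The polytope of the group has a vertex pair `1, g` with the same midpoint as all the pairs
`h, g * h`. -/
def HasCentralVertexPair {n : ℕ} (G : Subgroup (Equiv.Perm (Fin n))) : Prop :=
  ∃ g : G, ∀ h : G, actMat G.subtype 1 + actMat G.subtype g =
    actMat G.subtype h + actMat G.subtype (g * h)

theorem HasCentralVertexPair.congr {m n : ℕ} {G : Subgroup (Equiv.Perm (Fin m))}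
    {G' : Subgroup (Equiv.Perm (Fin n))} (h : EffectivelyEquivalent G G')
    (hG : HasCentralVertexPair G) : HasCentralVertexPair G' := by
  classical
  obtain ⟨φ, hφ⟩ := (effectivelyEquivalent_iff G G').1 h
  obtain ⟨g, hg⟩ := hG
  refine ⟨φ g, fun k => ?_⟩
  obtain ⟨k, rfl⟩ := φ.surjective k
  have := add_eq_add_of_affDep_le hφ.le (hg k)
  rw [← map_mul, ← map_one φ]
  exact this

theorem hasCentralVertexPair_iff {n : ℕ} (G : Subgroup (Equiv.Perm (Fin n))) :
    HasCentralVertexPair G ↔ ∃ g ∈ G, ∀ h ∈ G, ∀ i j : Fin n,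
      (if j = i then (1 : ℝ) else 0) + (if g j = i then 1 else 0) =
        (if h j = i then 1 else 0) + if g (h j) = i then 1 else 0 := by
  simp only [HasCentralVertexPair, Subtype.exists, Subtype.forall, ← Matrix.ext_iff,
    Matrix.add_apply, actMat_apply]
  exact ⟨fun ⟨g, hg, h⟩ => ⟨g, hg, h⟩, fun ⟨g, hg, h⟩ => ⟨g, hg, h⟩⟩

/-- The element `z` flips all four blocks. Every `h` in the group agrees at each point with `1` or
with `z`, and `z * h` makes the opposite choice, so the two matrices always sum to those of `1` and
`z`. -/
theorem hasCentralVertexPair_crosspolytope4 : HasCentralVertexPair (Subgroup.closure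
    {c[0, 1] * c[2, 3], c[2, 3] * c[6, 7], c[4, 5] * c[6, 7]} :
      Subgroup (Equiv.Perm (Fin 8))) := by
  let z : Equiv.Perm (Fin 8) := c[0, 1] * c[2, 3] * (c[4, 5] * c[6, 7])
  have hzz : ∀ j, z (z j) = j := by decide +kernel
  rw [hasCentralVertexPair_iff]
  refine ⟨z, Subgroup.mul_mem _ (Subgroup.subset_closure (by simp))
    (Subgroup.subset_closure (by simp)), fun h hh i j => ?_⟩
  have hmem : ∀ j : Fin 8, h j = j ∨ h j = z j := by
    refine Subgroup.closure_induction (p := fun (h : Equiv.Perm (Fin 8)) _ =>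
      ∀ j, h j = j ∨ h j = z j) ?_ (fun j => Or.inl rfl) ?_ ?_ hh
    · rintro h (rfl | rfl | rfl) <;> decide +kernel
    · intro h k _ _ hh hk j
      rw [Equiv.Perm.mul_apply]
      rcases hk j with e | e <;> rw [e]
      · exact hh j
      · rcases hh (z j) with e' | e' <;> rw [e']
        · exact Or.inr rfl
        · exact Or.inl (hzz j)
    · intro h _ hh j
      rw [Equiv.Perm.inv_eq_iff_eq, Equiv.Perm.inv_eq_iff_eq]
      rcases hh j with e | e
      · exact Or.inl e.symm
      · right
        rcases hh (z j) with e' | e'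
        · have := h.injective (e.trans e'.symm)
          rw [← this, e, ← this]
        · rw [e', hzz]
  rcases hmem j with e | e <;> rw [e]
  rw [hzz, add_comm]

/-- In entry `(0, 0)`, an `h` moving `0` forces `g (h 0) = 0`. The two generators of the Klein group
move `0` to different points, against injectivity of `g`. -/
theorem not_hasCentralVertexPair_tetrahedralPrismZ2Cubed : ¬ HasCentralVertexPair
    (Subgroup.closure {c[0, 1] * c[2, 3], c[0, 2] * c[1, 3], c[4, 5]} :
      Subgroup (Equiv.Perm (Fin 6))) := by
  rw [hasCentralVertexPair_iff]
  rintro ⟨g, -, hg⟩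
  have h1 := hg (c[0, 1] * c[2, 3]) (Subgroup.subset_closure (by simp)) 0 0
  have h2 := hg (c[0, 2] * c[1, 3]) (Subgroup.subset_closure (by simp)) 0 0
  have e1 : (c[0, 1] * c[2, 3] : Equiv.Perm (Fin 6)) 0 = 1 := by decide +kernel
  have e2 : (c[0, 2] * c[1, 3] : Equiv.Perm (Fin 6)) 0 = 2 := by decide +kernel
  rw [e1] at h1
  rw [e2] at h2
  have k1 : g 1 = 0 := by
    by_contra hc
    rw [if_pos rfl, if_neg hc] at h1
    split_ifs at h1 <;> simp_all
  have k2 : g 2 = 0 := by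
    by_contra hc
    rw [if_pos rfl, if_neg hc] at h2
    split_ifs at h2 <;> simp_all
  exact absurd (g.injective (k1.trans k2.symm)) (by decide)

theorem TableRow.eq_of_effectivelyEquivalent {n : ℕ} {G : Subgroup (Equiv.Perm (Fin n))}
    {r r' : TableRow} (h : EffectivelyEquivalent G r.group)
    (h' : EffectivelyEquivalent G r'.group) : r = r' := by
  obtain ⟨hd, -, hi⟩ := spec_of_effectivelyEquivalent h
  obtain ⟨hd', -, hi'⟩ := spec_of_effectivelyEquivalent h'
  have hdim := hd.symm.trans hd'
  have hord := hi.card_eq.symm.trans hi'.card_eq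
  have hfour := hi.hasElementOfOrderFour_iff.symm.trans hi'.hasElementOfOrderFour_iff
  have hcentral : HasCentralVertexPair r.group ↔ HasCentralVertexPair r'.group :=
    ⟨fun hc => hc.congr (effectivelyEquivalent_trans (effectivelyEquivalent_symm h) h'),
      fun hc => hc.congr (effectivelyEquivalent_trans (effectivelyEquivalent_symm h') h)⟩
  clear h h' hd hd' hi hi'
  cases r <;> cases r' <;> first
    | rfl
    | exact absurd hdim (by decide)
    | exact absurd hord (by decide)
    | exact (hfour.1 trivial).elim
    | exact (hfour.2 trivial).elim
    | exact absurd (hcentral.1 hasCentralVertexPair_crosspolytope4)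
        not_hasCentralVertexPair_tetrahedralPrismZ2Cubed
    | exact absurd (hcentral.2 hasCentralVertexPair_crosspolytope4)
        not_hasCentralVertexPair_tetrahedralPrismZ2Cubed

end Uniqueness

/-! ### Dimensions zero and one. -/

section SmallDimension

theorem isAddModel_of_card_eq_two {D : Type*} [AddCommGroup D] {X : Finset D}
    (hgen : AddSubgroup.closure (X : Set D) = ⊤) (hsmul : ∀ x ∈ X, ∀ k : ℕ, k • x ∈ X)
    (hcard : X.card = 2) : IsAddModel (Finset.univ : Finset (ZMod 2)) (X : Set D) := by
  classical
  obtain ⟨x, hx, hx0⟩ := Finset.exists_mem_ne (by omega : 1 < X.card) 0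
  have ho : addOrderOf x = 2 := by
    have h1 := addOrderOf_le_card_of_smul_closed hsmul hx
    have h2 := addOrderOf_ne_zero_of_mem hsmul hx
    have h3 : addOrderOf x ≠ 1 := mt AddMonoid.addOrderOf_eq_one_iff.1 hx0
    omega
  exact isAddModel_cyclic hgen hsmul hx ho hcard

variable {n : ℕ} (G : Subgroup (Equiv.Perm (Fin n)))

theorem polytopeDim_permPolytope_eq_zero_iff : polytopeDim (permPolytope G) = 0 ↔ G = ⊥ := by
  classical
  have hspan : polytopeDim (permPolytope G) =
      Module.finrank ℝ (vectorSpan ℝ (Set.range (actMat G.subtype))) := by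
    rw [permPolytope_eq, polytopeDim_convexHull_range]
  rw [hspan, Submodule.finrank_eq_zero, vectorSpan_eq_bot_iff_subsingleton,
      Subgroup.eq_bot_iff_forall]
  constructor
  · intro h x hx
    exact congrArg Subtype.val (actMat_injective G.subtype_injective
      (h ⟨⟨x, hx⟩, rfl⟩ ⟨1, rfl⟩))
  · rintro h _ ⟨a, rfl⟩ _ ⟨b, rfl⟩
    rw [Subtype.ext ((h a a.2).trans (h b b.2).symm)]

open Subgroup in
theorem polytopeDim_permPolytope_eq_one_iff : polytopeDim (permPolytope G) = 1 ↔
    EffectivelyEquivalent G (Subgroup.closure {(c[0, 1] : Equiv.Perm (Fin 2))}) := by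
  classical
  let F : ZMod 2 → Equiv.Perm (Fin 2) := fun e => c[0, 1] ^ e.val
  have hF : ∀ a b, F (a + b) = F a * F b := by decide +kernel
  have hinj : Function.Injective (permHom F hF) := permHom_injective hF (by decide +kernel)
  have hrange : (permHom F hF).range = closure {(c[0, 1] : Equiv.Perm (Fin 2))} := by
    refine permHom_range hF (fun a => pow_mem (subset_closure (by simp)) _) ?_
    rintro s rfl
    exact ⟨(1 : ZMod 2), by decide +kernel⟩
  have hmodel : IsAddModel (Finset.univ : Finset (ZMod 2)) (addCharSet (permHom F hF)) :=
    isAddModel_of_pairing (n := 2) (N := 2) _ (· * ·) add_mul mul_add (by decide +kernel) _ (by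
      change ∀ e : ZMod 2, _ ↔ ∃ j : Fin 2, ∀ a, F a j = j → _
      decide +kernel)
  constructor
  · intro hd
    have hcomm : ∀ g h : G, g * h = h * g := by
      -- A nonabelian group of dimension at most four has dimension exactly four.
      by_contra hG
      have := polytopeDim_eq_of_effectivelyEquivalent
        (effectivelyEquivalent_birkhoff3 (by omega) hG)
      rw [polytopeDim_birkhoff3] at this
      omega
    let _ : CommGroup G := { mul_comm := hcomm }
    rw [permPolytope_eq] at hd
    obtain ⟨X, hX, hgen, -, hsmul, hcard⟩ := exists_finset_addCharSet G.subtype_injective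
    rw [hd] at hcard
    have hm := isAddModel_of_card_eq_two hgen hsmul hcard
    rw [hX] at hm
    obtain ⟨φ, hφ⟩ := exists_mulEquiv_of_dualModel hm.isDualModel hmodel.isDualModel
    exact effectivelyEquivalent_of_affDep_eq hinj hrange φ hφ
  · intro h
    obtain ⟨φ, hφ⟩ := exists_mulEquiv_of_range_eq hinj hrange
    rw [polytopeDim_eq_of_effectivelyEquivalent h, permPolytope_eq_of_mulEquiv _ φ, hφ]
    have := polytopeDim_of_isAddModel hmodel
    rw [Finset.card_univ, ZMod.card] at this
    omega

end SmallDimension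

theorem mainTheorem2 (n : ℕ) (G : Subgroup (Equiv.Perm (Fin n))) :
    (2 ≤ polytopeDim (permPolytope G) → polytopeDim (permPolytope G) ≤ 4 →
      ∃! r : TableRow, EffectivelyEquivalent G r.group) ∧
    (∀ r : TableRow, EffectivelyEquivalent G r.group →
      polytopeDim (permPolytope G) = r.dim ∧
      r.HasCombType (permPolytope G) ∧
      r.HasIsoType G) ∧
    (polytopeDim (permPolytope G) = 0 ↔ G = ⊥) ∧
    (polytopeDim (permPolytope G) = 1 ↔
      EffectivelyEquivalent G (Subgroup.closure {(c[0, 1] : Equiv.Perm (Fin 2))})) := by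
  refine ⟨fun h2 h4 => ?_, fun r => TableRow.spec_of_effectivelyEquivalent,
    polytopeDim_permPolytope_eq_zero_iff G, polytopeDim_permPolytope_eq_one_iff G⟩
  obtain ⟨r, hr⟩ := exists_effectivelyEquivalent_row G h2 h4
  exact ⟨r, hr, fun r' hr' => TableRow.eq_of_effectivelyEquivalent hr' hr⟩
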